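/- **Setting.** Let $a<\alpha<b$, $\Omega^-=(a,\alpha)$, $\Omega^+=(\alpha,b)$, let $\beta=\beta^->0$ on $\Omega^-$ and $\beta=\beta^+>0$ on $\Omega^+$ be constants, and let $\gamma,c\in\mathbb R$. Consider $$-(\beta u')'+\gamma u'+cu=f\ \text{ on }\Omega^-\cup\Omega^+,\qquad u(a)=u(b)=0,\qquad [u(\alpha)]=[\beta u'(\alpha)]=0,$$ where $[\cdot]$ is the jump at $\alpha$. For $m\ge1$ let $\tilde W^{m,\infty}_\beta$ be the space of $v\in C([a,b])$ with $v(a)=v(b)=0$, $v|_{\Omega^\pm}\in W^{m,\infty}(\Omega^\pm)$ and $[\beta v^{(j)}(\alpha)]=0$ for $1\le j\le m-1$, and put $\|v\|_{m,\infty}=\max\{\|v\|_{W^{m,\infty}(\Omega^-)},\|v\|_{W^{m,\infty}(\Omega^+)}\}$, where $\|v\|_{W^{m,\infty}}=\max_{j\le m}\|v^{(j)}\|_{L^\infty}$. Let $a=x_0<x_1<\dots<x_N=b$ be a partition, $\tau_i=(x_{i-1},x_i)$, $h_i=x_i-x_{i-1}$, $h=\max_i h_i$, and let $k$ be such that $x_{k-1}\le\alpha\le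 x_k$; $\tau_k$ is the interface element, the other $\tau_i$ are noninterface elements. The affine map $\xi=(2x-x_{i-1}-x_i)/h_i$ maps $\tau_i$ onto $(-1,1)$; an additional index $i$ or $k$ on a function on $[-1,1]$ denotes its composition with this map. On $[-1,1]$, let $P_n$ be the Legendre polynomials and let $\psi_0=\frac{1-\xi}{2}$, $\psi_1=\frac{1+\xi}{2}$, $\psi_n(\xi)=\int_{-1}^{\xi}P_{n-1}\,dt$ for $n\ge2$. Let $\hat\alpha$ be the image of $\alpha$ under the map of $\tau_k$, let $\hat\beta=\beta^-$ on $(-1,\hat\alpha)$, $\hat\beta=\beta^+$ on $(\hat\alpha,1)$, and $w=1/\hat\beta$. Let $L_n$ be the monic orthogonal polynomials on $[-1,1]$ with weight $w$ (generalized Legendre polynomials), let $\phi_0,\phi_1$ be the continuous functions that are affine on either side of $\hat\alpha$, with $\hat\beta\phi_0',\hat\beta\phi_1'$ constant, $\phi_0(-1)=\phi_1(1)=1$ and $\phi_0(1)=\phi_1(-1)=0$, and let $\phi_n(\xi)=\int_{-1}^{\xi}wL_{n-1}\,dt$ for $n\ge2$ (generalized Lobatto polynomials). The immersed finite element space is $$S_p=\{v\in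 H^1_0(a,b):\ v|_{\tau_i}\in\operatorname{span}\{\psi_{i,n}\}_{n=0}^p\ (i\ne k),\ v|_{\tau_k}\in\operatorname{span}\{\phi_{k,n}\}_{n=0}^p\}.$$ With $(\cdot,\cdot)$ the $L^2(a,b)$ inner product, let $a(v,z)=(\beta v',z')+(\gamma v',z)+(cv,z)$. The immersed finite element (IFE) solution $u_h\in S_p$ satisfies $a(u_h,v)=(f,v)$ for all $v\in S_p$. **Theorem.** Let $p\ge2$ and $\kappa>0$. There is a constant $C>0$ depending only on $p,\beta^-,\beta^+,\gamma,c,\kappa,a,b$ (and not on $\alpha$, the partition, $f$, $u$ or $u_h$) such that the following holds whenever the bilinear form is coercive on $S_p$ with constant $\kappa$, that is, $a(v,v)\ge\kappa(\|v\|_{L^2}^2+\|v'\|_{L^2}^2)$ for all $v\in S_p$, $u\in\tilde W^{p+2,\infty}_\beta$ is the exact solution, and $u_h\in S_p$ is an IFE solution. * At every mesh point $x_j$, $0\le j\le N$: $|(u-u_h)(x_j)|\le Ch^{p+2}\|u\|_{p+2,\infty}$. * On every noninterface element $\tau_i$, $i\ne k$: $|(u-u_h)(l)|\le Ch^{p+2}\|u\|_{p+2,\infty}$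 at every root $l\in[x_{i-1},x_i]$ of $\psi_{i,p+1}$, and $|(u'-u_h')(g)|\le Ch^{p+1}\|u\|_{p+2,\infty}$ at every root $g\in\tau_i$ of $P_{i,p}$. * On the interface element $\tau_k$: $|(u-u_h)(l)|\le Ch^{p+2}\|u\|_{p+2,\infty}$ at every root $l\in[x_{k-1},x_k]$ of $\phi_{k,p+1}$, and $|(\beta u'-\beta u_h')(g)|\le Ch^{p+1}\|u\|_{p+2,\infty}$ at every root $g\in\tau_k$ of $L_{k,p}$, where the fluxes $\beta u'$ and $\beta u_h'$ are extended continuously to $\alpha$. -/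

import Mathlib

open MeasureTheory Set Filter Topology
open scoped ENNReal Polynomial

namespace IFE

noncomputable section

open Polynomial

/-! ### Sobolev spaces on an open set of the real line -/

/-- `g` is the `j`-th weak derivative of `f` on the open set `s`:
`∫_s f η⁽ʲ⁾ = (-1)ʲ ∫_s g η` for all test functions `η ∈ C_c^∞(s)`. -/
def IsWeakDeriv (j : ℕ) (s : Set ℝ) (f g : ℝ → ℝ) : Prop :=
  LocallyIntegrableOn f s ∧ LocallyIntegrableOn g s ∧
    ∀ η : ℝ → ℝ, ContDiff ℝ ((⊤ : ℕ∞) : WithTop ℕ∞) η → HasCompactSupport η → tsupport η ⊆ s →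
      ∫ x in s, f x * iteratedDeriv j η x = (-1) ^ j * ∫ x in s, g x * η x

/-- Membership in `W^{m,q}(s)`: all weak derivatives of order at most `m` exist and lie in
`L^q(s)`. -/
def MemSobolev (m : ℕ) (q : ℝ≥0∞) (s : Set ℝ) (f : ℝ → ℝ) : Prop :=
  ∀ j ≤ m, ∃ g : ℝ → ℝ, IsWeakDeriv j s f g ∧ MemLp g q (volume.restrict s)

open Classical in
/-- A representative of the `j`-th weak derivative (unique up to a null set of `s`). -/
def weakDeriv (j : ℕ) (s : Set ℝ) (f : ℝ → ℝ) : ℝ → ℝ :=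
  if h : ∃ g, IsWeakDeriv j s f g then h.choose else 0

/-- The norm `‖f‖_{m,∞,s} = max_{j ≤ m} ‖f⁽ʲ⁾‖_{L^∞(s)}`. -/
def sobolevNormInfty (m : ℕ) (s : Set ℝ) (f : ℝ → ℝ) : ℝ :=
  ((Finset.range (m + 1)).sup
    fun j => eLpNorm (weakDeriv j s f) ⊤ (volume.restrict s)).toReal

/-- `H^1_0(a,b)`; its elements are identified with their continuous representatives
on `[a,b]`. -/
def MemH10 (a b : ℝ) (v : ℝ → ℝ) : Prop :=
  ContinuousOn v (Icc a b) ∧ v a = 0 ∧ v b = 0 ∧ MemSobolev 1 2 (Ioo a b) v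

/-! ### The interface problem -/

/-- The piecewise constant coefficient with value `βm` to the left of `α` and `βp` to the
right of `α` (the value at the single point `α` plays no role). -/
def betaCoeff (βm βp α x : ℝ) : ℝ := if x < α then βm else βp

/-- The space `W̃_β^{m,q}(a,b)`: continuous functions on `[a,b]` that vanish at `a` and `b`, lie
in `W^{m,q}` on both sides of the interface, and satisfy the jump conditions
`[β v⁽ʲ⁾](α) = 0` for all `1 ≤ j ≤ m - 1` (the derivatives that have traces): the two one-sided
limits of `β v⁽ʲ⁾` at `α` exist and coincide. -/
def MemTildeW (m : ℕ) (q : ℝ≥0∞) (a b α βm βp : ℝ) (v : ℝ → ℝ) : Prop :=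
  ContinuousOn v (Icc a b) ∧ v a = 0 ∧ v b = 0 ∧
    MemSobolev m q (Ioo a α) v ∧ MemSobolev m q (Ioo α b) v ∧
    ∀ j, 1 ≤ j → j < m →
      ∃ l : ℝ, Tendsto (fun x => betaCoeff βm βp α x * iteratedDeriv j v x) (𝓝[≠] α) (𝓝 l)

/-- `‖v‖_{m,∞} = max (‖v‖_{m,∞,(a,α)}, ‖v‖_{m,∞,(α,b)})`. -/
def tildeNormInfty (m : ℕ) (a b α : ℝ) (v : ℝ → ℝ) : ℝ :=
  max (sobolevNormInfty m (Ioo a α) v) (sobolevNormInfty m (Ioo α b) v)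

/-- The differential equation `-(βu')' + γu' + cu = f` on both sides of the interface. -/
def SolvesInterfaceProblem (a b α βm βp γ c : ℝ) (f u : ℝ → ℝ) : Prop :=
  ∀ᵐ x ∂(volume.restrict (Ioo a α ∪ Ioo α b)),
    -deriv (fun y => betaCoeff βm βp α y * deriv u y) x + γ * deriv u x + c * u x = f x

/-- The bilinear form `a(u,v) = (βu',v') + (γu',v) + (cu,v)` (for functions that are
classically differentiable almost everywhere, such as piecewise polynomials). -/
def bilin (a b α βm βp γ c : ℝ) (u v : ℝ → ℝ) : ℝ :=
  (∫ x in a..b, betaCoeff βm βp α x * deriv u x * deriv v x) +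
    (∫ x in a..b, γ * deriv u x * v x) + ∫ x in a..b, c * u x * v x

/-! ### Legendre and Lobatto polynomials on `[-1,1]` -/

/-- Legendre polynomials, by Rodrigues' formula. -/
def legendreP (n : ℕ) : ℝ[X] :=
  C (1 / (2 ^ n * (n.factorial : ℝ))) * derivative^[n] ((X ^ 2 - 1) ^ n)

/-- Lobatto polynomials `ψ_n`. -/
def lobatto : ℕ → ℝ → ℝ
  | 0 => fun ξ => (1 - ξ) / 2
  | 1 => fun ξ => (1 + ξ) / 2
  | n + 2 => fun ξ => ∫ t in (-1 : ℝ)..ξ, (legendreP (n + 1)).eval t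

/-- The inner product `(P,Q)_w = ∫_{-1}^1 w P Q` with weight `w = 1/β̂`, where `β̂` jumps at
the reference interface point `αh`. -/
def wInner (βm βp αh : ℝ) (P Q : ℝ[X]) : ℝ :=
  ∫ ξ in (-1 : ℝ)..1, (betaCoeff βm βp αh ξ)⁻¹ * P.eval ξ * Q.eval ξ

/-- Generalized Legendre polynomials `L_n`: the monic orthogonal polynomials for `wInner`,
constructed by the three-term recurrence. -/
def genLegendre (βm βp αh : ℝ) : ℕ → ℝ[X]
  | 0 => 1
  | 1 => X - C (wInner βm βp αh X 1 / wInner βm βp αh 1 1)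
  | n + 2 =>
    (X - C (wInner βm βp αh (X * genLegendre βm βp αh (n + 1)) (genLegendre βm βp αh (n + 1)) /
        wInner βm βp αh (genLegendre βm βp αh (n + 1)) (genLegendre βm βp αh (n + 1)))) *
        genLegendre βm βp αh (n + 1) -
      C (wInner βm βp αh (genLegendre βm βp αh (n + 1)) (genLegendre βm βp αh (n + 1)) /
        wInner βm βp αh (genLegendre βm βp αh n) (genLegendre βm βp αh n)) *
        genLegendre βm βp αh n

/-- Generalized Lobatto polynomials `φ_n` (piecewise polynomials on `[-1,1]`). -/
def genLobatto (βm βp αh : ℝ) : ℕ → ℝ → ℝ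
  | 0 => fun ξ =>
    if ξ < αh then ((1 - αh) * βm + (αh - ξ) * βp) / ((1 - αh) * βm + (1 + αh) * βp)
    else (1 - ξ) * βm / ((1 - αh) * βm + (1 + αh) * βp)
  | 1 => fun ξ =>
    if ξ < αh then (1 + ξ) * βp / ((1 - αh) * βm + (1 + αh) * βp)
    else ((ξ - αh) * βm + (1 + αh) * βp) / ((1 - αh) * βm + (1 + αh) * βp)
  | n + 2 => fun ξ =>
    ∫ t in (-1 : ℝ)..ξ, (betaCoeff βm βp αh t)⁻¹ * (genLegendre βm βp αh (n + 1)).eval t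

/-! ### Meshes and the immersed finite element space -/

/-- A partition `a = x_0 < x_1 < ⋯ < x_N = b`. -/
structure Mesh (a b : ℝ) where
  N : ℕ
  node : Fin (N + 1) → ℝ
  strictMono : StrictMono node
  node_zero : node 0 = a
  node_last : node (Fin.last N) = b

namespace Mesh

variable {a b : ℝ} (T : Mesh a b)

/-- Left endpoint of an element. -/
def left (i : Fin T.N) : ℝ := T.node i.castSucc

/-- Right endpoint of an element. -/
def right (i : Fin T.N) : ℝ := T.node i.succ

/-- The mesh size `h = max_i h_i`. -/
def meshSize : ℝ := ⨆ i : Fin T.N, (T.right i - T.left i)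

/-- The affine map from the `i`-th element onto the reference interval `[-1,1]`. -/
def toRef (i : Fin T.N) (x : ℝ) : ℝ := (2 * x - T.left i - T.right i) / (T.right i - T.left i)

/-- `P_{i,n}`: Legendre polynomials on the `i`-th element. -/
def legendreOn (i : Fin T.N) (n : ℕ) (x : ℝ) : ℝ := (legendreP n).eval (T.toRef i x)

/-- `ψ_{i,n}`: Lobatto polynomials on the `i`-th element. -/
def lobattoOn (i : Fin T.N) (n : ℕ) (x : ℝ) : ℝ := lobatto n (T.toRef i x)

/-- `L_{k,n}`: generalized Legendre polynomials on the `k`-th element, which contains the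
interface point `α`. -/
def genLegendreOn (βm βp α : ℝ) (k : Fin T.N) (n : ℕ) (x : ℝ) : ℝ :=
  (genLegendre βm βp (T.toRef k α) n).eval (T.toRef k x)

/-- `φ_{k,n}`: generalized Lobatto polynomials on the `k`-th element. -/
def genLobattoOn (βm βp α : ℝ) (k : Fin T.N) (n : ℕ) (x : ℝ) : ℝ :=
  genLobatto βm βp (T.toRef k α) n (T.toRef k x)

/-- The local space `span {ψ_{i,n} : n ≤ p}` on a noninterface element. -/
def localSpace (p : ℕ) (i : Fin T.N) : Submodule ℝ (ℝ → ℝ) :=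
  Submodule.span ℝ {g | ∃ n ≤ p, g = T.lobattoOn i n}

/-- The local space `span {φ_{k,n} : n ≤ p}` on the interface element. -/
def genLocalSpace (βm βp α : ℝ) (p : ℕ) (k : Fin T.N) : Submodule ℝ (ℝ → ℝ) :=
  Submodule.span ℝ {g | ∃ n ≤ p, g = T.genLobattoOn βm βp α k n}

/-- The `p`-th degree immersed finite element space with interface element `k`. -/
def ifeSpace (βm βp α : ℝ) (k : Fin T.N) (p : ℕ) : Set (ℝ → ℝ) :=
  {v | MemH10 a b v ∧
    (∀ i, i ≠ k → ∃ g ∈ T.localSpace p i, EqOn v g (Ioo (T.left i) (T.right i))) ∧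
    ∃ g ∈ T.genLocalSpace βm βp α p k, EqOn v g (Ioo (T.left k) (T.right k))}

/-- `uh` is an immersed finite element solution: `uh ∈ S_p` and `a(uh,v) = (f,v)` for all
`v ∈ S_p`. -/
def IsIFESolution (βm βp γ c α : ℝ) (k : Fin T.N) (p : ℕ) (f uh : ℝ → ℝ) : Prop :=
  uh ∈ T.ifeSpace βm βp α k p ∧
    ∀ v ∈ T.ifeSpace βm βp α k p, bilin a b α βm βp γ c uh v = ∫ x in a..b, f x * v x

/-- The bilinear form is coercive on `S_p` in the `H^1` norm with constant `κ`. -/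
def IsCoercive (βm βp γ c α : ℝ) (k : Fin T.N) (p : ℕ) (κ : ℝ) : Prop :=
  ∀ v ∈ T.ifeSpace βm βp α k p,
    κ * ((∫ x in a..b, v x ^ 2) + ∫ x in a..b, deriv v x ^ 2) ≤ bilin a b α βm βp γ c v v

end Mesh

/-- `q` is the flux `βv'` at `x`. The flux is extended continuously to the interface
point, where `β` and `v'` may jump; at a point `x ≠ α` where `v` is `C^1`, it is `β(x) v'(x)`. -/
def IsFluxAt (βm βp α : ℝ) (v : ℝ → ℝ) (x q : ℝ) : Prop :=
  Tendsto (fun y => betaCoeff βm βp α y * deriv v y) (𝓝[≠] x) (𝓝 q)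

end

end IFE

/-!
Write `w = 1/β`. The jump conditions say exactly that the flux `F = βu'`, extended across the
interface, has `p` derivatives on all of `(a,b)`, the last one Lipschitz (`MemTildeW.exists_flux`),
although `u` itself is only piecewise smooth. Both `u` and the functions of the immersed finite
element space are primitives `∫ w D` of `w` times a flux `D`; for the latter, `D` is an arbitrary
piecewise polynomial of degree less than `p` with `∫ w D = 0` (`Mesh.exists_pw_of_mem_ifeSpace`,
`Mesh.primitive_pw_mem_ifeSpace`). This also holds on the interface element, so interface and
noninterface elements are treated alike, and everything is a question about polynomial
approximation of the smooth function `F` in `L²` with weight `w`.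

Let `ΠF` be the elementwise `w`-weighted `L²` projection of `F` onto polynomials of degree less than
`p`. It is stable in `L^∞` with a constant that depends only on `p` and the bounds of `w`
(`exists_projection_stability`). The primitive `r = ∫ w (F - ΠF)` is of order `h^{p+1}`, and because
the error is orthogonal to constants and, for `p ≥ 2`, to linear functions, `r` vanishes at the nodes
and has mean zero on every element.

With the Galerkin error `e = u - u_h`, integration by parts turns the lower order terms of the
bilinear form into `γe + c∫e` tested against the derivative of the test function. Hence `e - r` is
driven by `γr + c∫r`. The second term is of order `h^{p+2}` since `r` has mean zero on each element.
The first is of order `h^{p+1}` only, but it is removed by the discrete function with flux `Π(γr)`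
(up to a constant): the integral of `wΠ(γr)` over a noninterface element is a multiple of that of
`r`, hence zero, and over the interface element it is bounded by the length of the element, so that
this function is itself of order `h^{p+2}` (`Mesh.IsProj.exists_correction`). Coercivity then gives
`e - r = O(h^{p+2})` (`Mesh.supercloseness`).

The pointwise estimates follow. At the nodes `r = 0`. By Taylor expansion, `F - ΠF` is on each element
a multiple of the orthogonal polynomial of degree `p`, up to `O(h^{p+1})`
(`Mesh.IsProj.exists_expansion`); so `r` gains a power of `h` at the zeros of the primitive of `w`
times that polynomial, which are the (generalized) Lobatto points, and `F - ΠF` gains one at the zeros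
of the polynomial itself. Finally the Galerkin identity determines `ΠF` minus the flux of `u_h` as the
projection of `γe + c∫e` plus a global constant, so that it is of order `h^{p+1}` without any
comparison of the sizes of the elements (`Mesh.abs_projection_sub_flux_le`).
-/

namespace IFE

open Polynomial

/-! ### Locally bounded functions, weights and weighted projections -/

/-- Measurable functions that are bounded on bounded sets. -/
structure LocBdd (g : ℝ → ℝ) : Prop where
  meas : Measurable g
  bdd : ∀ R : ℝ, ∃ C : ℝ, ∀ x, |x| ≤ R → |g x| ≤ C

namespace LocBdd

variable {g k : ℝ → ℝ}

theorem of_continuous (hg : Continuous g) : LocBdd g := by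
  refine ⟨hg.measurable, fun R => ?_⟩
  obtain ⟨C, hC⟩ := (isCompact_Icc (a := -R) (b := R)).exists_bound_of_continuousOn hg.continuousOn
  exact ⟨C, fun x hx => hC x (abs_le.1 hx)⟩

theorem const (r : ℝ) : LocBdd fun _ => r := of_continuous continuous_const

theorem eval (Q : ℝ[X]) : LocBdd fun x => Q.eval x := of_continuous Q.continuous

theorem add (hg : LocBdd g) (hk : LocBdd k) : LocBdd fun x => g x + k x := by
  refine ⟨hg.meas.add hk.meas, fun R => ?_⟩
  obtain ⟨C, hC⟩ := hg.bdd R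
  obtain ⟨D, hD⟩ := hk.bdd R
  exact ⟨C + D, fun x hx => (abs_add_le _ _).trans (add_le_add (hC x hx) (hD x hx))⟩

theorem neg (hg : LocBdd g) : LocBdd fun x => -g x := by
  refine ⟨hg.meas.neg, fun R => ?_⟩
  obtain ⟨C, hC⟩ := hg.bdd R
  exact ⟨C, fun x hx => by simpa using hC x hx⟩

theorem sub (hg : LocBdd g) (hk : LocBdd k) : LocBdd fun x => g x - k x := by
  simpa [sub_eq_add_neg] using hg.add hk.neg

theorem mul (hg : LocBdd g) (hk : LocBdd k) : LocBdd fun x => g x * k x := by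
  refine ⟨hg.meas.mul hk.meas, fun R => ?_⟩
  obtain ⟨C, hC⟩ := hg.bdd R
  obtain ⟨D, hD⟩ := hk.bdd R
  refine ⟨C * D, fun x hx => ?_⟩
  rw [abs_mul]
  exact mul_le_mul (hC x hx) (hD x hx) (abs_nonneg _) ((abs_nonneg _).trans (hC x hx))

theorem const_mul (r : ℝ) (hg : LocBdd g) : LocBdd fun x => r * g x := (const r).mul hg

theorem abs (hg : LocBdd g) : LocBdd fun x => |g x| :=
  ⟨continuous_abs.measurable.comp hg.meas, fun R => by simpa using hg.bdd R⟩

theorem indicator (hg : LocBdd g) {s : Set ℝ} (hs : MeasurableSet s) : LocBdd (s.indicator g) := by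
  refine ⟨hg.meas.indicator hs, fun R => ?_⟩
  obtain ⟨C, hC⟩ := hg.bdd R
  refine ⟨C, fun x hx => ?_⟩
  by_cases h : x ∈ s
  · simpa [h] using hC x hx
  · simpa [h] using (abs_nonneg _).trans (hC x hx)

theorem sum {ι : Type*} {s : Finset ι} {g : ι → ℝ → ℝ} (hg : ∀ i ∈ s, LocBdd (g i)) :
    LocBdd fun x => ∑ i ∈ s, g i x := by
  classical
  induction s using Finset.induction_on with
  | empty => simpa using const 0
  | insert i s hi ih =>
    simp_rw [Finset.sum_insert hi]
    exact (hg i (by simp)).add (ih fun j hj => hg j (by simp [hj]))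

theorem intervalIntegrable (hg : LocBdd g) (a b : ℝ) : IntervalIntegrable g volume a b := by
  obtain ⟨C, hC⟩ := hg.bdd (max |a| |b|)
  rw [intervalIntegrable_iff]
  refine Measure.integrableOn_of_bounded (M := C) (by simp) hg.meas.aestronglyMeasurable ?_
  refine (ae_restrict_mem measurableSet_uIoc).mono fun x hx => hC x ?_
  have := uIoc_subset_uIcc hx
  rcases le_total a b with h | h
  · rw [uIcc_of_le h] at this
    exact abs_le_max_abs_abs this.1 this.2
  · rw [uIcc_of_ge h] at this
    rw [max_comm]
    exact abs_le_max_abs_abs this.1 this.2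

theorem continuous_primitive (hg : LocBdd g) (a : ℝ) : Continuous fun x => ∫ t in a..x, g t :=
  intervalIntegral.continuous_primitive (fun _ _ => hg.intervalIntegrable _ _) a

theorem primitive (hg : LocBdd g) (a : ℝ) : LocBdd fun x => ∫ t in a..x, g t :=
  of_continuous (hg.continuous_primitive a)

theorem locallyIntegrable (hg : LocBdd g) : LocallyIntegrable g volume := by
  rw [locallyIntegrable_iff]
  intro K hK
  obtain ⟨R, hR⟩ := hK.isBounded.exists_norm_le
  obtain ⟨C, hC⟩ := hg.bdd R
  refine Measure.integrableOn_of_bounded (M := C) hK.measure_lt_top.ne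
    hg.meas.aestronglyMeasurable ?_
  exact (ae_restrict_mem hK.measurableSet).mono fun x hx => hC x (hR x hx)

/-- Lebesgue differentiation theorem for primitives. -/
theorem ae_hasDerivAt (hg : LocBdd g) (a : ℝ) :
    ∀ᵐ x, HasDerivAt (fun x => ∫ t in a..x, g t) (g x) x :=
  (_root_.LocallyIntegrable.ae_hasDerivAt_integral hg.locallyIntegrable).mono fun _ h => h a

/-- Integration by parts for primitives of locally bounded functions. -/
theorem integral_primitive_mul (hg : LocBdd g) (hk : LocBdd k) (a b : ℝ) :
    ∫ x in a..b, (∫ t in a..x, g t) * k x =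
      (∫ x in a..b, g x) * (∫ x in a..b, k x) - ∫ x in a..b, g x * ∫ t in a..x, k t := by
  have hG := (hg.intervalIntegrable a b).absolutelyContinuousOnInterval_intervalIntegral
    (c := a) (by simp)
  have hK := (hk.intervalIntegrable a b).absolutelyContinuousOnInterval_intervalIntegral
    (c := a) (by simp)
  have h := hG.integral_mul_deriv_eq_deriv_mul hK
  simp only [intervalIntegral.integral_same, mul_zero, sub_zero] at h
  rw [← intervalIntegral.integral_congr_ae (f := fun x => (∫ t in a..x, g t) *
    deriv (fun x => ∫ t in a..x, k t) x), h, intervalIntegral.integral_congr_ae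
    (f := fun x => deriv (fun x => ∫ t in a..x, g t) x * ∫ t in a..x, k t)]
  · filter_upwards [hg.ae_hasDerivAt a] with x hx _
    rw [hx.deriv]
  · filter_upwards [hk.ae_hasDerivAt a] with x hx _
    rw [hx.deriv]

theorem abs_integral_le (hg : LocBdd g) {l r B : ℝ} (hlr : l ≤ r)
    (hB : ∀ x ∈ Ioo l r, |g x| ≤ B) : |∫ x in l..r, g x| ≤ B * (r - l) := by
  have h := intervalIntegral.abs_integral_le_integral_abs (f := g) (μ := volume) hlr
  refine h.trans ?_
  have : ∫ x in l..r, |g x| ≤ ∫ _ in l..r, B := by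
    refine intervalIntegral.integral_mono_on_of_le_Ioo hlr (hg.abs.intervalIntegrable _ _)
      (by simp) hB
  simpa [mul_comm] using this

theorem integral_add_adjacent (hg : LocBdd g) (a b c : ℝ) :
    (∫ x in a..b, g x) + ∫ x in b..c, g x = ∫ x in a..c, g x :=
  intervalIntegral.integral_add_adjacent_intervals (hg.intervalIntegrable _ _)
    (hg.intervalIntegrable _ _)

theorem integral_add (hg : LocBdd g) (hk : LocBdd k) (a b : ℝ) :
    ∫ x in a..b, (g x + k x) = (∫ x in a..b, g x) + ∫ x in a..b, k x :=
  intervalIntegral.integral_add (hg.intervalIntegrable _ _) (hk.intervalIntegrable _ _)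

theorem integral_sub (hg : LocBdd g) (hk : LocBdd k) (a b : ℝ) :
    ∫ x in a..b, (g x - k x) = (∫ x in a..b, g x) - ∫ x in a..b, k x :=
  intervalIntegral.integral_sub (hg.intervalIntegrable _ _) (hk.intervalIntegrable _ _)

theorem integral_mono (hg : LocBdd g) (hk : LocBdd k) {a b : ℝ} (hab : a ≤ b)
    (h : ∀ x ∈ Ioo a b, g x ≤ k x) : ∫ x in a..b, g x ≤ ∫ x in a..b, k x :=
  intervalIntegral.integral_mono_on_of_le_Ioo hab (hg.intervalIntegrable _ _)
    (hk.intervalIntegrable _ _) h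

end LocBdd

theorem integral_congr_Ioo {g k : ℝ → ℝ} {l r : ℝ} (hlr : l ≤ r)
    (h : ∀ x ∈ Ioo l r, g x = k x) : ∫ x in l..r, g x = ∫ x in l..r, k x := by
  refine intervalIntegral.integral_congr_ae ?_
  have : ∀ᵐ x : ℝ, x ≠ r := by simp [ae_iff]
  filter_upwards [this] with x hx hx'
  rw [uIoc_of_le hlr] at hx'
  exact h x ⟨hx'.1, lt_of_le_of_ne hx'.2 hx⟩

/-- A weight with uniform positive lower and upper bounds. -/
structure IsWeight (w : ℝ → ℝ) (w₀ w₁ : ℝ) : Prop where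
  locBdd : LocBdd w
  pos : 0 < w₀
  le : ∀ x, w₀ ≤ w x
  ge : ∀ x, w x ≤ w₁

namespace IsWeight

variable {w : ℝ → ℝ} {w₀ w₁ : ℝ}

theorem pos' (hw : IsWeight w w₀ w₁) (x : ℝ) : 0 < w x := hw.pos.trans_le (hw.le x)

theorem le_w₁ (hw : IsWeight w w₀ w₁) : w₀ ≤ w₁ := (hw.le 0).trans (hw.ge 0)

theorem w₁_pos (hw : IsWeight w w₀ w₁) : 0 < w₁ := hw.pos.trans_le hw.le_w₁

theorem abs_le (hw : IsWeight w w₀ w₁) (x : ℝ) : |w x| ≤ w₁ := by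
  rw [abs_of_pos (hw.pos' x)]
  exact hw.ge x

end IsWeight

/-- Scale-invariant inverse estimate between the sup norm and the `L²` norm on polynomials of
degree less than `p`; the constant comes from compactness of the unit sphere of the coefficient
space. -/
theorem exists_inverse_estimate (p : ℕ) : ∃ S : ℝ, 0 < S ∧ ∀ Q ∈ degreeLT ℝ p, ∀ l r : ℝ, l < r →
    ∀ x ∈ Icc l r, Q.eval x ^ 2 * (r - l) ≤ S * ∫ t in l..r, Q.eval t ^ 2 := by
  classical
  let P : (Fin p → ℝ) → ℝ[X] := fun c => ∑ i : Fin p, C (c i) * X ^ (i : ℕ)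
  have hPeval : ∀ c x, (P c).eval x = ∑ i : Fin p, c i * x ^ (i : ℕ) := by
    intro c x; simp [P, eval_finsetSum]
  let Φ : (Fin p → ℝ) → ℝ := fun c => ∫ t in (0:ℝ)..1, (P c).eval t ^ 2
  have hΦc : Continuous Φ := by
    apply intervalIntegral.continuous_parametric_intervalIntegral_of_continuous'
    simp only [Function.uncurry_def, hPeval]
    fun_prop
  have hΦ0 : ∀ c, 0 ≤ Φ c := fun c =>
    intervalIntegral.integral_nonneg (by norm_num) fun t _ => sq_nonneg _
  have hcoef : ∀ c (i : Fin p), (P c).coeff i = c i := by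
    intro c i
    simp only [P, finsetSum_coeff, coeff_C_mul, coeff_X_pow]
    rw [Finset.sum_eq_single i]
    · simp
    · intro j _ hj
      have : ¬ ((i : ℕ) = j) := fun h => hj (Fin.ext h.symm)
      simp [this]
    · simp
  have hpos : ∀ c, c ≠ 0 → 0 < Φ c := by
    intro c hc
    refine lt_of_le_of_ne (hΦ0 c) fun h => hc ?_
    have hz : P c = 0 := by
      refine eq_zero_of_infinite_isRoot _ ((Ioo_infinite (zero_lt_one' ℝ)).mono fun x hx => ?_)
      by_contra hne
      have : 0 < Φ c := by
        refine intervalIntegral.integral_pos zero_lt_one (by fun_prop)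
          (fun t _ => sq_nonneg _) ⟨x, ⟨hx.1.le, hx.2.le⟩, ?_⟩
        exact pow_pos (abs_pos.2 hne) 2 |>.trans_eq (sq_abs _)
      exact this.ne h
    funext i
    rw [← hcoef c i, hz]; simp
  -- The sphere is empty for `p = 0`.
  obtain ⟨m, hm, hmle⟩ : ∃ m : ℝ, 0 < m ∧ ∀ c ∈ Metric.sphere (0 : Fin p → ℝ) 1, m ≤ Φ c := by
    rcases (Metric.sphere (0 : Fin p → ℝ) 1).eq_empty_or_nonempty with h | h
    · exact ⟨1, one_pos, by simp [h]⟩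
    · obtain ⟨c, hc, hmin⟩ := (isCompact_sphere (0 : Fin p → ℝ) 1).exists_isMinOn h hΦc.continuousOn
      refine ⟨Φ c, hpos c ?_, fun d hd => hmin hd⟩
      rintro rfl
      simp at hc
  have hhom : ∀ c, m * ‖c‖ ^ 2 ≤ Φ c := by
    intro c
    rcases eq_or_ne c 0 with rfl | hc
    · simpa using hΦ0 0
    have hn : 0 < ‖c‖ := norm_pos_iff.2 hc
    have h1 := hmle (‖c‖⁻¹ • c) (by simp [norm_smul, hn.ne'])
    have h2 : Φ (‖c‖⁻¹ • c) = (‖c‖⁻¹) ^ 2 * Φ c := by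
      simp only [Φ, hPeval, ← intervalIntegral.integral_const_mul]
      congr 1; funext t
      rw [← mul_pow, Finset.mul_sum]
      simp [mul_assoc]
    rw [h2] at h1
    have := mul_le_mul_of_nonneg_right h1 (sq_nonneg ‖c‖)
    calc m * ‖c‖ ^ 2 ≤ _ := this
      _ = Φ c := by field_simp
  have hunit : ∀ Q ∈ degreeLT ℝ p, ∀ x ∈ Icc (0:ℝ) 1,
      Q.eval x ^ 2 ≤ ((p : ℝ) ^ 2 + 1) / m * ∫ t in (0:ℝ)..1, Q.eval t ^ 2 := by
    intro Q hQ x hx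
    set c : Fin p → ℝ := fun i => Q.coeff i with hcdef
    have hQP : Q = P c := by
      simp only [P, hcdef]
      rw [Fin.sum_univ_eq_sum_range (fun i => C (Q.coeff i) * X ^ i) p]
      ext n
      simp only [finsetSum_coeff, coeff_C_mul, coeff_X_pow]
      simp only [mul_ite, mul_one, mul_zero, Finset.sum_ite_eq, Finset.mem_range]
      split_ifs with hn
      · rfl
      · exact coeff_eq_zero_of_degree_lt ((mem_degreeLT.1 hQ).trans_le (by exact_mod_cast not_lt.1 hn))
    have h1 : |Q.eval x| ≤ p * ‖c‖ := by
      rw [hQP, hPeval]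
      refine (Finset.abs_sum_le_sum_abs _ _).trans ?_
      have : ∀ i ∈ (Finset.univ : Finset (Fin p)), |c i * x ^ (i : ℕ)| ≤ ‖c‖ := by
        intro i _
        rw [abs_mul, abs_pow, abs_of_nonneg hx.1]
        calc |c i| * x ^ (i : ℕ) ≤ ‖c‖ * 1 :=
              mul_le_mul (norm_le_pi_norm c i) (pow_le_one₀ hx.1 hx.2) (pow_nonneg hx.1 _)
                (norm_nonneg _)
          _ = ‖c‖ := mul_one _
      simpa using Finset.sum_le_card_nsmul _ _ _ this
    have h2 : Q.eval x ^ 2 ≤ (p * ‖c‖) ^ 2 := by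
      rw [← sq_abs]
      exact pow_le_pow_left₀ (abs_nonneg _) h1 2
    have h3 : m * ‖c‖ ^ 2 ≤ ∫ t in (0:ℝ)..1, Q.eval t ^ 2 := by
      rw [hQP]; exact hhom c
    rw [div_mul_eq_mul_div, le_div_iff₀ hm]
    have := sq_nonneg ‖c‖
    nlinarith [mul_le_mul_of_nonneg_left h3 (sq_nonneg (p : ℝ)), hΦ0 c]
  refine ⟨((p : ℝ) ^ 2 + 1) / m, by positivity, fun Q hQ l r hlr x hx => ?_⟩
  have hd : 0 < r - l := sub_pos.2 hlr
  -- Transport of the estimate on `[0,1]` to `[l,r]` by an affine substitution.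
  have hmem : Q.comp (C (r - l) * X + C l) ∈ degreeLT ℝ p := by
    rcases eq_or_ne Q 0 with rfl | hQ0
    · simp
    rw [mem_degreeLT] at hQ ⊢
    refine lt_of_le_of_lt ?_ hQ
    have : (Q.comp (C (r - l) * X + C l)).natDegree = Q.natDegree := by
      rw [natDegree_comp, natDegree_linear hd.ne', mul_one]
    rw [degree_eq_natDegree hQ0, ← this]
    exact degree_le_natDegree
  have h := hunit _ hmem ((x - l) / (r - l))
    ⟨div_nonneg (sub_nonneg.2 hx.1) hd.le, (div_le_one hd).2 (by linarith [hx.2])⟩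
  have e1 : (Q.comp (C (r - l) * X + C l)).eval ((x - l) / (r - l)) = Q.eval x := by
    simp only [eval_comp, eval_add, eval_mul, eval_C, eval_X]
    congr 1; field_simp; ring
  have e2 : ∫ t in (0:ℝ)..1, (Q.comp (C (r - l) * X + C l)).eval t ^ 2 =
      (r - l)⁻¹ * ∫ t in l..r, Q.eval t ^ 2 := by
    simp only [eval_comp, eval_add, eval_mul, eval_C, eval_X]
    rw [intervalIntegral.integral_comp_mul_add (fun t => Q.eval t ^ 2) hd.ne' l]
    simp
  rw [e1, e2] at h
  calc Q.eval x ^ 2 * (r - l) ≤ _ := mul_le_mul_of_nonneg_right h hd.le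
    _ = _ := by field_simp

section Projection

variable {w : ℝ → ℝ} {w₀ w₁ : ℝ}

/-- `L^∞` stability of the weighted `L²` projection onto polynomials of degree less than `p`, with
a constant that depends only on `p` and the bounds of the weight. -/
theorem exists_projection_stability (p : ℕ) {w₀ w₁ : ℝ} (hw₀ : 0 < w₀) (hw₁ : 0 < w₁) :
    ∃ S : ℝ, 0 < S ∧
    ∀ w, IsWeight w w₀ w₁ → ∀ l r : ℝ, l < r → ∀ Q ∈ degreeLT ℝ p, ∀ g, LocBdd g → ∀ B : ℝ,
      (∀ x ∈ Ioo l r, |g x| ≤ B) →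
      (∀ q ∈ degreeLT ℝ p, ∫ x in l..r, w x * Q.eval x * q.eval x =
        ∫ x in l..r, w x * g x * q.eval x) →
      ∀ x ∈ Icc l r, |Q.eval x| ≤ S * B := by
  obtain ⟨S, hS, hinv⟩ := exists_inverse_estimate p
  refine ⟨S * w₁ / w₀, by positivity, fun w hw l r hlr Q hQ g hg B hB horth x hx => ?_⟩
  obtain ⟨y, hy, hmax⟩ := (isCompact_Icc (a := l) (b := r)).exists_isMaxOn
    (nonempty_Icc.2 hlr.le) (f := fun x => |Q.eval x|) (by fun_prop)
  have hd : 0 < r - l := sub_pos.2 hlr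
  have hB0 : 0 ≤ B := (abs_nonneg _).trans (hB ((l + r) / 2) ⟨by linarith, by linarith⟩)
  refine (hmax hx).trans ?_
  change |Q.eval y| ≤ _
  set m := |Q.eval y| with hm
  have hm0 : 0 ≤ m := abs_nonneg _
  have h1 : m ^ 2 * (r - l) ≤ S * ∫ t in l..r, Q.eval t ^ 2 := by
    rw [hm, sq_abs]; exact hinv Q hQ l r hlr y hy
  have h2 : w₀ * ∫ t in l..r, Q.eval t ^ 2 ≤ ∫ x in l..r, w x * Q.eval x * Q.eval x := by
    rw [← intervalIntegral.integral_const_mul]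
    refine LocBdd.integral_mono ?_ ((hw.locBdd.mul (.eval Q)).mul (.eval Q)) hlr.le fun t _ => ?_
    · exact .of_continuous (by fun_prop)
    · nlinarith [hw.le t, sq_nonneg (Q.eval t)]
  have h3 : ∫ x in l..r, w x * g x * Q.eval x ≤ w₁ * B * m * (r - l) := by
    refine (le_abs_self _).trans
      (((hw.locBdd.mul hg).mul (.eval Q)).abs_integral_le hlr.le fun t ht => ?_)
    rw [abs_mul, abs_mul]
    have := hw.w₁_pos
    exact mul_le_mul (mul_le_mul (hw.abs_le t) (hB t ht) (abs_nonneg _) this.le)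
      (hmax (Ioo_subset_Icc_self ht)) (abs_nonneg _) (by positivity)
  rw [← horth Q hQ] at h3
  rcases hm0.eq_or_lt with h0 | h0
  · rw [← h0]; positivity
  -- The maximum `m` of `|Q|` and the length of the interval cancel in
  -- `w₀ m² (r - l) ≤ S ∫ w Q² = S ∫ w g Q ≤ S w₁ B m (r - l)`.
  have h4 : w₀ * (m ^ 2 * (r - l)) ≤ S * (w₁ * B * m * (r - l)) := by
    calc w₀ * (m ^ 2 * (r - l)) ≤ w₀ * (S * ∫ t in l..r, Q.eval t ^ 2) :=
          mul_le_mul_of_nonneg_left h1 hw₀.le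
      _ = S * (w₀ * ∫ t in l..r, Q.eval t ^ 2) := by ring
      _ ≤ _ := mul_le_mul_of_nonneg_left (h2.trans h3) hS.le
  have h5 : w₀ * m ≤ S * w₁ * B := by
    refine le_of_mul_le_mul_right ?_ (mul_pos h0 hd)
    nlinarith
  rw [div_mul_eq_mul_div, le_div_iff₀ hw₀]
  linarith

theorem eq_zero_of_integral_weight_sq (hw : IsWeight w w₀ w₁) {l r : ℝ} (hlr : l < r) {Q : ℝ[X]}
    (h : ∫ x in l..r, w x * Q.eval x * Q.eval x = 0) : Q = 0 := by
  have h2 : w₀ * ∫ t in l..r, Q.eval t ^ 2 ≤ ∫ x in l..r, w x * Q.eval x * Q.eval x := by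
    rw [← intervalIntegral.integral_const_mul]
    refine LocBdd.integral_mono ?_ ((hw.locBdd.mul (.eval Q)).mul (.eval Q)) hlr.le fun t _ => ?_
    · exact .of_continuous (by fun_prop)
    · nlinarith [hw.le t, sq_nonneg (Q.eval t)]
  refine eq_zero_of_infinite_isRoot _ ((Ioo_infinite hlr).mono fun x hx => ?_)
  by_contra hne
  have : 0 < ∫ t in l..r, Q.eval t ^ 2 := by
    refine intervalIntegral.integral_pos hlr (by fun_prop)
      (fun t _ => sq_nonneg _) ⟨x, ⟨hx.1.le, hx.2.le⟩, ?_⟩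
    exact pow_pos (abs_pos.2 hne) 2 |>.trans_eq (sq_abs _)
  have := mul_pos hw.pos this
  linarith

/-- Existence of the weighted `L²` projection onto polynomials of degree less than `p`. -/
theorem exists_projection (hw : IsWeight w w₀ w₁) (p : ℕ) {l r : ℝ} (hlr : l < r) {g : ℝ → ℝ}
    (hg : LocBdd g) :
    ∃ Q ∈ degreeLT ℝ p, ∀ q ∈ degreeLT ℝ p,
      ∫ x in l..r, w x * Q.eval x * q.eval x = ∫ x in l..r, w x * g x * q.eval x := by
  have hint : ∀ P q : ℝ[X], LocBdd fun x => w x * P.eval x * q.eval x := fun P q =>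
    (hw.locBdd.mul (.eval P)).mul (.eval q)
  let B : degreeLT ℝ p →ₗ[ℝ] Module.Dual ℝ (degreeLT ℝ p) :=
    LinearMap.mk₂ ℝ (fun P q => ∫ x in l..r, w x * (P : ℝ[X]).eval x * (q : ℝ[X]).eval x)
      (fun P P' q => by
        rw [← (hint _ _).integral_add (hint _ _)]
        congr 1; funext x; simp; ring)
      (fun s P q => by
        rw [smul_eq_mul, ← intervalIntegral.integral_const_mul]
        congr 1; funext x; simp; ring)
      (fun P q q' => by
        rw [← (hint _ _).integral_add (hint _ _)]
        congr 1; funext x; simp; ring)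
      (fun s P q => by
        rw [smul_eq_mul, ← intervalIntegral.integral_const_mul]
        congr 1; funext x; simp; ring)
  have hinj : Function.Injective B := by
    rw [injective_iff_map_eq_zero]
    intro P hP
    have : B P P = 0 := by rw [hP]; rfl
    exact Subtype.ext (eq_zero_of_integral_weight_sq hw hlr this)
  -- The weighted inner product is definite, so every functional on the finite-dimensional space is
  -- represented.
  have hsurj : Function.Surjective B :=
    (LinearMap.injective_iff_surjective_of_finrank_eq_finrank
      Subspace.dual_finrank_eq.symm).1 hinj
  let φ : Module.Dual ℝ (degreeLT ℝ p) :=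
    { toFun := fun q => ∫ x in l..r, w x * g x * (q : ℝ[X]).eval x
      map_add' := fun q q' => by
        rw [← ((hw.locBdd.mul hg).mul (.eval _)).integral_add ((hw.locBdd.mul hg).mul (.eval _))]
        congr 1; funext x; simp; ring
      map_smul' := fun s q => by
        rw [smul_eq_mul, ← intervalIntegral.integral_const_mul]
        congr 1; funext x; simp; ring }
  obtain ⟨Q, hQ⟩ := hsurj φ
  exact ⟨Q, Q.2, fun q hq => LinearMap.congr_fun hQ ⟨q, hq⟩⟩

end Projection

/-! ### Legendre and generalized Legendre polynomials -/

theorem isWeight_betaCoeff_inv {βm βp : ℝ} (hβm : 0 < βm) (hβp : 0 < βp) (α : ℝ) :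
    IsWeight (fun x => (betaCoeff βm βp α x)⁻¹) (min βm⁻¹ βp⁻¹) (max βm⁻¹ βp⁻¹) where
  locBdd := by
    refine ⟨?_, fun R => ⟨max βm⁻¹ βp⁻¹, fun x _ => ?_⟩⟩
    · exact (Measurable.ite measurableSet_Iio measurable_const measurable_const).inv
    · have := inv_pos.2 hβm
      have := inv_pos.2 hβp
      unfold betaCoeff
      split_ifs
      · rw [abs_of_pos (by assumption)]; exact le_max_left _ _
      · rw [abs_of_pos (by assumption)]; exact le_max_right _ _
  pos := lt_min (inv_pos.2 hβm) (inv_pos.2 hβp)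
  le x := by
    unfold betaCoeff
    split_ifs
    · exact min_le_left _ _
    · exact min_le_right _ _
  ge x := by
    unfold betaCoeff
    split_ifs
    · exact le_max_left _ _
    · exact le_max_right _ _

theorem mem_degreeLT_iff_coeff {p : ℕ} {Q : ℝ[X]} :
    Q ∈ degreeLT ℝ p ↔ ∀ m, p ≤ m → Q.coeff m = 0 := by
  rw [mem_degreeLT, degree_lt_iff_coeff_zero]

/-- A polynomial of degree at most `n` is a multiple of a given polynomial of exact degree `n` plus
a polynomial of lower degree. -/
theorem exists_eq_smul_add {n : ℕ} {A : ℝ[X]} (hA : A.natDegree = n) (hA0 : A ≠ 0) {Q : ℝ[X]}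
    (hQ : Q ∈ degreeLT ℝ (n + 1)) : ∃ (s : ℝ) (q : ℝ[X]), q ∈ degreeLT ℝ n ∧ Q = C s * A + q := by
  have hlead : A.coeff n ≠ 0 := by
    rw [← hA]; exact leadingCoeff_ne_zero.2 hA0
  refine ⟨Q.coeff n / A.coeff n, Q - C (Q.coeff n / A.coeff n) * A, ?_, by ring⟩
  rw [mem_degreeLT_iff_coeff] at hQ ⊢
  intro m hm
  rw [coeff_sub, coeff_C_mul]
  rcases hm.eq_or_lt with rfl | hm
  · field_simp; ring
  · rw [hQ m hm, coeff_eq_zero_of_natDegree_lt (by omega : A.natDegree < m)]; ring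

theorem mul_X_mem_degreeLT {n : ℕ} {q : ℝ[X]} (hq : q ∈ degreeLT ℝ n) :
    X * q ∈ degreeLT ℝ (n + 1) := by
  rw [mem_degreeLT_iff_coeff] at hq ⊢
  intro m hm
  obtain ⟨m, rfl⟩ : ∃ k, m = k + 1 := ⟨m - 1, by omega⟩
  rw [coeff_X_mul]
  exact hq m (by omega)

theorem mem_degreeLT_of_natDegree {n : ℕ} {q : ℝ[X]} (hq : q.natDegree < n) :
    q ∈ degreeLT ℝ n := by
  rw [mem_degreeLT_iff_coeff]
  exact fun m hm => coeff_eq_zero_of_natDegree_lt (hq.trans_le hm)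

theorem derivative_mem_degreeLT {n : ℕ} {q : ℝ[X]} (hq : q ∈ degreeLT ℝ (n + 1)) :
    derivative q ∈ degreeLT ℝ n := by
  rw [mem_degreeLT_iff_coeff] at hq ⊢
  intro m hm
  rw [coeff_derivative, hq _ (by omega), zero_mul]

theorem comp_linear_mem_degreeLT {n : ℕ} {q : ℝ[X]} (hq : q ∈ degreeLT ℝ n) (c d : ℝ) :
    q.comp (C c * X + C d) ∈ degreeLT ℝ n := by
  rcases eq_or_ne q 0 with rfl | hq0
  · simp
  have h1 : q.natDegree < n := (natDegree_lt_iff_degree_lt hq0).2 (mem_degreeLT.1 hq)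
  refine mem_degreeLT_of_natDegree (lt_of_le_of_lt (natDegree_comp_le.trans ?_) h1)
  calc q.natDegree * (C c * X + C d).natDegree ≤ q.natDegree * 1 :=
        Nat.mul_le_mul_left _ natDegree_linear_le
    _ = q.natDegree := mul_one _

section Legendre

theorem natDegree_sq_sub_one_pow (n : ℕ) : ((X ^ 2 - 1 : ℝ[X]) ^ n).natDegree = 2 * n := by
  have : (X ^ 2 - 1 : ℝ[X]) = X ^ 2 - C 1 := by simp
  rw [natDegree_pow, this, natDegree_X_pow_sub_C, mul_comm]

theorem monic_sq_sub_one_pow (n : ℕ) : ((X ^ 2 - 1 : ℝ[X]) ^ n).Monic := by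
  have : (X ^ 2 - 1 : ℝ[X]) = X ^ 2 - C 1 := by simp
  rw [this]
  exact (monic_X_pow_sub_C 1 two_ne_zero).pow n

theorem coeff_legendreP_ne_zero (n : ℕ) : (legendreP n).coeff n ≠ 0 := by
  rw [legendreP, coeff_C_mul, coeff_iterate_derivative]
  have h : ((X ^ 2 - 1 : ℝ[X]) ^ n).coeff (n + n) = 1 := by
    have := (monic_sq_sub_one_pow n).coeff_natDegree
    rwa [natDegree_sq_sub_one_pow, two_mul] at this
  rw [h]
  have h2 : (n + n).descFactorial n ≠ 0 := by
    rw [Ne, Nat.descFactorial_eq_zero_iff_lt]; omega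
  simp only [nsmul_eq_mul, mul_one]
  have : (n.factorial : ℝ) ≠ 0 := by exact_mod_cast n.factorial_ne_zero
  have h3 : (((n + n).descFactorial n : ℕ) : ℝ) ≠ 0 := by exact_mod_cast h2
  positivity

theorem legendreP_ne_zero (n : ℕ) : legendreP n ≠ 0 := fun h =>
  coeff_legendreP_ne_zero n (by simp [h])

theorem natDegree_legendreP (n : ℕ) : (legendreP n).natDegree = n := by
  refine le_antisymm ?_ (le_natDegree_of_ne_zero (coeff_legendreP_ne_zero n))
  refine (natDegree_C_mul_le _ _).trans ((natDegree_iterate_derivative _ _).trans ?_)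
  rw [natDegree_sq_sub_one_pow]; omega

theorem legendreP_zero : legendreP 0 = 1 := by simp [legendreP]

theorem eval_iterate_derivative_sq_sub_one_pow {n k : ℕ} (hk : k < n) {x : ℝ}
    (hx : x ^ 2 = 1) : (derivative^[k] ((X ^ 2 - 1 : ℝ[X]) ^ n)).eval x = 0 := by
  have hdvd : (X - C x) ∣ (X ^ 2 - 1 : ℝ[X]) := by
    rw [dvd_iff_isRoot]; simp [hx]
  have h := pow_sub_dvd_iterate_derivative_of_pow_dvd k (pow_dvd_pow_of_dvd hdvd n)
  have h2 : (X - C x) ∣ derivative^[k] ((X ^ 2 - 1 : ℝ[X]) ^ n) :=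
    (dvd_pow_self _ (by omega)).trans h
  exact dvd_iff_isRoot.1 h2

/-- Orthogonality of the Legendre polynomials, by repeated integration by parts in Rodrigues'
formula. -/
theorem integral_legendreP_mul (n : ℕ) {q : ℝ[X]} (hq : q ∈ degreeLT ℝ n) :
    ∫ t in (-1 : ℝ)..1, (legendreP n).eval t * q.eval t = 0 := by
  have key : ∀ k ≤ n, ∀ q ∈ degreeLT ℝ k,
      ∫ t in (-1 : ℝ)..1, (derivative^[k] ((X ^ 2 - 1 : ℝ[X]) ^ n)).eval t * q.eval t = 0 := by
    intro k
    induction k with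
    | zero =>
      intro _ q hq
      have : q = 0 := by
        ext m
        simpa using mem_degreeLT_iff_coeff.1 hq m (Nat.zero_le m)
      simp [this]
    | succ k ih =>
      intro hk q hq
      set W := derivative^[k] ((X ^ 2 - 1 : ℝ[X]) ^ n) with hW
      rw [Function.iterate_succ_apply', ← hW]
      have h := intervalIntegral.integral_deriv_mul_eq_sub (a := -1) (b := 1)
        (u := fun t => W.eval t) (v := fun t => q.eval t)
        (u' := fun t => (derivative W).eval t) (v' := fun t => (derivative q).eval t)
        (fun t _ => W.hasDerivAt t) (fun t _ => q.hasDerivAt t)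
        ((LocBdd.eval _).intervalIntegrable _ _) ((LocBdd.eval _).intervalIntegrable _ _)
      rw [((LocBdd.eval _).mul (.eval _)).integral_add ((LocBdd.eval _).mul (.eval _)),
        ih (by omega) _ (derivative_mem_degreeLT hq)] at h
      rw [hW, eval_iterate_derivative_sq_sub_one_pow (by omega) (by norm_num),
        eval_iterate_derivative_sq_sub_one_pow (by omega) (by norm_num), ← hW] at h
      simpa using h
  have := key n le_rfl q hq
  simp only [legendreP, eval_mul, eval_C, mul_assoc]
  rw [intervalIntegral.integral_const_mul, this, mul_zero]

end Legendre

section GenLegendre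

variable {βm βp : ℝ} (hβm : 0 < βm) (hβp : 0 < βp) (αh : ℝ)

theorem wInner_comm (P Q : ℝ[X]) : wInner βm βp αh P Q = wInner βm βp αh Q P := by
  simp only [wInner]; congr 1; funext x; ring

theorem wInner_X_mul (P Q : ℝ[X]) :
    wInner βm βp αh (X * P) Q = wInner βm βp αh P (X * Q) := by
  simp only [wInner, eval_mul, eval_X]; congr 1; funext x; ring

theorem wInner_C_mul (s : ℝ) (P Q : ℝ[X]) :
    wInner βm βp αh (C s * P) Q = s * wInner βm βp αh P Q := by
  simp only [wInner, ← intervalIntegral.integral_const_mul, eval_mul, eval_C]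
  congr 1; funext x; ring

include hβm hβp

theorem wInner_add (P P' Q : ℝ[X]) :
    wInner βm βp αh (P + P') Q = wInner βm βp αh P Q + wInner βm βp αh P' Q := by
  have h := (isWeight_betaCoeff_inv hβm hβp αh).locBdd
  simp only [wInner]
  rw [← ((h.mul (.eval _)).mul (.eval _)).integral_add ((h.mul (.eval _)).mul (.eval _))]
  congr 1; funext x; simp; ring

theorem wInner_sub (P P' Q : ℝ[X]) :
    wInner βm βp αh (P - P') Q = wInner βm βp αh P Q - wInner βm βp αh P' Q := by
  have : P - P' = P + C (-1) * P' := by simp; ring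
  rw [this, wInner_add hβm hβp, wInner_C_mul]; ring

/-- In particular the denominators in the recurrence for `genLegendre` do not vanish. -/
theorem wInner_self_ne_zero {P : ℝ[X]} (hP : P ≠ 0) : wInner βm βp αh P P ≠ 0 := fun h =>
  hP (eq_zero_of_integral_weight_sq (isWeight_betaCoeff_inv hβm hβp αh) (by norm_num) h)

omit hβm hβp

theorem genLegendre_monic_natDegree (n : ℕ) :
    (genLegendre βm βp αh n).Monic ∧ (genLegendre βm βp αh n).natDegree = n := by
  suffices h : ((genLegendre βm βp αh n).Monic ∧ (genLegendre βm βp αh n).natDegree = n) ∧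
      ((genLegendre βm βp αh (n + 1)).Monic ∧ (genLegendre βm βp αh (n + 1)).natDegree = n + 1) from
    h.1
  induction n with
  | zero =>
    simp only [genLegendre]
    exact ⟨⟨monic_one, natDegree_one⟩, monic_X_sub_C _, natDegree_X_sub_C _⟩
  | succ n ih =>
    refine ⟨ih.2, ?_⟩
    obtain ⟨⟨h1, d1⟩, h2, d2⟩ := ih
    rw [genLegendre]
    set s := wInner βm βp αh (X * genLegendre βm βp αh (n + 1)) (genLegendre βm βp αh (n + 1)) /
        wInner βm βp αh (genLegendre βm βp αh (n + 1)) (genLegendre βm βp αh (n + 1))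
    set t := wInner βm βp αh (genLegendre βm βp αh (n + 1)) (genLegendre βm βp αh (n + 1)) /
        wInner βm βp αh (genLegendre βm βp αh n) (genLegendre βm βp αh n)
    have hm : ((X - C s) * genLegendre βm βp αh (n + 1)).Monic := (monic_X_sub_C s).mul h2
    have hd : ((X - C s) * genLegendre βm βp αh (n + 1)).natDegree = n + 2 := by
      rw [(monic_X_sub_C s).natDegree_mul h2, natDegree_X_sub_C, d2]; omega
    have hlt : (C t * genLegendre βm βp αh n).natDegree <
        ((X - C s) * genLegendre βm βp αh (n + 1)).natDegree := by
      rw [hd]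
      exact (natDegree_C_mul_le _ _).trans_lt (by omega)
    have hlt' := degree_lt_degree hlt
    exact ⟨hm.sub_of_left hlt', by rw [natDegree_sub_eq_left_of_natDegree_lt hlt, hd]⟩

theorem genLegendre_ne_zero (n : ℕ) : genLegendre βm βp αh n ≠ 0 :=
  (genLegendre_monic_natDegree αh n).1.ne_zero

theorem natDegree_genLegendre (n : ℕ) : (genLegendre βm βp αh n).natDegree = n :=
  (genLegendre_monic_natDegree αh n).2

include hβm hβp

/-- Orthogonality of the generalized Legendre polynomials, from the three-term recurrence. -/
theorem wInner_genLegendre (n : ℕ) {q : ℝ[X]} (hq : q ∈ degreeLT ℝ n) :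
    wInner βm βp αh (genLegendre βm βp αh n) q = 0 := by
  suffices h : (∀ q ∈ degreeLT ℝ n, wInner βm βp αh (genLegendre βm βp αh n) q = 0) ∧
      ∀ q ∈ degreeLT ℝ (n + 1), wInner βm βp αh (genLegendre βm βp αh (n + 1)) q = 0 from
    h.1 q hq
  clear hq q
  have hzero : ∀ P : ℝ[X], wInner βm βp αh P 0 = 0 := fun P => by simp [wInner]
  have hlow : ∀ q ∈ degreeLT ℝ 0, q = 0 := fun q hq => by
    ext m; simpa using mem_degreeLT_iff_coeff.1 hq m (Nat.zero_le m)
  induction n with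
  | zero =>
    refine ⟨fun q hq => by rw [hlow q hq, hzero], fun q hq => ?_⟩
    obtain ⟨s, q', hq', rfl⟩ := exists_eq_smul_add (natDegree_one (R := ℝ)) one_ne_zero hq
    rw [hlow q' hq', add_zero, wInner_comm, wInner_C_mul, wInner_comm]
    have h1 : wInner βm βp αh 1 1 ≠ 0 := wInner_self_ne_zero hβm hβp αh one_ne_zero
    have e : genLegendre βm βp αh 1 = X - C (wInner βm βp αh X 1 / wInner βm βp αh 1 1) * 1 := by
      rw [genLegendre, mul_one]
    rw [e, wInner_sub hβm hβp, wInner_C_mul]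
    field_simp; ring
  | succ n ih =>
    refine ⟨ih.2, fun q hq => ?_⟩
    obtain ⟨ih0, ih1⟩ := ih
    have d0 := natDegree_genLegendre (βm := βm) (βp := βp) αh n
    have d1 := natDegree_genLegendre (βm := βm) (βp := βp) αh (n + 1)
    have z0 := genLegendre_ne_zero (βm := βm) (βp := βp) αh n
    have z1 := genLegendre_ne_zero (βm := βm) (βp := βp) αh (n + 1)
    have n0 := wInner_self_ne_zero hβm hβp αh z0
    have n1 := wInner_self_ne_zero hβm hβp αh z1
    obtain ⟨s, q1, hq1, rfl⟩ := exists_eq_smul_add d1 z1 hq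
    obtain ⟨t, q2, hq2, rfl⟩ := exists_eq_smul_add d0 z0 hq1
    have m0 : genLegendre βm βp αh n ∈ degreeLT ℝ (n + 1) := mem_degreeLT_of_natDegree (by omega)
    have hq2' : q2 ∈ degreeLT ℝ (n + 1) := degreeLT_mono (Nat.le_succ n) hq2
    rw [genLegendre]
    set L1 := genLegendre βm βp αh (n + 1)
    set L0 := genLegendre βm βp αh n
    -- The leading parts agree, so `(L₁, X L₀) = (L₁, L₁)`.
    have hX : wInner βm βp αh L1 (X * L0) = wInner βm βp αh L1 L1 := by
      have hmem : X * L0 - L1 ∈ degreeLT ℝ (n + 1) := by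
        have c0 : L0.coeff n = 1 := by
          have := (genLegendre_monic_natDegree (βm := βm) (βp := βp) αh n).1.coeff_natDegree
          rwa [d0] at this
        have c1 : L1.coeff (n + 1) = 1 := by
          have := (genLegendre_monic_natDegree (βm := βm) (βp := βp) αh (n + 1)).1.coeff_natDegree
          rwa [d1] at this
        rw [mem_degreeLT_iff_coeff]
        intro m hm
        obtain ⟨m, rfl⟩ : ∃ k, m = k + 1 := ⟨m - 1, by omega⟩
        rw [coeff_sub, coeff_X_mul]
        rcases (by omega : m = n ∨ n < m) with rfl | h
        · rw [c0, c1, sub_self]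
        · rw [coeff_eq_zero_of_natDegree_lt (by omega), coeff_eq_zero_of_natDegree_lt (by omega),
            sub_self]
      have h := ih1 _ hmem
      rw [wInner_comm, wInner_sub hβm hβp, sub_eq_zero] at h
      rw [wInner_comm, h]
    have expand : ∀ r, wInner βm βp αh ((X - C (wInner βm βp αh (X * L1) L1 / wInner βm βp αh L1 L1))
        * L1 - C (wInner βm βp αh L1 L1 / wInner βm βp αh L0 L0) * L0) r =
        wInner βm βp αh L1 (X * r) - wInner βm βp αh (X * L1) L1 / wInner βm βp αh L1 L1 *
          wInner βm βp αh L1 r - wInner βm βp αh L1 L1 / wInner βm βp αh L0 L0 *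
          wInner βm βp αh L0 r := by
      intro r
      rw [sub_mul, wInner_sub hβm hβp, wInner_sub hβm hβp, wInner_C_mul, wInner_C_mul,
        wInner_X_mul]
    have e1 : wInner βm βp αh L1 (X * q2) = 0 := ih1 _ (mul_X_mem_degreeLT hq2)
    have hadd : ∀ P Q Q', wInner βm βp αh P (Q + Q') = wInner βm βp αh P Q + wInner βm βp αh P Q' :=
      fun P Q Q' => by
        rw [wInner_comm, wInner_add hβm hβp, wInner_comm αh Q, wInner_comm αh Q']
    have hC : ∀ s P Q, wInner βm βp αh P (C s * Q) = s * wInner βm βp αh P Q := fun s P Q => by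
      rw [wInner_comm, wInner_C_mul, wInner_comm]
    rw [hadd, hadd, hC, hC, expand, expand, expand, e1, hX, ih0 _ hq2, ih1 _ hq2', ih1 _ m0,
      wInner_comm αh L0 L1, ih1 _ m0, wInner_X_mul αh L1 L1]
    field_simp; ring

end GenLegendre

/-! ### Weak derivatives in one dimension -/

section WeakDerivatives

/-- Test functions on `s`: smooth functions with compact support in `s`. -/
structure IsTest (s : Set ℝ) (η : ℝ → ℝ) : Prop where
  contDiff : ContDiff ℝ ((⊤ : ℕ∞) : WithTop ℕ∞) η
  compact : HasCompactSupport η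
  subset : tsupport η ⊆ s

theorem IsTest.sub {s : Set ℝ} {η ζ : ℝ → ℝ} (hη : IsTest s η) (hζ : IsTest s ζ) (K : ℝ) :
    IsTest s fun x => η x - K * ζ x := by
  have hsub : tsupport (fun x => η x - K * ζ x) ⊆ tsupport η ∪ tsupport ζ := by
    refine closure_minimal (fun x hx => ?_) ((isClosed_tsupport _).union (isClosed_tsupport _))
    by_contra h
    simp only [mem_union, not_or] at h
    exact hx (by simp [image_eq_zero_of_notMem_tsupport h.1, image_eq_zero_of_notMem_tsupport h.2])
  exact ⟨hη.contDiff.sub (contDiff_const.mul hζ.contDiff),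
    (hη.compact.isCompact.union hζ.compact.isCompact).of_isClosed_subset (isClosed_tsupport _) hsub,
    hsub.trans (union_subset hη.subset hζ.subset)⟩

theorem IsTest.isTest_deriv {s : Set ℝ} {η : ℝ → ℝ} (hη : IsTest s η) : IsTest s (deriv η) :=
  ⟨(contDiff_infty_iff_deriv.1 hη.contDiff).2, hη.compact.deriv,
    (closure_mono support_deriv_subset).trans
      ((isClosed_tsupport η).closure_eq.subset.trans hη.subset)⟩

theorem IsTest.integrable_mul {s : Set ℝ} {f η : ℝ → ℝ} (hf : LocallyIntegrableOn f s)
    (hη : IsTest s η) : Integrable (fun x => f x * η x) := by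
  have h1 := hf.integrableOn_compact_subset hη.subset hη.compact
  have h2 := h1.mul_continuousOn hη.contDiff.continuous.continuousOn hη.compact
  refine (integrableOn_iff_integrable_of_support_subset (fun x hx => ?_)).1 h2
  refine subset_tsupport _ fun h => hx ?_
  simp [h]

theorem IsTest.setIntegral_eq {s : Set ℝ} {f η : ℝ → ℝ} (hη : IsTest s η) :
    ∫ x in s, f x * η x = ∫ x, f x * η x :=
  setIntegral_eq_integral_of_forall_compl_eq_zero fun x hx => by
    rw [image_eq_zero_of_notMem_tsupport fun h => hx (hη.subset h), mul_zero]

theorem ae_eq_of_forall_integral_test_eq {s : Set ℝ} (hs : IsOpen s) {f g : ℝ → ℝ}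
    (hf : LocallyIntegrableOn f s) (hg : LocallyIntegrableOn g s)
    (h : ∀ η, IsTest s η → ∫ x in s, f x * η x = ∫ x in s, g x * η x) :
    ∀ᵐ x, x ∈ s → f x = g x := by
  have := hs.ae_eq_zero_of_integral_contDiff_smul_eq_zero (hf.sub hg) (μ := volume) ?_
  · exact this.mono fun x hx hxs => sub_eq_zero.1 (hx hxs)
  · intro η h1 h2 h3
    have hη : IsTest s η := ⟨h1, h2, h3⟩
    have e := h η hη
    rw [hη.setIntegral_eq, hη.setIntegral_eq] at e
    have : ∫ x, (f x * η x - g x * η x) = 0 := by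
      rw [MeasureTheory.integral_sub (hη.integrable_mul hf) (hη.integrable_mul hg), e, sub_self]
    rw [← this]
    congr 1; funext x; simp; ring

/-- A test function on an interval with vanishing mean is the derivative of a test function. -/
theorem IsTest.primitive {c d : ℝ} (hcd : c < d) {σ : ℝ → ℝ} (hσ : IsTest (Ioo c d) σ)
    (h0 : ∫ x in c..d, σ x = 0) : IsTest (Ioo c d) fun x => ∫ t in c..x, σ t := by
  have hc : Continuous σ := hσ.contDiff.continuous
  have hl : LocBdd σ := .of_continuous hc
  obtain ⟨c', d', hc', hd', hsub⟩ : ∃ c' d', c < c' ∧ d' < d ∧ tsupport σ ⊆ Icc c' d' := by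
    rcases (tsupport σ).eq_empty_or_nonempty with h | h
    · exact ⟨(c + d) / 2, (c + d) / 2, by linarith, by linarith, by simp [h]⟩
    · obtain ⟨x, hx, hmin⟩ := hσ.compact.isCompact.exists_isLeast h
      obtain ⟨y, hy, hmax⟩ := hσ.compact.isCompact.exists_isGreatest h
      exact ⟨x, y, (hσ.subset hx).1, (hσ.subset hy).2, fun z hz => ⟨hmin hz, hmax hz⟩⟩
  have hz : ∀ x, x ∉ Icc c' d' → σ x = 0 := fun x hx =>
    image_eq_zero_of_notMem_tsupport fun h => hx (hsub h)
  have hts : tsupport (fun x => ∫ t in c..x, σ t) ⊆ Icc c' d' := by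
    refine closure_minimal (fun x hx => ?_) isClosed_Icc
    by_contra hxn
    apply hx
    rcases lt_or_ge x c' with h | h
    · change ∫ t in c..x, σ t = 0
      rw [intervalIntegral.integral_congr (g := fun _ => 0)]
      · simp
      · intro t ht
        refine hz t fun ht' => ?_
        rcases le_total c x with hcx | hcx
        · rw [uIcc_of_le hcx] at ht; linarith [ht.2, ht'.1]
        · rw [uIcc_of_ge hcx] at ht; linarith [ht.2, ht'.1]
    · have h' : d' < x := by
        by_contra hh; exact hxn ⟨h, not_lt.1 hh⟩
      change ∫ t in c..x, σ t = 0
      rw [← hl.integral_add_adjacent c d x, h0, zero_add,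
        intervalIntegral.integral_congr (g := fun _ => 0)]
      · simp
      · intro t ht
        refine hz t fun ht' => ?_
        rcases le_total d x with hcx | hcx
        · rw [uIcc_of_le hcx] at ht; linarith [ht.1, ht'.2]
        · rw [uIcc_of_ge hcx] at ht; linarith [ht.1, ht'.2]
  have hder : ∀ x, HasDerivAt (fun x => ∫ t in c..x, σ t) (σ x) x := fun x =>
    (hc.integral_hasStrictDerivAt c x).hasDerivAt
  refine ⟨contDiff_infty_iff_deriv.2 ⟨fun x => (hder x).differentiableAt, ?_⟩,
    isCompact_Icc.of_isClosed_subset (isClosed_tsupport _) hts,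
    hts.trans fun x hx => ⟨hc'.trans_le hx.1, hx.2.trans_lt hd'⟩⟩
  have : deriv (fun x => ∫ t in c..x, σ t) = σ := funext fun x => (hder x).deriv
  rw [this]; exact hσ.contDiff

theorem IsTest.apply_eq_integral {c d : ℝ} {η : ℝ → ℝ} (hη : IsTest (Ioo c d) η) (x : ℝ) :
    η x = ∫ t in c..x, deriv η t := by
  have h := intervalIntegral.integral_deriv_eq_sub' (a := c) (b := x) η rfl
    (fun t _ => (hη.contDiff.differentiable (by simp)).differentiableAt)
    hη.isTest_deriv.contDiff.continuous.continuousOn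
  have hc : η c = 0 := image_eq_zero_of_notMem_tsupport fun h => lt_irrefl c (hη.subset h).1
  rw [h, hc, sub_zero]

theorem setIntegral_Ioo_eq {c d : ℝ} (hcd : c ≤ d) (f : ℝ → ℝ) :
    ∫ x in Ioo c d, f x = ∫ x in c..d, f x := by
  rw [intervalIntegral.integral_of_le hcd, integral_Ioc_eq_integral_Ioo]

theorem integral_primitive_mul_deriv_test {c d : ℝ} {g η : ℝ → ℝ} (hg : LocBdd g)
    (hη : IsTest (Ioo c d) η) (x₀ : ℝ) :
    ∫ x in c..d, (∫ t in x₀..x, g t) * deriv η x = -∫ x in c..d, g x * η x := by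
  have hd : LocBdd (deriv η) := .of_continuous hη.isTest_deriv.contDiff.continuous
  have hηd : η d = 0 :=
     image_eq_zero_of_notMem_tsupport fun h => lt_irrefl d (hη.subset h).2
  have hd0 : ∫ x in c..d, deriv η x = 0 := by rw [← hη.apply_eq_integral, hηd]
  have h := hg.integral_primitive_mul hd c d
  simp_rw [← hη.apply_eq_integral] at h
  rw [hηd] at h
  have e : ∀ x, (∫ t in x₀..x, g t) * deriv η x =
      (∫ t in c..x, g t) * deriv η x - (∫ t in c..x₀, g t) * deriv η x := by
    intro x
    rw [← hg.integral_add_adjacent c x₀ x]; ring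
  simp_rw [e]
  rw [((hg.primitive c).mul hd).integral_sub (hd.const_mul _),
    intervalIntegral.integral_const_mul, hd0, h]
  ring

/-- Lemma of du Bois-Reymond: a function with a locally bounded weak derivative is almost everywhere
a primitive of it. -/
theorem exists_ae_eq_primitive {c d : ℝ} (hcd : c < d) {f g : ℝ → ℝ}
    (hf : LocallyIntegrableOn f (Ioo c d)) (hg : LocBdd g) (x₀ : ℝ)
    (h : ∀ η, IsTest (Ioo c d) η →
      ∫ x in Ioo c d, f x * deriv η x = -∫ x in Ioo c d, g x * η x) :
    ∃ K : ℝ, ∀ᵐ x, x ∈ Ioo c d → f x = K + ∫ t in x₀..x, g t := by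
  have hG := hg.continuous_primitive x₀
  have hGl : LocallyIntegrableOn (fun x => ∫ t in x₀..x, g t) (Ioo c d) :=
    hG.locallyIntegrable.locallyIntegrableOn _
  obtain ⟨φ, hφt, hφ1⟩ : ∃ φ, IsTest (Ioo c d) φ ∧ ∫ x in c..d, φ x = 1 := by
    let b : ContDiffBump ((c + d) / 2) :=
      ⟨(d - c) / 8, (d - c) / 4, by linarith, by linarith⟩
    have hb : IsTest (Ioo c d) (b.normed volume) := by
      refine ⟨b.contDiff_normed, b.hasCompactSupport_normed, ?_⟩
      rw [b.tsupport_normed_eq, Real.closedBall_eq_Icc]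
      change Icc ((c + d) / 2 - (d - c) / 4) ((c + d) / 2 + (d - c) / 4) ⊆ _
      exact fun x hx => ⟨by linarith [hx.1], by linarith [hx.2]⟩
    refine ⟨_, hb, ?_⟩
    rw [← setIntegral_Ioo_eq hcd.le]
    have := hb.setIntegral_eq (f := fun _ => 1)
    simp only [one_mul] at this
    rw [this, b.integral_normed]
  have hzero : ∀ η, IsTest (Ioo c d) η →
      ∫ x in Ioo c d, (f x - ∫ t in x₀..x, g t) * deriv η x = 0 := by
    intro η hη
    simp_rw [sub_mul]
    rw [MeasureTheory.integral_sub (hη.isTest_deriv.integrable_mul hf).integrableOn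
      (hη.isTest_deriv.integrable_mul hGl).integrableOn, h η hη, setIntegral_Ioo_eq hcd.le,
      setIntegral_Ioo_eq hcd.le, integral_primitive_mul_deriv_test hg hη]
    ring
  have hfG : LocallyIntegrableOn (fun x => f x - ∫ t in x₀..x, g t) (Ioo c d) := hf.sub hGl
  set K := ∫ x in Ioo c d, (f x - ∫ t in x₀..x, g t) * φ x with hK
  refine ⟨K, ?_⟩
  have hmain := ae_eq_of_forall_integral_test_eq isOpen_Ioo (f := fun x => f x - ∫ t in x₀..x, g t)
    (g := fun _ => K) hfG (continuous_const.locallyIntegrable.locallyIntegrableOn _) ?_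
  · refine hmain.mono fun x hx hxs => ?_
    have : f x - ∫ t in x₀..x, g t = K := hx hxs
    linarith
  · intro ζ hζ
    have hσ := hζ.sub hφt (∫ x in c..d, ζ x)
    have hζl : LocBdd ζ := .of_continuous hζ.contDiff.continuous
    have hφl : LocBdd φ := .of_continuous hφt.contDiff.continuous
    have hσ0 : ∫ x in c..d, (ζ x - (∫ x in c..d, ζ x) * φ x) = 0 := by
      rw [hζl.integral_sub (hφl.const_mul _), intervalIntegral.integral_const_mul, hφ1]; ring
    have h1 := hzero _ (hσ.primitive hcd hσ0)
    have hder : ∀ x, deriv (fun x => ∫ t in c..x, (ζ t - (∫ x in c..d, ζ x) * φ t)) x =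
        ζ x - (∫ x in c..d, ζ x) * φ x := fun x =>
      (hσ.contDiff.continuous.integral_hasStrictDerivAt c x).hasDerivAt.deriv
    simp_rw [hder] at h1
    have e : ∀ x, (f x - ∫ t in x₀..x, g t) * (ζ x - (∫ x in c..d, ζ x) * φ x) =
        (f x - ∫ t in x₀..x, g t) * ζ x -
          (∫ x in c..d, ζ x) * ((f x - ∫ t in x₀..x, g t) * φ x) := fun x => by ring
    simp_rw [e] at h1
    rw [MeasureTheory.integral_sub (hζ.integrable_mul hfG).integrableOn
      ((hφt.integrable_mul hfG).const_mul _).integrableOn, MeasureTheory.integral_const_mul,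
      ← hK, sub_eq_zero] at h1
    rw [h1, setIntegral_Ioo_eq hcd.le, intervalIntegral.integral_const_mul]
    ring

theorem IsWeakDeriv.ae_unique {j : ℕ} {s : Set ℝ} (hs : IsOpen s) {f g g' : ℝ → ℝ}
    (h : IsWeakDeriv j s f g) (h' : IsWeakDeriv j s f g') : ∀ᵐ x, x ∈ s → g x = g' x := by
  refine ae_eq_of_forall_integral_test_eq hs h.2.1 h'.2.1 fun η hη => ?_
  have e := h.2.2 η hη.contDiff hη.compact hη.subset
  rw [h'.2.2 η hη.contDiff hη.compact hη.subset] at e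
  exact (mul_left_cancel₀ (pow_ne_zero j (by norm_num)) e).symm

theorem sobolevNormInfty_nonneg (m : ℕ) (s : Set ℝ) (f : ℝ → ℝ) : 0 ≤ sobolevNormInfty m s f :=
  ENNReal.toReal_nonneg

/-- Weak derivatives of functions in `W^{m,∞}` have representatives that are bounded everywhere by
the Sobolev norm. -/
theorem MemSobolev.exists_bounded {m : ℕ} {s : Set ℝ} (hs : IsOpen s) {f : ℝ → ℝ}
    (hf : MemSobolev m ⊤ s f) {j : ℕ} (hj : j ≤ m) :
    ∃ g, Measurable g ∧ (∀ x, |g x| ≤ sobolevNormInfty m s f) ∧ IsWeakDeriv j s f g := by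
  have hspec : ∀ i ≤ m, IsWeakDeriv i s f (weakDeriv i s f) ∧
      MemLp (weakDeriv i s f) ⊤ (volume.restrict s) := by
    intro i hi
    obtain ⟨g, hg, hgL⟩ := hf i hi
    have hex : ∃ g, IsWeakDeriv i s f g := ⟨g, hg⟩
    have hW : IsWeakDeriv i s f (weakDeriv i s f) := by
      rw [weakDeriv, dif_pos hex]; exact hex.choose_spec
    refine ⟨hW, hgL.ae_eq ?_⟩
    exact (ae_restrict_iff' hs.measurableSet).2 (hg.ae_unique hs hW)
  set M := sobolevNormInfty m s f with hM
  obtain ⟨hW, hWL⟩ := hspec j hj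
  have hbd : ∀ᵐ x ∂(volume.restrict s), |weakDeriv j s f x| ≤ M := by
    have hfin : ((Finset.range (m + 1)).sup
        fun j => eLpNorm (weakDeriv j s f) ⊤ (volume.restrict s)) ≠ ⊤ := by
      refine ((Finset.sup_lt_iff (by simp)).2 fun i hi => ?_).ne
      exact (hspec i (by simpa [Nat.lt_succ_iff] using hi)).2.2
    filter_upwards [enorm_ae_le_eLpNormEssSup (weakDeriv j s f) (volume.restrict s)] with x hx
    rw [← eLpNorm_exponent_top] at hx
    have h2 := hx.trans (Finset.le_sup (f := fun j => eLpNorm (weakDeriv j s f) ⊤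
      (volume.restrict s)) (Finset.mem_range.2 (Nat.lt_succ_of_le hj)))
    have := ENNReal.toReal_mono hfin h2
    rwa [toReal_enorm] at this
  have hmk := hWL.1.ae_eq_mk
  set W' := hWL.1.mk (weakDeriv j s f) with hW'
  have hmeas : Measurable W' := hWL.1.stronglyMeasurable_mk.measurable
  have hM0 : 0 ≤ M := sobolevNormInfty_nonneg _ _ _
  -- Truncation at height `M` makes the bound hold everywhere and changes the function on a null set
  -- only.
  have hgm : Measurable fun x => max (-M) (min M (W' x)) :=
    measurable_const.max (measurable_const.min hmeas)
  have hgb : ∀ x, |max (-M) (min M (W' x))| ≤ M := fun x =>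
    abs_le.2 ⟨le_max_left _ _, max_le (by linarith) (min_le_left _ _)⟩
  have hgl : LocBdd fun x => max (-M) (min M (W' x)) := ⟨hgm, fun _ => ⟨M, fun x _ => hgb x⟩⟩
  refine ⟨_, hgm, hgb, hW.1, hgl.locallyIntegrable.locallyIntegrableOn _, fun η h1 h2 h3 => ?_⟩
  rw [hW.2.2 η h1 h2 h3]
  congr 1
  refine integral_congr_ae ?_
  filter_upwards [hbd, hmk] with x hx hx'
  rw [← hx', min_eq_right (abs_le.1 hx).2, max_eq_right (abs_le.1 hx).1]

/-- A continuous function in `W^{m+1,∞}` on an interval is classically `m` times differentiable,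
with derivatives bounded by the Sobolev norm, and its `m`-th derivative is Lipschitz. -/
theorem MemSobolev.classical {m : ℕ} {c d : ℝ} (hcd : c < d) {f : ℝ → ℝ}
    (hf : MemSobolev (m + 1) ⊤ (Ioo c d) f) (hfc : ContinuousOn f (Ioo c d)) :
    (∀ j ≤ m, ∀ x ∈ Ioo c d, |iteratedDeriv j f x| ≤ sobolevNormInfty (m + 1) (Ioo c d) f) ∧
    (∀ j < m, ∀ x ∈ Ioo c d,
      HasDerivAt (iteratedDeriv j f) (iteratedDeriv (j + 1) f x) x) ∧
    ∀ x ∈ Ioo c d, ∀ y ∈ Ioo c d, |iteratedDeriv m f x - iteratedDeriv m f y| ≤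
      sobolevNormInfty (m + 1) (Ioo c d) f * |x - y| := by
  set M := sobolevNormInfty (m + 1) (Ioo c d) f
  have hM0 : 0 ≤ M := sobolevNormInfty_nonneg _ _ _
  -- The `g j` are bounded representatives of the weak derivatives; each is almost everywhere equal to
  -- the primitive `G j` of the next one, and the continuous functions `G j` are the classical
  -- derivatives.
  have hex : ∀ j, ∃ g, j ≤ m + 1 →
      Measurable g ∧ (∀ x, |g x| ≤ M) ∧ IsWeakDeriv j (Ioo c d) f g := by
    intro j
    by_cases hj : j ≤ m + 1
    · obtain ⟨g, hg⟩ := hf.exists_bounded isOpen_Ioo hj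
      exact ⟨g, fun _ => hg⟩
    · exact ⟨0, fun h => absurd h hj⟩
  choose g hg using hex
  have hgl : ∀ j ≤ m + 1, LocBdd (g j) := fun j hj =>
    ⟨(hg j hj).1, fun _ => ⟨M, fun x _ => (hg j hj).2.1 x⟩⟩
  have hprim : ∀ j, ∃ K : ℝ, j ≤ m →
      ∀ᵐ x, x ∈ Ioo c d → g j x = K + ∫ t in c..x, g (j + 1) t := by
    intro j
    by_cases hj : j ≤ m
    · have hweak : ∀ η, IsTest (Ioo c d) η → ∫ x in Ioo c d, g j x * deriv η x =
          -∫ x in Ioo c d, g (j + 1) x * η x := by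
        intro η hη
        have e1 := (hg j (by omega)).2.2.2.2 (deriv η) hη.isTest_deriv.contDiff
          hη.isTest_deriv.compact hη.isTest_deriv.subset
        have e2 := (hg (j + 1) (by omega)).2.2.2.2 η hη.contDiff hη.compact hη.subset
        rw [iteratedDeriv_succ', e1, pow_succ, mul_assoc] at e2
        have := mul_left_cancel₀ (pow_ne_zero j (by norm_num)) e2
        rw [this]; ring
      obtain ⟨K, hK⟩ := exists_ae_eq_primitive hcd (hg j (by omega)).2.2.2.1
        (hgl (j + 1) (by omega)) c hweak
      exact ⟨K, fun _ => hK⟩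
    · exact ⟨0, fun h => absurd h hj⟩
  choose K hK using hprim
  set G : ℕ → ℝ → ℝ := fun j x => K j + ∫ t in c..x, g (j + 1) t with hG
  have hGc : ∀ j ≤ m, Continuous (G j) := fun j hj =>
    continuous_const.add ((hgl (j + 1) (by omega)).continuous_primitive c)
  have hae : ∀ j ≤ m, ∀ᵐ x ∂(volume.restrict (Ioo c d)), g j x = G j x := fun j hj =>
    (ae_restrict_iff' measurableSet_Ioo).2 (hK j hj)
  have hGb : ∀ j ≤ m, ∀ x ∈ Ioo c d, |G j x| ≤ M := by
    intro j hj x hx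
    have h1 : EqOn (fun x => max |G j x| M) (fun _ => M) (Ioo c d) := by
      refine Measure.eqOn_open_of_ae_eq (μ := volume) ?_ isOpen_Ioo ?_ continuousOn_const
      · filter_upwards [hae j hj] with x hx
        rw [← hx]
        exact max_eq_right ((hg j (by omega)).2.1 x)
      · exact ((hGc j hj).abs.max continuous_const).continuousOn
    exact max_eq_right_iff.1 (h1 hx)
  have hdiff : ∀ j x y, j ≤ m → G j x - G j y = ∫ t in y..x, g (j + 1) t := by
    intro j x y hj
    simp only [hG]
    rw [← (hgl (j + 1) (by omega)).integral_add_adjacent c y x]; ring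
  have hGd : ∀ j < m, ∀ x ∈ Ioo c d, HasDerivAt (G j) (G (j + 1) x) x := by
    intro j hj x hx
    have hder : HasDerivAt (fun y => K j + ∫ t in c..y, G (j + 1) t) (G (j + 1) x) x :=
      (((hGc (j + 1) hj).integral_hasStrictDerivAt c x).hasDerivAt).const_add _
    refine hder.congr_of_eventuallyEq ?_
    filter_upwards [isOpen_Ioo.mem_nhds hx] with y hy
    simp only [hG]
    congr 1
    refine intervalIntegral.integral_congr_ae ?_
    filter_upwards [hK (j + 1) hj] with t ht ht'
    rw [uIoc_of_le hy.1.le] at ht'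
    exact ht ⟨ht'.1, ht'.2.trans_lt hy.2⟩
  have hG0 : EqOn f (G 0) (Ioo c d) := by
    refine Measure.eqOn_open_of_ae_eq (μ := volume) ?_ isOpen_Ioo hfc (hGc 0 (by omega)).continuousOn
    have h0 : IsWeakDeriv 0 (Ioo c d) f f :=
      ⟨(hg 0 (by omega)).2.2.1, (hg 0 (by omega)).2.2.1, fun η _ _ _ => by simp⟩
    have h1 := (ae_restrict_iff' measurableSet_Ioo).2
      (h0.ae_unique isOpen_Ioo (hg 0 (by omega)).2.2)
    filter_upwards [h1, hae 0 (by omega)] with x h2 h3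
    rw [h2, h3]
  have hit : ∀ j ≤ m, EqOn (iteratedDeriv j f) (G j) (Ioo c d) := by
    intro j
    induction j with
    | zero => intro _ x hx; rw [iteratedDeriv_zero]; exact hG0 hx
    | succ j ih =>
      intro hj x hx
      rw [iteratedDeriv_succ]
      have : iteratedDeriv j f =ᶠ[𝓝 x] G j :=
        (ih (by omega)).eventuallyEq_of_mem (isOpen_Ioo.mem_nhds hx)
      rw [this.deriv_eq]
      exact (hGd j hj x hx).deriv
  refine ⟨fun j hj x hx => by rw [hit j hj hx]; exact hGb j hj x hx, fun j hj x hx => ?_,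
    fun x hx y hy => ?_⟩
  · rw [hit (j + 1) hj hx]
    exact (hGd j hj x hx).congr_of_eventuallyEq
      ((hit j hj.le).eventuallyEq_of_mem (isOpen_Ioo.mem_nhds hx))
  · rw [hit m le_rfl hx, hit m le_rfl hy, hdiff m x y le_rfl, ← Real.norm_eq_abs]
    exact intervalIntegral.norm_integral_le_of_norm_le_const
      fun t _ => (Real.norm_eq_abs _).trans_le ((hg (m + 1) le_rfl).2.1 t)

end WeakDerivatives

/-! ### The flux across the interface -/

section Flux

/-- A function `F 0` on `(a,b)` with its derivatives `F 1, …, F n`: all are continuous and bounded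
by `B`, the differentiation rule holds off the point `α`, and `F n` is Lipschitz with
constant `B`. -/
structure IsDerivChain (n : ℕ) (a b α B : ℝ) (F : ℕ → ℝ → ℝ) : Prop where
  locBdd : ∀ j ≤ n, LocBdd (F j)
  bound : ∀ j ≤ n, ∀ x ∈ Ioo a b, |F j x| ≤ B
  continuousOn : ∀ j ≤ n, ContinuousOn (F j) (Ioo a b)
  hasDerivAt : ∀ j < n, ∀ x ∈ Ioo a b, x ≠ α → HasDerivAt (F j) (F (j + 1) x) x
  lipschitz : ∀ x ∈ Ioo a b, ∀ y ∈ Ioo a b, |F n x - F n y| ≤ B * |x - y|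

namespace IsDerivChain

variable {n : ℕ} {a b α B : ℝ} {F : ℕ → ℝ → ℝ}

theorem integral_eq (h : IsDerivChain n a b α B F) {j : ℕ} (hj : j < n) {x y : ℝ}
    (hx : x ∈ Ioo a b) (hy : y ∈ Ioo a b) : ∫ t in x..y, F (j + 1) t = F j y - F j x := by
  have hsub : uIcc x y ⊆ Ioo a b := ordConnected_Ioo.uIcc_subset hx hy
  refine integral_eq_of_hasDerivAt_off_countable (F j) (F (j + 1)) (countable_singleton α)
    ((h.continuousOn j hj.le).mono hsub) (fun t ht => ?_) ((h.locBdd (j + 1) hj).intervalIntegrable _ _)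
  exact h.hasDerivAt j hj t (hsub (Ioo_subset_Icc_self ht.1)) ht.2

theorem of_succ (h : IsDerivChain (n + 1) a b α B F) : IsDerivChain n a b α B F where
  locBdd j hj := h.locBdd j (by omega)
  bound j hj := h.bound j (by omega)
  continuousOn j hj := h.continuousOn j (by omega)
  hasDerivAt j hj := h.hasDerivAt j (by omega)
  lipschitz x hx y hy := by
    rw [← h.integral_eq (Nat.lt_succ_self n) hy hx, ← Real.norm_eq_abs]
    refine intervalIntegral.norm_integral_le_of_norm_le_const fun t ht => ?_
    exact h.bound (n + 1) le_rfl t (ordConnected_Ioo.uIcc_subset hy hx (uIoc_subset_uIcc ht))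

end IsDerivChain

theorem exists_antiderivative {n : ℕ} {q : ℝ[X]} (hq : q ∈ degreeLT ℝ n) :
    ∃ A ∈ degreeLT ℝ (n + 1), derivative A = q := by
  have hsum : q = ∑ i ∈ Finset.range n, monomial i (q.coeff i) := by
    ext m
    simp only [finsetSum_coeff, coeff_monomial, Finset.sum_ite_eq', Finset.mem_range]
    split_ifs with h
    · rfl
    · exact mem_degreeLT_iff_coeff.1 hq m (not_lt.1 h)
  refine ⟨∑ i ∈ Finset.range n, monomial (i + 1) (q.coeff i / (i + 1)), ?_, ?_⟩
  · refine Submodule.sum_mem _ fun i hi => mem_degreeLT.2 ?_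
    refine (degree_monomial_le _ _).trans_lt ?_
    have := Finset.mem_range.1 hi
    exact_mod_cast (by omega : i + 1 < n + 1)
  · conv_rhs => rw [hsum]
    rw [derivative_sum]
    refine Finset.sum_congr rfl fun i _ => ?_
    rw [derivative_monomial]
    have : ((i : ℝ) + 1) ≠ 0 := by positivity
    simp only [Nat.add_sub_cancel, Nat.cast_add, Nat.cast_one]
    rw [div_mul_cancel₀ _ this]

/-- Taylor approximation of order `n + 1` on subintervals, with a constant that does not see the
singular point `α`. -/
theorem IsDerivChain.exists_taylor {n : ℕ} {a b α B : ℝ} {F : ℕ → ℝ → ℝ}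
    (h : IsDerivChain n a b α B F) {l r : ℝ} (hal : a ≤ l) (hlr : l < r) (hrb : r ≤ b) :
    ∃ T ∈ degreeLT ℝ (n + 1), ∀ x ∈ Ioo l r, |F 0 x - T.eval x| ≤ B * (r - l) ^ (n + 1) := by
  have hd : 0 < r - l := sub_pos.2 hlr
  -- Expanding about the midpoint keeps the base point inside `(a,b)`.
  set z := (l + r) / 2 with hz
  have hzI : z ∈ Ioo l r := ⟨by linarith, by linarith⟩
  have hsub : Ioo l r ⊆ Ioo a b := Ioo_subset_Ioo hal hrb
  have hB : 0 ≤ B := (abs_nonneg _).trans (h.bound 0 (Nat.zero_le n) z (hsub hzI))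
  have hdist : ∀ x ∈ Ioo l r, |x - z| ≤ r - l := fun x hx =>
    abs_le.2 ⟨by linarith [hx.1, hzI.2], by linarith [hx.2, hzI.1]⟩
  suffices H : ∀ i j, i + j = n → ∃ T ∈ degreeLT ℝ (i + 1), ∀ x ∈ Ioo l r,
      |F j x - T.eval x| ≤ B * (r - l) ^ (i + 1) from H n 0 (by omega)
  intro i
  induction i with
  | zero =>
    intro j hj
    obtain rfl : j = n := by omega
    refine ⟨C (F j z), mem_degreeLT_of_natDegree (by simp), fun x hx => ?_⟩
    rw [eval_C, zero_add, pow_one]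
    exact (h.lipschitz x (hsub hx) z (hsub hzI)).trans
      (mul_le_mul_of_nonneg_left (hdist x hx) hB)
  | succ i ih =>
    intro j hj
    obtain ⟨T, hT, hTb⟩ := ih (j + 1) (by omega)
    obtain ⟨A, hA, hAT⟩ := exists_antiderivative hT
    refine ⟨A + C (F j z - A.eval z), Submodule.add_mem _ hA
      (mem_degreeLT_of_natDegree (by simp)), fun x hx => ?_⟩
    have e1 : ∫ t in z..x, T.eval t = A.eval x - A.eval z := by
      rw [← hAT]
      exact intervalIntegral.integral_eq_sub_of_hasDerivAt (fun t _ => A.hasDerivAt t)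
        ((LocBdd.eval _).intervalIntegrable _ _)
    have e2 : F j x - (A + C (F j z - A.eval z)).eval x =
        ∫ t in z..x, (F (j + 1) t - T.eval t) := by
      rw [(h.locBdd (j + 1) (by omega)).integral_sub (.eval T),
        h.integral_eq (by omega) (hsub hzI) (hsub hx), e1, eval_add, eval_C]
      ring
    rw [e2, ← Real.norm_eq_abs]
    refine (intervalIntegral.norm_integral_le_of_norm_le_const (C := B * (r - l) ^ (i + 1))
      fun t ht => hTb t ?_).trans ?_
    · exact ordConnected_Ioo.uIcc_subset hzI hx (uIoc_subset_uIcc ht)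
    · rw [pow_succ _ (i + 1), ← mul_assoc]
      exact mul_le_mul_of_nonneg_left (hdist x hx) (by positivity)

theorem betaCoeff_eventuallyEq {βm βp α x : ℝ} (hx : x ≠ α) :
    betaCoeff βm βp α =ᶠ[𝓝 x] fun _ => betaCoeff βm βp α x := by
  rcases hx.lt_or_gt with h | h
  · filter_upwards [Iio_mem_nhds h] with y hy
    simp [betaCoeff, h, mem_Iio.1 hy]
  · filter_upwards [Ioi_mem_nhds h] with y hy
    simp [betaCoeff, not_lt.2 h.le, not_lt.2 (mem_Ioi.1 hy).le]

theorem betaCoeff_pos {βm βp : ℝ} (hβm : 0 < βm) (hβp : 0 < βp) (α x : ℝ) :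
    0 < betaCoeff βm βp α x := by
  unfold betaCoeff; split_ifs <;> assumption

theorem betaCoeff_le (βm βp α x : ℝ) : betaCoeff βm βp α x ≤ max βm βp := by
  unfold betaCoeff; split_ifs
  · exact le_max_left _ _
  · exact le_max_right _ _

theorem tildeNormInfty_nonneg (m : ℕ) (a b α : ℝ) (v : ℝ → ℝ) : 0 ≤ tildeNormInfty m a b α v :=
  (sobolevNormInfty_nonneg _ _ _).trans (le_max_left _ _)

/-- The flux of a function in `W̃_β^{p+2,∞}`, extended continuously to the interface, has `p`
continuous derivatives on the whole of `(a,b)`, the last one Lipschitz. -/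
theorem MemTildeW.exists_flux {p : ℕ} {a b α βm βp : ℝ} (hβm : 0 < βm) (hβp : 0 < βp)
    (hα : α ∈ Ioo a b) {u : ℝ → ℝ} (hu : MemTildeW (p + 2) ⊤ a b α βm βp u) :
    ∃ F : ℕ → ℝ → ℝ,
      IsDerivChain p a b α (max βm βp * tildeNormInfty (p + 2) a b α u) F ∧
      ∀ x ∈ Ioo a b, x ≠ α → HasDerivAt u ((betaCoeff βm βp α x)⁻¹ * F 0 x) x := by
  obtain ⟨huc, hua, hub, hum, hup, hjump⟩ := hu
  set M := tildeNormInfty (p + 2) a b α u with hM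
  have hM0 : 0 ≤ M := tildeNormInfty_nonneg _ _ _ _ _
  obtain ⟨bm, dm, lm⟩ := MemSobolev.classical hα.1 hum
    (huc.mono (Ioo_subset_Icc_self.trans (Icc_subset_Icc_right hα.2.le)))
  obtain ⟨bp, dp, lp⟩ := MemSobolev.classical hα.2 hup
    (huc.mono (Ioo_subset_Icc_self.trans (Icc_subset_Icc_left hα.1.le)))
  have hMm : sobolevNormInfty (p + 1 + 1) (Ioo a α) u ≤ M := le_max_left _ _
  have hMp : sobolevNormInfty (p + 1 + 1) (Ioo α b) u ≤ M := le_max_right _ _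
  have hbd : ∀ j ≤ p + 1, ∀ x ∈ Ioo a b, x ≠ α → |iteratedDeriv j u x| ≤ M := by
    intro j hj x hx hxα
    rcases hxα.lt_or_gt with h | h
    · exact (bm j hj x ⟨hx.1, h⟩).trans hMm
    · exact (bp j hj x ⟨h, hx.2⟩).trans hMp
  have hder : ∀ j < p + 1, ∀ x ∈ Ioo a b, x ≠ α →
      HasDerivAt (iteratedDeriv j u) (iteratedDeriv (j + 1) u x) x := by
    intro j hj x hx hxα
    rcases hxα.lt_or_gt with h | h
    · exact dm j hj x ⟨hx.1, h⟩
    · exact dp j hj x ⟨h, hx.2⟩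
  have hl : ∀ j, ∃ l : ℝ, j ≤ p →
      Tendsto (fun x => betaCoeff βm βp α x * iteratedDeriv (j + 1) u x) (𝓝[≠] α) (𝓝 l) := by
    intro j
    by_cases hj : j ≤ p
    · obtain ⟨l, hl⟩ := hjump (j + 1) (by omega) (by omega)
      exact ⟨l, fun _ => hl⟩
    · exact ⟨0, fun h => absurd h hj⟩
  choose l hl using hl
  set B := max βm βp * M with hB
  have hβM : 0 < max βm βp := hβm.trans_le (le_max_left _ _)
  have hB0 : 0 ≤ B := by positivity
  -- At `α` the flux derivative takes its two-sided limit `l j`, which exists by the jump condition on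
  -- `u^(j+1)`.
  let F : ℕ → ℝ → ℝ := fun j x => if x ∈ Ioo a b then
    (if x = α then l j else betaCoeff βm βp α x * iteratedDeriv (j + 1) u x) else 0
  have hFα : ∀ j, F j α = l j := fun j => by simp only [F, if_pos hα, if_true]
  have hFx : ∀ j, ∀ x ∈ Ioo a b, x ≠ α →
      F j x = betaCoeff βm βp α x * iteratedDeriv (j + 1) u x := fun j x hx hxα => by
    simp only [F, if_pos hx, if_neg hxα]
  have hev : ∀ x ∈ Ioo a b, x ≠ α → ∀ᶠ y in 𝓝 x, y ∈ Ioo a b ∧ y ≠ α := fun x hx hxα =>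
    (isOpen_Ioo.eventually_mem hx).and (isOpen_ne.eventually_mem hxα)
  have hFev : ∀ j, ∀ x ∈ Ioo a b, x ≠ α →
      F j =ᶠ[𝓝 x] fun y => betaCoeff βm βp α x * iteratedDeriv (j + 1) u y := fun j x hx hxα => by
    filter_upwards [hev x hx hxα, betaCoeff_eventuallyEq hxα] with y hy hy'
    rw [hFx j y hy.1 hy.2, hy']
  have hFt : ∀ j ≤ p, Tendsto (F j) (𝓝[≠] α) (𝓝 (F j α)) := fun j hj => by
    rw [hFα]
    refine (hl j hj).congr' ?_
    have : ∀ᶠ y in 𝓝[≠] α, y ∈ Ioo a b := nhdsWithin_le_nhds (isOpen_Ioo.mem_nhds hα)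
    filter_upwards [this, self_mem_nhdsWithin] with y hy hy'
    exact (hFx j y hy hy').symm
  have hFd : ∀ j < p, ∀ x ∈ Ioo a b, x ≠ α → HasDerivAt (F j) (F (j + 1) x) x := by
    intro j hj x hx hxα
    rw [hFx (j + 1) x hx hxα]
    exact ((hder (j + 1) (by omega) x hx hxα).const_mul _).congr_of_eventuallyEq (hFev j x hx hxα)
  have hLm : ∀ x ∈ Ioo a α, ∀ y ∈ Ioo a α, |F p x - F p y| ≤ B * |x - y| := by
    intro x hx y hy
    rw [hFx p x ⟨hx.1, hx.2.trans hα.2⟩ hx.2.ne, hFx p y ⟨hy.1, hy.2.trans hα.2⟩ hy.2.ne]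
    simp only [betaCoeff, if_pos hx.2, if_pos hy.2]
    rw [← mul_sub, abs_mul, abs_of_pos hβm, hB, mul_assoc]
    exact mul_le_mul (le_max_left _ _) ((lm x hx y hy).trans
      (mul_le_mul_of_nonneg_right hMm (abs_nonneg _))) (abs_nonneg _) hβM.le
  have hLp : ∀ x ∈ Ioo α b, ∀ y ∈ Ioo α b, |F p x - F p y| ≤ B * |x - y| := by
    intro x hx y hy
    rw [hFx p x ⟨hα.1.trans hx.1, hx.2⟩ hx.1.ne', hFx p y ⟨hα.1.trans hy.1, hy.2⟩ hy.1.ne']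
    simp only [betaCoeff, if_neg hx.1.le.not_gt, if_neg hy.1.le.not_gt]
    rw [← mul_sub, abs_mul, abs_of_pos hβp, hB, mul_assoc]
    exact mul_le_mul (le_max_right _ _) ((lp x hx y hy).trans
      (mul_le_mul_of_nonneg_right hMp (abs_nonneg _))) (abs_nonneg _) hβM.le
  -- The Lipschitz bounds on the two sides extend to `α` by continuity and combine to one on `(a,b)`.
  have hLmα : ∀ x ∈ Ioo a α, |F p x - F p α| ≤ B * |x - α| := by
    intro x hx
    have ht : Tendsto (F p) (𝓝[<] α) (𝓝 (F p α)) :=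
      (hFt p le_rfl).mono_left (nhdsWithin_mono _ fun y hy => ne_of_lt hy)
    have hid : Tendsto (fun y : ℝ => y) (𝓝[<] α) (𝓝 α) := nhdsWithin_le_nhds
    refine le_of_tendsto_of_tendsto (tendsto_const_nhds.sub ht).abs
      ((tendsto_const_nhds.sub hid).abs.const_mul B) ?_
    filter_upwards [Ioo_mem_nhdsLT hα.1] with y hy
    exact hLm x hx y hy
  have hLpα : ∀ x ∈ Ioo α b, |F p x - F p α| ≤ B * |x - α| := by
    intro x hx
    have ht : Tendsto (F p) (𝓝[>] α) (𝓝 (F p α)) :=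
      (hFt p le_rfl).mono_left (nhdsWithin_mono _ fun y hy => ne_of_gt hy)
    have hid : Tendsto (fun y : ℝ => y) (𝓝[>] α) (𝓝 α) := nhdsWithin_le_nhds
    refine le_of_tendsto_of_tendsto (tendsto_const_nhds.sub ht).abs
      ((tendsto_const_nhds.sub hid).abs.const_mul B) ?_
    filter_upwards [Ioo_mem_nhdsGT hα.2] with y hy
    exact hLp x hx y hy
  have hLip : ∀ x ∈ Ioo a b, ∀ y ∈ Ioo a b, x ≤ y → |F p x - F p y| ≤ B * |x - y| := by
    intro x hx y hy hxy
    rcases lt_trichotomy x α with h1 | h1 | h1 <;> rcases lt_trichotomy y α with h2 | h2 | h2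
    · exact hLm x ⟨hx.1, h1⟩ y ⟨hy.1, h2⟩
    · rw [h2]; exact hLmα x ⟨hx.1, h1⟩
    · have e1 := hLmα x ⟨hx.1, h1⟩
      have e2 := hLpα y ⟨h2, hy.2⟩
      rw [abs_sub_comm] at e2
      calc |F p x - F p y| ≤ |F p x - F p α| + |F p α - F p y| := abs_sub_le _ _ _
        _ ≤ B * |x - α| + B * |y - α| := add_le_add e1 e2
        _ = B * |x - y| := by
          rw [abs_of_neg (by linarith : x - α < 0), abs_of_pos (by linarith : 0 < y - α),
            abs_of_neg (by linarith : x - y < 0)]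
          ring
    · linarith
    · simp [h1, h2]
    · rw [h1, abs_sub_comm, abs_sub_comm α]; exact hLpα y ⟨h2, hy.2⟩
    · linarith
    · linarith
    · exact hLp x ⟨h1, hx.2⟩ y ⟨h2, hy.2⟩
  have hFcont : ∀ j ≤ p, ContinuousOn (F j) (Ioo a b) := by
    intro j hj x hx
    refine ContinuousAt.continuousWithinAt ?_
    by_cases hxα : x = α
    · rw [hxα]
      exact continuousAt_iff_punctured_nhds.2 (hFt j hj)
    · rcases hj.eq_or_lt with rfl | hj
      · have : ContinuousOn (F j) (Ioo a b) := by
          refine LipschitzOnWith.continuousOn (K := B.toNNReal) ?_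
          refine LipschitzOnWith.of_dist_le_mul fun x hx y hy => ?_
          rw [Real.coe_toNNReal _ hB0, Real.dist_eq, Real.dist_eq]
          rcases le_total x y with h | h
          · exact hLip x hx y hy h
          · rw [abs_sub_comm, abs_sub_comm x]; exact hLip y hy x hx h
        exact this.continuousAt (isOpen_Ioo.mem_nhds hx)
      · exact (hFd j hj x hx hxα).continuousAt
  have hFb' : ∀ j ≤ p, ∀ x ∈ Ioo a b, x ≠ α → |F j x| ≤ B := by
    intro j hj x hx hxα
    rw [hFx j x hx hxα, abs_mul, abs_of_pos (betaCoeff_pos hβm hβp α x)]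
    exact mul_le_mul (betaCoeff_le _ _ _ _) (hbd (j + 1) (by omega) x hx hxα) (abs_nonneg _) hβM.le
  have hFb : ∀ j ≤ p, ∀ x ∈ Ioo a b, |F j x| ≤ B := by
    intro j hj x hx
    by_cases hxα : x = α
    · rw [hxα]
      refine le_of_tendsto (hFt j hj).abs ?_
      have : ∀ᶠ y in 𝓝[≠] α, y ∈ Ioo a b := nhdsWithin_le_nhds (isOpen_Ioo.mem_nhds hα)
      filter_upwards [this, self_mem_nhdsWithin] with y hy hy'
      exact hFb' j hj y hy hy'
    · exact hFb' j hj x hx hxα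
  refine ⟨F, ⟨fun j hj => ⟨?_, fun R => ⟨B, fun x _ => ?_⟩⟩, hFb, hFcont, hFd,
    fun x hx y hy => ?_⟩, fun x hx hxα => ?_⟩
  · classical
    have h1 : F j = (Ioo a b).piecewise (F j) (fun _ => 0) := by
      funext x
      by_cases hx : x ∈ Ioo a b
      · rw [piecewise_eq_of_mem _ _ _ hx]
      · rw [piecewise_eq_of_notMem _ _ _ hx]; simp only [F, if_neg hx]
    rw [h1]
    exact (hFcont j hj).measurable_piecewise continuousOn_const measurableSet_Ioo
  · by_cases hx : x ∈ Ioo a b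
    · exact hFb j hj x hx
    · simp only [F, if_neg hx, abs_zero]; exact hB0
  · rcases le_total x y with h | h
    · exact hLip x hx y hy h
    · rw [abs_sub_comm, abs_sub_comm x]; exact hLip y hy x hx h
  · have h := hder 0 (by omega) x hx hxα
    rw [iteratedDeriv_zero] at h
    rw [hFx 0 x hx hxα, inv_mul_cancel_left₀ (betaCoeff_pos hβm hβp α x).ne']
    exact h

end Flux

/-! ### Lobatto families and local spaces -/

section LocalSpaces

/-- `Φ` is a family of Lobatto type functions on `[l,r]` with respect to the weight `w`:
`Φ 0 + Φ 1 = 1`, and up to a factor `Φ (n + 1)` is the primitive of `w * A n`, where `A` is a family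
of polynomials with `deg A n = n` that are orthogonal with respect to `w`. -/
structure IsLobattoFamily (w : ℝ → ℝ) (l r : ℝ) (Φ : ℕ → ℝ → ℝ) (A : ℕ → ℝ[X]) : Prop where
  zero_add_one : ∀ x ∈ Icc l r, Φ 0 x + Φ 1 x = 1
  ne_zero : ∀ n, A n ≠ 0
  natDegree : ∀ n, (A n).natDegree = n
  succ : ∀ n, ∃ s : ℝ, s ≠ 0 ∧ ∀ x ∈ Icc l r, Φ (n + 1) x = s * ∫ t in l..x, w t * (A n).eval t
  orth : ∀ n, ∀ q ∈ degreeLT ℝ n, ∫ t in l..r, w t * (A n).eval t * q.eval t = 0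

namespace IsLobattoFamily

variable {w : ℝ → ℝ} {l r : ℝ} {Φ : ℕ → ℝ → ℝ} {A : ℕ → ℝ[X]}

/-- The local space consists of constants plus primitives of `w` times polynomials of degree less than
`p`; the converse is `exists_mem_span`. -/
theorem exists_of_mem_span (h : IsLobattoFamily w l r Φ A) (hw : LocBdd w) {p : ℕ} (hp : 1 ≤ p)
    {g : ℝ → ℝ} (hg : g ∈ Submodule.span ℝ {g | ∃ n ≤ p, g = Φ n}) :
    ∃ c₀ : ℝ, ∃ Q ∈ degreeLT ℝ p, ∀ x ∈ Icc l r, g x = c₀ + ∫ t in l..x, w t * Q.eval t := by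
  have hpos : ∀ n, n + 1 ≤ p → ∃ c₀ : ℝ, ∃ Q ∈ degreeLT ℝ p, ∀ x ∈ Icc l r,
      Φ (n + 1) x = c₀ + ∫ t in l..x, w t * Q.eval t := by
    intro n hn
    obtain ⟨s, _, hs⟩ := h.succ n
    refine ⟨0, C s * A n, ?_, fun x hx => ?_⟩
    · refine mem_degreeLT_of_natDegree ((natDegree_C_mul_le _ _).trans_lt ?_)
      rw [h.natDegree n]; omega
    · rw [hs x hx, zero_add, ← intervalIntegral.integral_const_mul]
      congr 1; funext t; simp; ring
  induction hg using Submodule.span_induction with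
  | mem g hg =>
    obtain ⟨n, hn, rfl⟩ := hg
    rcases n with _ | n
    · obtain ⟨c₀, Q, hQ, hQx⟩ := hpos 0 hp
      refine ⟨1 - c₀, -Q, Submodule.neg_mem _ hQ, fun x hx => ?_⟩
      have e := hQx x hx
      rw [zero_add] at e
      have : Φ 0 x = 1 - Φ 1 x := by linarith [h.zero_add_one x hx]
      rw [this, e]
      simp only [eval_neg, mul_neg, intervalIntegral.integral_neg]
      ring
    · exact hpos n hn
  | zero => exact ⟨0, 0, Submodule.zero_mem _, fun x _ => by simp⟩
  | add g g' _ _ ih ih' =>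
    obtain ⟨c, Q, hQ, e⟩ := ih
    obtain ⟨c', Q', hQ', e'⟩ := ih'
    refine ⟨c + c', Q + Q', Submodule.add_mem _ hQ hQ', fun x hx => ?_⟩
    simp only [Pi.add_apply, eval_add, mul_add]
    rw [(hw.mul (.eval Q)).integral_add (hw.mul (.eval Q')), e x hx, e' x hx]
    ring
  | smul s g _ ih =>
    obtain ⟨c, Q, hQ, e⟩ := ih
    refine ⟨s * c, C s * Q, ?_, fun x hx => ?_⟩
    · rw [← smul_eq_C_mul]; exact Submodule.smul_mem _ _ hQ
    · rw [Pi.smul_apply, smul_eq_mul, e x hx, mul_add, ← intervalIntegral.integral_const_mul]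
      congr 2; funext t; simp; ring

theorem exists_mem_span (h : IsLobattoFamily w l r Φ A) (hw : LocBdd w) {p : ℕ} (hp : 1 ≤ p)
    (c₀ : ℝ) {Q : ℝ[X]} (hQ : Q ∈ degreeLT ℝ p) :
    ∃ g ∈ Submodule.span ℝ {g | ∃ n ≤ p, g = Φ n},
      ∀ x ∈ Icc l r, g x = c₀ + ∫ t in l..x, w t * Q.eval t := by
  have key : ∀ n ≤ p, ∀ Q ∈ degreeLT ℝ n, ∃ g ∈ Submodule.span ℝ {g | ∃ n ≤ p, g = Φ n},
      ∀ x ∈ Icc l r, g x = ∫ t in l..x, w t * Q.eval t := by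
    intro n
    induction n with
    | zero =>
      intro _ Q hQ
      have : Q = 0 := by ext m; simpa using mem_degreeLT_iff_coeff.1 hQ m (Nat.zero_le m)
      exact ⟨0, Submodule.zero_mem _, fun x _ => by simp [this]⟩
    | succ n ih =>
      intro hn Q hQ
      obtain ⟨s, q, hq, rfl⟩ := exists_eq_smul_add (h.natDegree n) (h.ne_zero n) hQ
      obtain ⟨g, hg, hgx⟩ := ih (by omega) q hq
      obtain ⟨s', hs', hsx⟩ := h.succ n
      refine ⟨(s / s') • Φ (n + 1) + g, Submodule.add_mem _ (Submodule.smul_mem _ _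
        (Submodule.subset_span ⟨n + 1, hn, rfl⟩)) hg, fun x hx => ?_⟩
      rw [Pi.add_apply, Pi.smul_apply, smul_eq_mul, hsx x hx, hgx x hx, ← mul_assoc,
        div_mul_cancel₀ _ hs', ← intervalIntegral.integral_const_mul,
        ← ((hw.mul (.eval (A n))).const_mul s).integral_add (hw.mul (.eval q))]
      congr 1; funext t; simp; ring
  obtain ⟨g, hg, hgx⟩ := key p le_rfl Q hQ
  refine ⟨c₀ • Φ 0 + c₀ • Φ 1 + g, Submodule.add_mem _ (Submodule.add_mem _
    (Submodule.smul_mem _ _ (Submodule.subset_span ⟨0, by omega, rfl⟩))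
    (Submodule.smul_mem _ _ (Submodule.subset_span ⟨1, hp, rfl⟩))) hg, fun x hx => ?_⟩
  have := h.zero_add_one x hx
  simp only [Pi.add_apply, Pi.smul_apply, smul_eq_mul]
  rw [hgx x hx, ← mul_add, this, mul_one]

end IsLobattoFamily

namespace Mesh

variable {a b : ℝ} (T : Mesh a b)

theorem left_lt_right (i : Fin T.N) : T.left i < T.right i :=
  T.strictMono (Fin.castSucc_lt_succ)

/-- Pullback of a polynomial on the reference interval to the `i`-th element. -/
noncomputable def pullback (i : Fin T.N) (P : ℝ[X]) : ℝ[X] :=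
  P.comp (C (2 / (T.right i - T.left i)) * X +
    C (-(T.left i + T.right i) / (T.right i - T.left i)))

theorem toRef_eq (i : Fin T.N) (x : ℝ) : T.toRef i x = 2 / (T.right i - T.left i) * x +
    -(T.left i + T.right i) / (T.right i - T.left i) := by
  rw [toRef]; ring

theorem eval_pullback (i : Fin T.N) (P : ℝ[X]) (x : ℝ) :
    (T.pullback i P).eval x = P.eval (T.toRef i x) := by
  rw [pullback, toRef_eq, eval_comp]; simp

theorem natDegree_pullback (i : Fin T.N) (P : ℝ[X]) :
    (T.pullback i P).natDegree = P.natDegree := by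
  have h : 0 < T.right i - T.left i := sub_pos.2 (T.left_lt_right i)
  rw [pullback, natDegree_comp, natDegree_linear (by positivity), mul_one]

theorem toRef_left (i : Fin T.N) : T.toRef i (T.left i) = -1 := by
  have h : T.right i - T.left i ≠ 0 := (sub_pos.2 (T.left_lt_right i)).ne'
  rw [toRef]; field_simp; ring

theorem toRef_right (i : Fin T.N) : T.toRef i (T.right i) = 1 := by
  have h : T.right i - T.left i ≠ 0 := (sub_pos.2 (T.left_lt_right i)).ne'
  rw [toRef]; field_simp; ring

theorem toRef_lt_toRef (i : Fin T.N) {x y : ℝ} : T.toRef i x < T.toRef i y ↔ x < y := by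
  have h : 0 < T.right i - T.left i := sub_pos.2 (T.left_lt_right i)
  rw [toRef, toRef, div_lt_div_iff_of_pos_right h]
  constructor <;> intro <;> linarith

theorem toRef_mem (i : Fin T.N) {x : ℝ} (hx : x ∈ Icc (T.left i) (T.right i)) :
    T.toRef i x ∈ Icc (-1 : ℝ) 1 := by
  have h1 := (T.toRef_lt_toRef i (x := x) (y := T.left i)).not.2 (not_lt.2 hx.1)
  have h2 := (T.toRef_lt_toRef i (x := T.right i) (y := x)).not.2 (not_lt.2 hx.2)
  rw [toRef_left] at h1
  rw [toRef_right] at h2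
  exact ⟨not_lt.1 h1, not_lt.1 h2⟩

theorem integral_comp_toRef (i : Fin T.N) (g : ℝ → ℝ) (x : ℝ) :
    ∫ t in T.left i..x, g (T.toRef i t) =
      (T.right i - T.left i) / 2 * ∫ t in (-1 : ℝ)..T.toRef i x, g t := by
  have h : 0 < T.right i - T.left i := sub_pos.2 (T.left_lt_right i)
  rw [← T.toRef_left i]
  simp only [toRef_eq]
  rw [intervalIntegral.integral_comp_mul_add _ (by positivity)]
  simp

theorem betaCoeff_toRef (βm βp α : ℝ) (i : Fin T.N) (x : ℝ) :
    betaCoeff βm βp (T.toRef i α) (T.toRef i x) = betaCoeff βm βp α x := by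
  simp only [betaCoeff, toRef_lt_toRef]

/-- Every polynomial of degree less than `n` is the pullback of one. -/
theorem exists_pullback_eq (i : Fin T.N) {n : ℕ} {q : ℝ[X]} (hq : q ∈ degreeLT ℝ n) :
    ∃ P ∈ degreeLT ℝ n, ∀ x, q.eval x = P.eval (T.toRef i x) := by
  refine ⟨_, comp_linear_mem_degreeLT hq ((T.right i - T.left i) / 2)
    ((T.left i + T.right i) / 2), fun x => ?_⟩
  have h : T.right i - T.left i ≠ 0 := (sub_pos.2 (T.left_lt_right i)).ne'
  rw [eval_comp, toRef]
  simp only [eval_add, eval_mul, eval_C, eval_X]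
  congr 1; field_simp; ring

/-- On an element on which the weight is constant, the Lobatto polynomials form a Lobatto family. -/
theorem isLobattoFamily_lobattoOn (i : Fin T.N) {w : ℝ → ℝ} {ω : ℝ} (hω : ω ≠ 0)
    (hw : ∀ x ∈ Ioo (T.left i) (T.right i), w x = ω) :
    IsLobattoFamily w (T.left i) (T.right i) (T.lobattoOn i)
      fun n => T.pullback i (legendreP n) := by
  have h : 0 < T.right i - T.left i := sub_pos.2 (T.left_lt_right i)
  have hint : ∀ n, ∀ x ∈ Icc (T.left i) (T.right i),
      ∫ t in T.left i..x, w t * (T.pullback i (legendreP n)).eval t =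
        ω * ((T.right i - T.left i) / 2) * ∫ t in (-1 : ℝ)..T.toRef i x, (legendreP n).eval t := by
    intro n x hx
    rw [mul_assoc, ← T.integral_comp_toRef, ← intervalIntegral.integral_const_mul]
    refine integral_congr_Ioo hx.1 fun t ht => ?_
    rw [hw t ⟨ht.1, ht.2.trans_le hx.2⟩, eval_pullback]
  refine ⟨fun x _ => ?_, fun n => ?_, fun n => ?_, fun n => ?_, fun n q hq => ?_⟩
  · simp only [lobattoOn, lobatto]; ring
  · have h0 := legendreP_ne_zero n
    rw [pullback]
    intro hz
    have := T.natDegree_pullback i (legendreP n)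
    rcases (comp_eq_zero_iff.1 hz) with h1 | h1
    · exact h0 h1
    · have h2 := congrArg natDegree h1.2
      rw [natDegree_linear (by positivity), natDegree_C] at h2
      omega
  · rw [natDegree_pullback, natDegree_legendreP]
  · refine ⟨(ω * ((T.right i - T.left i) / 2))⁻¹ * (if n = 0 then 1 / 2 else 1), ?_, fun x hx => ?_⟩
    · have : ω * ((T.right i - T.left i) / 2) ≠ 0 := mul_ne_zero hω (by positivity)
      have h2 : (if n = 0 then (1 / 2 : ℝ) else 1) ≠ 0 := by split_ifs <;> norm_num
      exact mul_ne_zero (inv_ne_zero this) h2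
    · have : ω * ((T.right i - T.left i) / 2) ≠ 0 := mul_ne_zero hω (by positivity)
      have hcancel : ∀ c e I : ℝ, c ≠ 0 → c⁻¹ * e * (c * I) = e * I := fun c e I hc => by
        field_simp
      rw [hint n x hx, hcancel _ _ _ this]
      rcases n with _ | n
      · simp [lobattoOn, lobatto, legendreP_zero]; ring
      · simp [lobattoOn, lobatto]
  · obtain ⟨P, hP, hPq⟩ := T.exists_pullback_eq i hq
    have e : ∫ t in T.left i..T.right i, w t * (T.pullback i (legendreP n)).eval t * q.eval t =
        ∫ t in T.left i..T.right i, ω * (fun s => (legendreP n).eval s * P.eval s) (T.toRef i t) := by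
      refine integral_congr_Ioo (T.left_lt_right i).le fun t ht => ?_
      rw [hw t ht, eval_pullback, hPq]; ring
    rw [e, intervalIntegral.integral_const_mul, T.integral_comp_toRef i
      (fun s => (legendreP n).eval s * P.eval s), toRef_right, integral_legendreP_mul n hP]
    simp

end Mesh

theorem genLobatto_den_pos {βm βp αh : ℝ} (hβm : 0 < βm) (hβp : 0 < βp)
    (hα : αh ∈ Icc (-1 : ℝ) 1) : 0 < (1 - αh) * βm + (1 + αh) * βp := by
  rcases hα.1.eq_or_lt with h | h
  · have : 0 ≤ 1 + αh := by linarith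
    have : 0 < 1 - αh := by linarith
    positivity
  · have : 0 < 1 + αh := by linarith
    have : 0 ≤ 1 - αh := by linarith [hα.2]
    positivity

/-- The piecewise affine function `φ₁`, written as a multiple of the primitive of the weight. -/
theorem genLobatto_one_eq {βm βp αh ξ : ℝ} (hβm : 0 < βm) (hβp : 0 < βp)
    (hα : αh ∈ Icc (-1 : ℝ) 1) (hξ : ξ ∈ Icc (-1 : ℝ) 1) :
    genLobatto βm βp αh 1 ξ = βm * βp / ((1 - αh) * βm + (1 + αh) * βp) *
      ∫ t in (-1 : ℝ)..ξ, (betaCoeff βm βp αh t)⁻¹ := by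
  have hleft : ∀ y, y ≤ αh → -1 ≤ y →
      ∫ t in (-1 : ℝ)..y, (betaCoeff βm βp αh t)⁻¹ = (y + 1) * βm⁻¹ := by
    intro y hy hy'
    rw [integral_congr_Ioo hy' (k := fun _ => βm⁻¹) fun t ht => by
      simp [betaCoeff, ht.2.trans_le hy]]
    simp
  simp only [genLobatto]
  have hden := genLobatto_den_pos hβm hβp hα
  split_ifs with h
  · rw [hleft ξ h.le hξ.1]
    field_simp; ring
  · have h := not_lt.1 h
    rw [← (isWeight_betaCoeff_inv hβm hβp αh).locBdd.integral_add_adjacent (-1) αh ξ,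
      hleft αh le_rfl hα.1, integral_congr_Ioo h (k := fun _ => βp⁻¹) fun t ht => by
        simp [betaCoeff, ht.1.le.not_gt]]
    rw [intervalIntegral.integral_const, smul_eq_mul]
    field_simp; ring

/-- On the interface element, the generalized Lobatto polynomials form a Lobatto family. -/
theorem Mesh.isLobattoFamily_genLobattoOn {a b : ℝ} (T : Mesh a b) (k : Fin T.N) {βm βp α : ℝ}
    (hβm : 0 < βm) (hβp : 0 < βp) (hα : α ∈ Icc (T.left k) (T.right k)) :
    IsLobattoFamily (fun x => (betaCoeff βm βp α x)⁻¹) (T.left k) (T.right k)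
      (T.genLobattoOn βm βp α k)
      fun n => T.pullback k (genLegendre βm βp (T.toRef k α) n) := by
  have h : 0 < T.right k - T.left k := sub_pos.2 (T.left_lt_right k)
  have hαh := T.toRef_mem k hα
  have hden := genLobatto_den_pos hβm hβp hαh
  have hint : ∀ n x, ∫ t in T.left k..x, (betaCoeff βm βp α t)⁻¹ *
      (T.pullback k (genLegendre βm βp (T.toRef k α) n)).eval t =
        (T.right k - T.left k) / 2 * ∫ t in (-1 : ℝ)..T.toRef k x,
          (betaCoeff βm βp (T.toRef k α) t)⁻¹ * (genLegendre βm βp (T.toRef k α) n).eval t := by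
    intro n x
    rw [← T.integral_comp_toRef k fun t => (betaCoeff βm βp (T.toRef k α) t)⁻¹ *
      (genLegendre βm βp (T.toRef k α) n).eval t]
    simp only [eval_pullback, betaCoeff_toRef]
  refine ⟨fun x _ => ?_, fun n => ?_, fun n => ?_, fun n => ?_, fun n q hq => ?_⟩
  · simp only [genLobattoOn, genLobatto]
    split_ifs <;> rw [← add_div, div_eq_one_iff_eq hden.ne'] <;> ring
  · rw [pullback]
    intro hz
    rcases (comp_eq_zero_iff.1 hz) with h1 | h1
    · exact genLegendre_ne_zero _ n h1
    · have h2 := congrArg natDegree h1.2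
      rw [natDegree_linear (by positivity), natDegree_C] at h2
      omega
  · rw [natDegree_pullback, natDegree_genLegendre]
  · rcases n with _ | n
    · refine ⟨((T.right k - T.left k) / 2)⁻¹ *
        (βm * βp / ((1 - T.toRef k α) * βm + (1 + T.toRef k α) * βp)), by positivity,
        fun x hx => ?_⟩
      rw [hint, genLobattoOn, zero_add, genLobatto_one_eq hβm hβp hαh (T.toRef_mem k hx)]
      simp only [genLegendre, eval_one, mul_one]
      field_simp
    · refine ⟨((T.right k - T.left k) / 2)⁻¹, by positivity, fun x hx => ?_⟩
      rw [hint, inv_mul_cancel_left₀ (by positivity), genLobattoOn, genLobatto]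
  · obtain ⟨P, hP, hPq⟩ := T.exists_pullback_eq k hq
    have e : ∀ t, (betaCoeff βm βp α t)⁻¹ *
        (T.pullback k (genLegendre βm βp (T.toRef k α) n)).eval t * q.eval t =
        (fun s => (betaCoeff βm βp (T.toRef k α) s)⁻¹ *
          (genLegendre βm βp (T.toRef k α) n).eval s * P.eval s) (T.toRef k t) := by
      intro t
      simp only [eval_pullback, betaCoeff_toRef, hPq]
    simp_rw [e]
    rw [T.integral_comp_toRef k (fun s => (betaCoeff βm βp (T.toRef k α) s)⁻¹ *
          (genLegendre βm βp (T.toRef k α) n).eval s * P.eval s), toRef_right]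
    have := wInner_genLegendre hβm hβp (T.toRef k α) n hP
    rw [wInner] at this
    rw [this, mul_zero]

end LocalSpaces

/-! ### The immersed finite element space as a space of primitives -/

section Space

theorem LocBdd.memLp {g : ℝ → ℝ} (hg : LocBdd g) (a b : ℝ) (q : ℝ≥0∞) :
    MemLp g q (volume.restrict (Ioo a b)) := by
  obtain ⟨C, hC⟩ := hg.bdd (max |a| |b|)
  refine MemLp.of_bound hg.meas.aestronglyMeasurable C ?_
  refine (ae_restrict_mem measurableSet_Ioo).mono fun x hx => hC x ?_
  rw [max_comm]
  exact (abs_le_max_abs_abs hx.1.le hx.2.le).trans_eq (max_comm _ _)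

theorem memH10_primitive {a b : ℝ} (hab : a ≤ b) {g : ℝ → ℝ} (hg : LocBdd g)
    (h0 : ∫ x in a..b, g x = 0) : MemH10 a b fun x => ∫ t in a..x, g t := by
  have hc := hg.continuous_primitive a
  have hl := hc.locallyIntegrable.locallyIntegrableOn (Ioo a b) (μ := volume)
  refine ⟨hc.continuousOn, by simp, h0, fun j hj => ?_⟩
  rcases (by omega : j = 0 ∨ j = 1) with rfl | rfl
  · exact ⟨_, ⟨hl, hl, fun η _ _ _ => by simp⟩, (hg.primitive a).memLp a b 2⟩
  · refine ⟨g, ⟨hl, hg.locallyIntegrable.locallyIntegrableOn _, fun η h1 h2 h3 => ?_⟩,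
      hg.memLp a b 2⟩
    rw [setIntegral_Ioo_eq hab, setIntegral_Ioo_eq hab, iteratedDeriv_one,
      integral_primitive_mul_deriv_test hg ⟨h1, h2, h3⟩]
    ring

namespace Mesh

variable {a b : ℝ} (T : Mesh a b)

theorem a_le_node (j : Fin (T.N + 1)) : a ≤ T.node j :=
  T.node_zero.symm.trans_le (T.strictMono.monotone (Fin.zero_le j))

theorem node_le_b (j : Fin (T.N + 1)) : T.node j ≤ b :=
  (T.strictMono.monotone (Fin.le_last j)).trans_eq T.node_last

theorem a_le_left (i : Fin T.N) : a ≤ T.left i := T.a_le_node _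

theorem right_le_b (i : Fin T.N) : T.right i ≤ b := T.node_le_b _

theorem Icc_subset (i : Fin T.N) : Icc (T.left i) (T.right i) ⊆ Icc a b :=
  Icc_subset_Icc (T.a_le_left i) (T.right_le_b i)

theorem sub_le_meshSize (i : Fin T.N) : T.right i - T.left i ≤ T.meshSize :=
  le_ciSup (f := fun i => T.right i - T.left i) (finite_range _).bddAbove i

theorem right_le_left {i j : Fin T.N} (h : i < j) : T.right i ≤ T.left j :=
  T.strictMono.monotone (Fin.succ_le_castSucc_iff.2 h)

/-- Induction along the mesh, element by element, for a property of the nodes. -/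
theorem node_induction {P : ℝ → Prop} (h0 : P a) (hs : ∀ i, P (T.left i) → P (T.right i))
    (j : Fin (T.N + 1)) : P (T.node j) := by
  induction j using Fin.induction with
  | zero => rw [T.node_zero]; exact h0
  | succ i ih => exact hs i ih

theorem exists_mem_Ioc {x : ℝ} (hx : x ∈ Ioc a b) : ∃ i, x ∈ Ioc (T.left i) (T.right i) := by
  have : ∀ j, x ∈ Ioc a (T.node j) → ∃ i, x ∈ Ioc (T.left i) (T.right i) := by
    refine T.node_induction (P := fun y => x ∈ Ioc a y → ∃ i, x ∈ Ioc (T.left i) (T.right i))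
      (fun h => absurd h (by simp)) fun i ih h => ?_
    rcases le_or_gt x (T.left i) with h' | h'
    · exact ih ⟨h.1, h'⟩
    · exact ⟨i, h', h.2⟩
  refine this (Fin.last _) ?_
  rwa [T.node_last]

/-- The piecewise polynomial with value `Q i` on the `i`-th element (and `0` off `(a,b]`). -/
noncomputable def pw (Q : Fin T.N → ℝ[X]) (x : ℝ) : ℝ :=
  ∑ i, (Ioc (T.left i) (T.right i)).indicator (fun x => (Q i).eval x) x

variable {T}

theorem pw_of_mem (Q : Fin T.N → ℝ[X]) {i : Fin T.N} {x : ℝ}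
    (hx : x ∈ Ioc (T.left i) (T.right i)) : T.pw Q x = (Q i).eval x := by
  rw [pw, Finset.sum_eq_single i, indicator_of_mem hx]
  · intro j _ hj
    refine indicator_of_notMem (fun hx' => ?_) _
    rcases hj.lt_or_gt with h | h
    · linarith [T.right_le_left h, hx'.2, hx.1]
    · linarith [T.right_le_left h, hx'.1, hx.2]
  · simp

theorem pw_of_mem_Ioo (Q : Fin T.N → ℝ[X]) {i : Fin T.N} {x : ℝ}
    (hx : x ∈ Ioo (T.left i) (T.right i)) : T.pw Q x = (Q i).eval x :=
  pw_of_mem Q (Ioo_subset_Ioc_self hx)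

theorem locBdd_pw (Q : Fin T.N → ℝ[X]) : LocBdd (T.pw Q) :=
  LocBdd.sum fun i _ => (LocBdd.eval (Q i)).indicator measurableSet_Ioc

theorem pw_add (Q Q' : Fin T.N → ℝ[X]) (x : ℝ) :
    T.pw (fun i => Q i + Q' i) x = T.pw Q x + T.pw Q' x := by
  simp only [pw, ← Finset.sum_add_distrib]
  refine Finset.sum_congr rfl fun i _ => ?_
  by_cases h : x ∈ Ioc (T.left i) (T.right i) <;> simp [h]

theorem pw_sub (Q Q' : Fin T.N → ℝ[X]) (x : ℝ) :
    T.pw (fun i => Q i - Q' i) x = T.pw Q x - T.pw Q' x := by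
  simp only [pw, ← Finset.sum_sub_distrib]
  refine Finset.sum_congr rfl fun i _ => ?_
  by_cases h : x ∈ Ioc (T.left i) (T.right i) <;> simp [h]

theorem pw_const (s : ℝ) {x : ℝ} (hx : x ∈ Ioc a b) : T.pw (fun _ => C s) x = s := by
  obtain ⟨i, hi⟩ := T.exists_mem_Ioc hx
  rw [pw_of_mem _ hi, eval_C]

/-- Integrals against a piecewise polynomial vanish if they do on each element. -/
theorem integral_mul_pw_eq_zero {p : ℕ} {H : ℝ → ℝ} (hH : LocBdd H)
    (h : ∀ i, ∀ q ∈ degreeLT ℝ p, ∫ x in T.left i..T.right i, H x * q.eval x = 0)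
    {Q : Fin T.N → ℝ[X]} (hQ : ∀ i, Q i ∈ degreeLT ℝ p) : ∫ x in a..b, H x * T.pw Q x = 0 := by
  have hl := hH.mul (locBdd_pw Q)
  have := T.node_induction (P := fun y => ∫ x in a..y, H x * T.pw Q x = 0) (by simp)
    (fun i ih => ?_) (Fin.last _)
  · rwa [T.node_last] at this
  · rw [← hl.integral_add_adjacent a (T.left i), ih, zero_add, ← h i (Q i) (hQ i)]
    exact integral_congr_Ioo (T.left_lt_right i).le fun x hx => by rw [pw_of_mem_Ioo Q hx]

/-- Test fluxes supported on a single element localize an integral. -/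
theorem integral_mul_pw_single {g : ℝ → ℝ} (hg : LocBdd g) (i : Fin T.N) (q : ℝ[X]) :
    ∫ x in a..b, g x * T.pw (fun j => if j = i then q else 0) x =
      ∫ x in T.left i..T.right i, g x * q.eval x := by
  have hl := hg.mul (locBdd_pw fun j => if j = i then q else 0)
  have e : ∀ x, T.pw (fun j => if j = i then q else 0) x =
      (Ioc (T.left i) (T.right i)).indicator (fun x => q.eval x) x := by
    intro x
    rw [pw, Finset.sum_eq_single i]
    · simp
    · intro j _ hj; simp [hj]
    · simp
  rw [← hl.integral_add_adjacent a (T.right i), ← hl.integral_add_adjacent a (T.left i),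
    integral_congr_Ioo (T.a_le_left i) (k := fun _ => 0), integral_congr_Ioo (T.right_le_b i)
    (k := fun _ => 0), integral_congr_Ioo (T.left_lt_right i).le]
  · simp
    rfl
  · intro x hx; rw [e, indicator_of_mem (Ioo_subset_Ioc_self hx)]
  · intro x hx; rw [e, indicator_of_notMem (fun h => by linarith [h.2, hx.1]), mul_zero]
  · intro x hx; rw [e, indicator_of_notMem (fun h => by linarith [h.1, hx.2]), mul_zero]

theorem integral_pw_on {w : ℝ → ℝ} (Q : Fin T.N → ℝ[X]) {i : Fin T.N} {x : ℝ}
    (hx : x ∈ Icc (T.left i) (T.right i)) :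
    ∫ t in T.left i..x, w t * T.pw Q t = ∫ t in T.left i..x, w t * (Q i).eval t :=
  integral_congr_Ioo hx.1 fun t ht => by rw [pw_of_mem Q ⟨ht.1, ht.2.le.trans hx.2⟩]

theorem betaCoeff_const {βm βp α : ℝ} {k i : Fin T.N} (hα : α ∈ Icc (T.left k) (T.right k))
    (hik : i ≠ k) :
    ∃ β, (β = βm ∨ β = βp) ∧ ∀ x ∈ Ioo (T.left i) (T.right i), betaCoeff βm βp α x = β := by
  rcases hik.lt_or_gt with h | h
  · refine ⟨βm, .inl rfl, fun x hx => if_pos ?_⟩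
    linarith [T.right_le_left h, hx.2, hα.1]
  · refine ⟨βp, .inr rfl, fun x hx => if_neg ?_⟩
    linarith [T.right_le_left h, hx.1, hα.2]

theorem ne_of_mem_Ioo {α : ℝ} {k i : Fin T.N} (hα : α ∈ Icc (T.left k) (T.right k))
    (hik : i ≠ k) {x : ℝ} (hx : x ∈ Ioo (T.left i) (T.right i)) : x ≠ α := by
  rcases hik.lt_or_gt with h | h
  · exact ne_of_lt (by linarith [T.right_le_left h, hx.2, hα.1])
  · exact ne_of_gt (by linarith [T.right_le_left h, hx.1, hα.2])

/-- On each noninterface element the Lobatto polynomials form a Lobatto family for the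
weight `1/β`. -/
theorem isLobattoFamily_of_ne {βm βp α : ℝ} (hβm : 0 < βm) (hβp : 0 < βp) {k i : Fin T.N}
    (hα : α ∈ Icc (T.left k) (T.right k)) (hik : i ≠ k) :
    IsLobattoFamily (fun x => (betaCoeff βm βp α x)⁻¹) (T.left i) (T.right i) (T.lobattoOn i)
      fun n => T.pullback i (legendreP n) := by
  obtain ⟨β, hβ, hc⟩ := betaCoeff_const (βm := βm) (βp := βp) hα hik
  have hβ0 : 0 < β := by rcases hβ with rfl | rfl <;> assumption
  exact T.isLobattoFamily_lobattoOn i (inv_ne_zero hβ0.ne') fun x hx => by rw [hc x hx]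

/-- Elements of the immersed finite element space are primitives of `β⁻¹` times piecewise
polynomials of degree less than `p`. -/
theorem exists_pw_of_mem_ifeSpace {βm βp α : ℝ} (hβm : 0 < βm) (hβp : 0 < βp) {k : Fin T.N}
    (hα : α ∈ Icc (T.left k) (T.right k)) {p : ℕ} (hp : 1 ≤ p) {v : ℝ → ℝ}
    (hv : v ∈ T.ifeSpace βm βp α k p) :
    ∃ Q : Fin T.N → ℝ[X], (∀ i, Q i ∈ degreeLT ℝ p) ∧
      ∀ x ∈ Icc a b, v x = ∫ t in a..x, (betaCoeff βm βp α t)⁻¹ * T.pw Q t := by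
  obtain ⟨⟨hvc, hva, -, -⟩, hne, hk⟩ := hv
  have hw := (isWeight_betaCoeff_inv hβm hβp α).locBdd
  have hloc : ∀ i, ∃ Q ∈ degreeLT ℝ p, ∀ x ∈ Icc (T.left i) (T.right i),
      v x = v (T.left i) + ∫ t in T.left i..x, (betaCoeff βm βp α t)⁻¹ * Q.eval t := by
    intro i
    obtain ⟨c₀, Q, hQ, h⟩ : ∃ c₀ : ℝ, ∃ Q ∈ degreeLT ℝ p, ∀ x ∈ Ioo (T.left i) (T.right i),
        v x = c₀ + ∫ t in T.left i..x, (betaCoeff βm βp α t)⁻¹ * Q.eval t := by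
      by_cases hik : i = k
      · rw [hik]
        obtain ⟨g, hg, hvg⟩ := hk
        obtain ⟨c₀, Q, hQ, h⟩ :=
          (T.isLobattoFamily_genLobattoOn k hβm hβp hα).exists_of_mem_span hw hp hg
        exact ⟨c₀, Q, hQ, fun x hx => (hvg hx).trans (h x (Ioo_subset_Icc_self hx))⟩
      · obtain ⟨g, hg, hvg⟩ := hne i hik
        obtain ⟨c₀, Q, hQ, h⟩ :=
          (isLobattoFamily_of_ne hβm hβp hα hik).exists_of_mem_span hw hp hg
        exact ⟨c₀, Q, hQ, fun x hx => (hvg hx).trans (h x (Ioo_subset_Icc_self hx))⟩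
    have hlr := T.left_lt_right i
    have hE : EqOn v (fun x => c₀ + ∫ t in T.left i..x, (betaCoeff βm βp α t)⁻¹ * Q.eval t)
        (Icc (T.left i) (T.right i)) := by
      refine EqOn.of_subset_closure h (hvc.mono (T.Icc_subset i)) ?_ Ioo_subset_Icc_self
        (closure_Ioo hlr.ne).symm.subset
      exact (continuous_const.add ((hw.mul (.eval Q)).continuous_primitive _)).continuousOn
    have hl : v (T.left i) = c₀ := by
      have := hE (left_mem_Icc.2 hlr.le)
      simpa using this
    exact ⟨Q, hQ, fun x hx => by rw [hl]; exact hE hx⟩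
  choose Q hQ hv using hloc
  have hl := hw.mul (locBdd_pw Q)
  have hstep : ∀ i, v (T.left i) = ∫ t in a..T.left i, (betaCoeff βm βp α t)⁻¹ * T.pw Q t →
      ∀ x ∈ Icc (T.left i) (T.right i),
        v x = ∫ t in a..x, (betaCoeff βm βp α t)⁻¹ * T.pw Q t := by
    intro i ih x hx
    rw [hv i x hx, ih, ← hl.integral_add_adjacent a (T.left i) x, integral_pw_on Q hx]
  have hnode := T.node_induction
    (P := fun y => v y = ∫ t in a..y, (betaCoeff βm βp α t)⁻¹ * T.pw Q t) (by simp [hva])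
    fun i ih => hstep i ih _ (right_mem_Icc.2 (T.left_lt_right i).le)
  refine ⟨Q, hQ, fun x hx => ?_⟩
  rcases hx.1.eq_or_lt with rfl | h
  · simp [hva]
  · obtain ⟨i, hi⟩ := T.exists_mem_Ioc ⟨h, hx.2⟩
    exact hstep i (hnode _) x (Ioc_subset_Icc_self hi)

/-- Converse of `exists_pw_of_mem_ifeSpace`; the mean value condition is the boundary condition at `b`. -/
theorem primitive_pw_mem_ifeSpace {βm βp α : ℝ} (hβm : 0 < βm) (hβp : 0 < βp) {k : Fin T.N}
    (hα : α ∈ Icc (T.left k) (T.right k)) {p : ℕ} (hp : 1 ≤ p) {Q : Fin T.N → ℝ[X]}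
    (hQ : ∀ i, Q i ∈ degreeLT ℝ p)
    (h0 : ∫ t in a..b, (betaCoeff βm βp α t)⁻¹ * T.pw Q t = 0) :
    (fun x => ∫ t in a..x, (betaCoeff βm βp α t)⁻¹ * T.pw Q t) ∈ T.ifeSpace βm βp α k p := by
  have hw := (isWeight_betaCoeff_inv hβm hβp α).locBdd
  have hl := hw.mul (locBdd_pw Q)
  have hab : a ≤ b := (T.a_le_node 0).trans (T.node_le_b 0)
  have hsplit : ∀ i, ∀ x ∈ Icc (T.left i) (T.right i),
      ∫ t in a..x, (betaCoeff βm βp α t)⁻¹ * T.pw Q t =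
      (∫ t in a..T.left i, (betaCoeff βm βp α t)⁻¹ * T.pw Q t) +
        ∫ t in T.left i..x, (betaCoeff βm βp α t)⁻¹ * (Q i).eval t := fun i x hx => by
    rw [← hl.integral_add_adjacent a (T.left i) x, integral_pw_on Q hx]
  refine ⟨memH10_primitive hab hl h0, fun i hik => ?_, ?_⟩
  · obtain ⟨g, hg, hgx⟩ := (isLobattoFamily_of_ne hβm hβp hα hik).exists_mem_span hw hp
      (∫ t in a..T.left i, (betaCoeff βm βp α t)⁻¹ * T.pw Q t) (hQ i)
    exact ⟨g, hg, fun x hx => (hsplit i x (Ioo_subset_Icc_self hx)).trans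
      (hgx x (Ioo_subset_Icc_self hx)).symm⟩
  · obtain ⟨g, hg, hgx⟩ := (T.isLobattoFamily_genLobattoOn k hβm hβp hα).exists_mem_span hw hp
      (∫ t in a..T.left k, (betaCoeff βm βp α t)⁻¹ * T.pw Q t) (hQ k)
    exact ⟨g, hg, fun x hx => (hsplit k x (Ioo_subset_Icc_self hx)).trans
      (hgx x (Ioo_subset_Icc_self hx)).symm⟩

end Mesh

end Space

/-! ### Projection onto piecewise polynomials and the correction of the lower order terms -/

section Supercloseness

/-- Stability in `L^∞`, with constant `S`, of the `w`-weighted `L²` projection onto polynomials of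
degree less than `p` on arbitrary intervals. -/
def IsStabilityConst (p : ℕ) (w : ℝ → ℝ) (S : ℝ) : Prop :=
  ∀ l r : ℝ, l < r → ∀ Q ∈ degreeLT ℝ p, ∀ g, LocBdd g → ∀ B : ℝ,
    (∀ x ∈ Ioo l r, |g x| ≤ B) →
    (∀ q ∈ degreeLT ℝ p, ∫ x in l..r, w x * Q.eval x * q.eval x =
      ∫ x in l..r, w x * g x * q.eval x) →
    ∀ x ∈ Icc l r, |Q.eval x| ≤ S * B

/-- The lower order terms of the bilinear form, integrated once: for `v` vanishing at `a` and `b`,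
`(γE' + cE, v) = -(lowerOrder γ c a E, v')`. -/
noncomputable def lowerOrder (γ c a : ℝ) (E : ℝ → ℝ) (x : ℝ) : ℝ := γ * E x + c * ∫ t in a..x, E t

theorem locBdd_lowerOrder (γ c a : ℝ) {E : ℝ → ℝ} (hE : LocBdd E) : LocBdd (lowerOrder γ c a E) :=
  (hE.const_mul γ).add ((hE.primitive a).const_mul c)

theorem abs_lowerOrder_le {γ c a b : ℝ} {E : ℝ → ℝ} (hE : LocBdd E) {ε : ℝ}
    (hε : ∀ x ∈ Icc a b, |E x| ≤ ε) {x : ℝ} (hx : x ∈ Icc a b) :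
    |lowerOrder γ c a E x| ≤ (|γ| + |c| * (b - a)) * ε := by
  have hε0 : 0 ≤ ε := (abs_nonneg _).trans (hε x hx)
  have h1 : |∫ t in a..x, E t| ≤ ε * (b - a) :=
    (hE.abs_integral_le hx.1 fun t ht => hε t ⟨ht.1.le, ht.2.le.trans hx.2⟩).trans
      (mul_le_mul_of_nonneg_left (by linarith [hx.2]) hε0)
  calc |lowerOrder γ c a E x| ≤ |γ * E x| + |c * ∫ t in a..x, E t| := abs_add_le _ _
    _ = |γ| * |E x| + |c| * |∫ t in a..x, E t| := by rw [abs_mul, abs_mul]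
    _ ≤ |γ| * ε + |c| * (ε * (b - a)) :=
      add_le_add (mul_le_mul_of_nonneg_left (hε x hx) (abs_nonneg _))
        (mul_le_mul_of_nonneg_left h1 (abs_nonneg _))
    _ = _ := by ring

/-- Integration by parts in the bilinear form: `D` is the flux of `E = ∫ w D`, and the test function
is the primitive of `k`. -/
theorem integral_form_eq {γ c a b : ℝ} {w D k : ℝ → ℝ} (hw : LocBdd w) (hD : LocBdd D)
    (hk : LocBdd k) (hk0 : ∫ x in a..b, k x = 0) :
    (∫ x in a..b, D x * k x) + (∫ x in a..b, γ * (w x * D x) * ∫ t in a..x, k t) +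
      (∫ x in a..b, c * (∫ t in a..x, w t * D t) * ∫ t in a..x, k t) =
    ∫ x in a..b, (D x - lowerOrder γ c a (fun y => ∫ t in a..y, w t * D t) x) * k x := by
  have hg := hw.mul hD
  have hE := hg.primitive a
  have hEE := hE.primitive a
  have h1 := hg.integral_primitive_mul hk a b
  have h2 := hE.integral_primitive_mul hk a b
  rw [hk0, mul_zero, zero_sub] at h1 h2
  have e1 : ∫ x in a..b, γ * (w x * D x) * ∫ t in a..x, k t =
      -∫ x in a..b, γ * ((∫ t in a..x, w t * D t) * k x) := by
    simp_rw [mul_assoc γ]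
    rw [intervalIntegral.integral_const_mul, intervalIntegral.integral_const_mul, h1]
    simp only [mul_assoc, mul_neg, neg_neg]
  have e2 : ∫ x in a..b, c * (∫ t in a..x, w t * D t) * ∫ t in a..x, k t =
      -∫ x in a..b, c * ((∫ s in a..x, ∫ t in a..s, w t * D t) * k x) := by
    simp_rw [mul_assoc c]
    rw [intervalIntegral.integral_const_mul, intervalIntegral.integral_const_mul, h2]
    simp only [mul_neg, neg_neg]
  rw [e1, e2, ← sub_eq_add_neg, ← sub_eq_add_neg,
    ← (hD.mul hk).integral_sub ((hE.mul hk).const_mul γ),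
    ← ((hD.mul hk).sub ((hE.mul hk).const_mul γ)).integral_sub ((hEE.mul hk).const_mul c)]
  congr 1; funext x; simp only [lowerOrder]; ring

namespace Mesh

variable {a b : ℝ} {T : Mesh a b} {w : ℝ → ℝ} {w₀ w₁ : ℝ} {p : ℕ}

variable (T w p) in
/-- `Q` is the elementwise `w`-weighted `L²` projection of `g` onto polynomials of degree less
than `p`. -/
def IsProj (g : ℝ → ℝ) (Q : Fin T.N → ℝ[X]) : Prop :=
  ∀ i, Q i ∈ degreeLT ℝ p ∧ ∀ q ∈ degreeLT ℝ p,
    ∫ x in T.left i..T.right i, w x * (Q i).eval x * q.eval x =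
      ∫ x in T.left i..T.right i, w x * g x * q.eval x

theorem exists_isProj (hw : IsWeight w w₀ w₁) {g : ℝ → ℝ} (hg : LocBdd g) :
    ∃ Q, T.IsProj w p g Q := by
  choose Q hQ using fun i => exists_projection hw p (T.left_lt_right i) hg
  exact ⟨Q, hQ⟩

theorem IsProj.orth_element (hw : LocBdd w) {g : ℝ → ℝ} (hg : LocBdd g) {Q : Fin T.N → ℝ[X]}
    (hQ : T.IsProj w p g Q) (i : Fin T.N) {q : ℝ[X]} (hq : q ∈ degreeLT ℝ p) :
    ∫ x in T.left i..T.right i, w x * (g x - T.pw Q x) * q.eval x = 0 := by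
  have h := (hQ i).2 q hq
  rw [← sub_eq_zero, ← ((hw.mul (.eval _)).mul (.eval _)).integral_sub
    ((hw.mul hg).mul (.eval _)), ← neg_eq_zero, ← intervalIntegral.integral_neg] at h
  rw [← h]
  refine integral_congr_Ioo (T.left_lt_right i).le fun x hx => ?_
  rw [pw_of_mem_Ioo Q hx]; ring

theorem IsProj.orth (hw : LocBdd w) {g : ℝ → ℝ} (hg : LocBdd g) {Q : Fin T.N → ℝ[X]}
    (hQ : T.IsProj w p g Q) {P : Fin T.N → ℝ[X]} (hP : ∀ i, P i ∈ degreeLT ℝ p) :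
    ∫ x in a..b, (g x - T.pw Q x) * (w x * T.pw P x) = 0 := by
  rw [← integral_mul_pw_eq_zero (hw.mul (hg.sub (locBdd_pw Q)))
    (fun i q hq => hQ.orth_element hw hg i hq) hP]
  congr 1; funext x; ring

/-- The primitive of the weighted projection error vanishes at the nodes. -/
theorem IsProj.primitive_node (hw : LocBdd w) (hp : 1 ≤ p) {g : ℝ → ℝ} (hg : LocBdd g)
    {Q : Fin T.N → ℝ[X]} (hQ : T.IsProj w p g Q) (j : Fin (T.N + 1)) :
    ∫ t in a..T.node j, w t * (g t - T.pw Q t) = 0 := by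
  have hl := hw.mul (hg.sub (locBdd_pw Q))
  refine T.node_induction (P := fun y => ∫ t in a..y, w t * (g t - T.pw Q t) = 0) (by simp)
    (fun i ih => ?_) j
  have h1 := hQ.orth_element hw hg i (q := 1) (mem_degreeLT_of_natDegree (by simp; omega))
  rw [← hl.integral_add_adjacent a (T.left i), ih, zero_add, ← h1]
  simp

theorem IsProj.primitive_eq (hw : LocBdd w) (hp : 1 ≤ p) {g : ℝ → ℝ} (hg : LocBdd g)
    {Q : Fin T.N → ℝ[X]} (hQ : T.IsProj w p g Q) (i : Fin T.N) (x : ℝ) :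
    ∫ t in a..x, w t * (g t - T.pw Q t) = ∫ t in T.left i..x, w t * (g t - T.pw Q t) := by
  have hl := hw.mul (hg.sub (locBdd_pw Q))
  rw [← hl.integral_add_adjacent a (T.left i) x]
  have : ∫ t in a..T.left i, w t * (g t - T.pw Q t) = 0 := hQ.primitive_node hw hp hg _
  rw [this, zero_add]

/-- For `p ≥ 2` the primitive of the weighted projection error has mean zero on each element, since
the error is also orthogonal to linear functions. -/
theorem IsProj.integral_primitive (hw : LocBdd w) (hp : 2 ≤ p) {g : ℝ → ℝ} (hg : LocBdd g)
    {Q : Fin T.N → ℝ[X]} (hQ : T.IsProj w p g Q) (i : Fin T.N) :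
    ∫ x in T.left i..T.right i, ∫ t in a..x, w t * (g t - T.pw Q t) = 0 := by
  have hl := hw.mul (hg.sub (locBdd_pw Q))
  simp_rw [hQ.primitive_eq hw (by omega) hg i]
  have h := hl.integral_primitive_mul (LocBdd.const 1) (T.left i) (T.right i)
  have h1 := hQ.orth_element hw hg i (q := 1) (mem_degreeLT_of_natDegree (by simp; omega))
  have h2 := hQ.orth_element hw hg i (q := X - C (T.left i))
    (mem_degreeLT_of_natDegree (by rw [natDegree_X_sub_C]; omega))
  simp only [eval_one, mul_one] at h1
  simp only [eval_sub, eval_X, eval_C] at h2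
  simp only [mul_one, h1, intervalIntegral.integral_const, smul_eq_mul, h2] at h
  rw [h]; ring

theorem exists_left_le {x : ℝ} (hx : x ∈ Ioc a b) :
    ∃ i, x ∈ Icc (T.left i) (T.right i) ∧ x - T.left i ≤ T.meshSize := by
  obtain ⟨i, hi⟩ := T.exists_mem_Ioc hx
  exact ⟨i, Ioc_subset_Icc_self hi, by linarith [T.sub_le_meshSize i, hi.2]⟩

theorem meshSize_nonneg (k : Fin T.N) : 0 ≤ T.meshSize :=
  (sub_pos.2 (T.left_lt_right k)).le.trans (T.sub_le_meshSize k)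

theorem meshSize_le (k : Fin T.N) : T.meshSize ≤ b - a := by
  have : Nonempty (Fin T.N) := ⟨k⟩
  exact ciSup_le fun i => by linarith [T.a_le_left i, T.right_le_b i]

/-- A primitive that is bounded by `z` at the nodes is bounded by `z` plus a multiple of the mesh
size. -/
theorem abs_primitive_le (k : Fin T.N) {g : ℝ → ℝ} (hg : LocBdd g) {z B : ℝ}
    (hB : ∀ x ∈ Icc a b, |g x| ≤ B) (hz : ∀ j, |∫ t in a..T.node j, g t| ≤ z) {x : ℝ}
    (hx : x ∈ Icc a b) : |∫ t in a..x, g t| ≤ z + B * T.meshSize := by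
  have hB0 : 0 ≤ B := (abs_nonneg _).trans (hB x hx)
  have hz0 : 0 ≤ z := (abs_nonneg _).trans (hz 0)
  have hh := meshSize_nonneg k
  rcases hx.1.eq_or_lt with rfl | h
  · simp; positivity
  · obtain ⟨i, hi, hi'⟩ := exists_left_le (T := T) ⟨h, hx.2⟩
    rw [← hg.integral_add_adjacent a (T.left i) x]
    refine (abs_add_le _ _).trans (add_le_add (hz _) ?_)
    refine (hg.abs_integral_le hi.1 fun t ht => hB t ?_).trans (mul_le_mul_of_nonneg_left hi' hB0)
    exact T.Icc_subset i ⟨ht.1.le, ht.2.le.trans hi.2⟩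

/-- The second primitive of the weighted projection error gains a further power of `h`. -/
theorem IsProj.abs_integral_primitive_le (k : Fin T.N) (hw : LocBdd w) (hp : 2 ≤ p) {g : ℝ → ℝ}
    (hg : LocBdd g) {Q : Fin T.N → ℝ[X]} (hQ : T.IsProj w p g Q) {ρ : ℝ}
    (hρ : ∀ x ∈ Icc a b, |∫ t in a..x, w t * (g t - T.pw Q t)| ≤ ρ) {x : ℝ} (hx : x ∈ Icc a b) :
    |∫ y in a..x, ∫ t in a..y, w t * (g t - T.pw Q t)| ≤ ρ * T.meshSize := by
  have hl := (hw.mul (hg.sub (locBdd_pw Q))).primitive a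
  have hnode := T.node_induction
    (P := fun z => ∫ y in a..z, ∫ t in a..y, w t * (g t - T.pw Q t) = 0) (by simp)
    fun i ih => by
      rw [← hl.integral_add_adjacent a (T.left i), ih, zero_add, hQ.integral_primitive hw hp hg]
  have := abs_primitive_le k hl hρ (z := 0) (fun j => by rw [hnode j, abs_zero]) hx
  rwa [zero_add] at this

/-- The correction function: its flux matches, against test fluxes, the term `γ r` for the primitive
`r` of the projection error, and it is one order smaller than `r`. -/
theorem IsProj.exists_correction (hab : a < b) (hw : IsWeight w w₀ w₁) (hp : 2 ≤ p) {k : Fin T.N}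
    (hconst : ∀ i, i ≠ k → ∃ ω : ℝ, ∀ x ∈ Ioo (T.left i) (T.right i), w x = ω)
    {S : ℝ} (hS0 : 0 ≤ S) (hS : IsStabilityConst p w S) {g : ℝ → ℝ} (hg : LocBdd g)
    {Q : Fin T.N → ℝ[X]} (hQ : T.IsProj w p g Q) {ρ : ℝ}
    (hρ : ∀ x ∈ Icc a b, |∫ t in a..x, w t * (g t - T.pw Q t)| ≤ ρ) (γ : ℝ) :
    ∃ Q₁ : Fin T.N → ℝ[X], (∀ i, Q₁ i ∈ degreeLT ℝ p) ∧ ∫ t in a..b, w t * T.pw Q₁ t = 0 ∧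
      (∀ x ∈ Icc a b,
        |∫ t in a..x, w t * T.pw Q₁ t| ≤ 2 * (w₁ * (1 + S) * |γ|) * (ρ * T.meshSize)) ∧
      ∀ P : Fin T.N → ℝ[X], (∀ i, P i ∈ degreeLT ℝ p) → ∫ t in a..b, w t * T.pw P t = 0 →
        ∫ x in a..b, (T.pw Q₁ x - γ * ∫ t in a..x, w t * (g t - T.pw Q t)) *
          (w x * T.pw P x) = 0 := by
  set r : ℝ → ℝ := fun x => ∫ t in a..x, w t * (g t - T.pw Q t) with hr
  have hrl : LocBdd r := (hw.locBdd.mul (hg.sub (locBdd_pw Q))).primitive a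
  have hh := meshSize_nonneg k
  have hρ0 : 0 ≤ ρ := (abs_nonneg _).trans (hρ a (left_mem_Icc.2 hab.le))
  have hw₁ := hw.w₁_pos
  obtain ⟨R, hR⟩ := exists_isProj (T := T) (p := p) hw (hrl.const_mul γ)
  have hwR := hw.locBdd.mul (locBdd_pw R)
  have hel : ∀ i, ∫ t in T.left i..T.right i, w t * T.pw R t =
      γ * ∫ t in T.left i..T.right i, w t * r t := by
    intro i
    have := (hR i).2 1 (mem_degreeLT_of_natDegree (by simp; omega))
    rw [integral_pw_on R (right_mem_Icc.2 (T.left_lt_right i).le),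
      ← intervalIntegral.integral_const_mul]
    simp only [eval_one, mul_one] at this
    rw [this]
    congr 1; funext x; ring
  -- Where the weight is constant, `∫ w R = γ ω ∫ r`, which vanishes as `r` has mean zero.
  have hel0 : ∀ i, i ≠ k → ∫ t in T.left i..T.right i, w t * T.pw R t = 0 := by
    intro i hi
    obtain ⟨ω, hω⟩ := hconst i hi
    rw [hel, integral_congr_Ioo (T.left_lt_right i).le (k := fun t => ω * r t)
      fun x hx => by rw [hω x hx], intervalIntegral.integral_const_mul,
      hQ.integral_primitive hw.locBdd hp hg]
    simp
  set zk := ∫ t in T.left k..T.right k, w t * T.pw R t with hzk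
  set z := w₁ * |γ| * (ρ * T.meshSize) with hz
  have hz0 : 0 ≤ z := by positivity
  have hzkb : |zk| ≤ z := by
    rw [hzk, hel, abs_mul]
    have h1 : |∫ t in T.left k..T.right k, w t * r t| ≤ w₁ * ρ * (T.right k - T.left k) := by
      refine (hw.locBdd.mul hrl).abs_integral_le (T.left_lt_right k).le fun x hx => ?_
      rw [abs_mul]
      exact mul_le_mul (hw.abs_le x) (hρ x (T.Icc_subset k (Ioo_subset_Icc_self hx)))
        (abs_nonneg _) hw₁.le
    calc |γ| * |∫ t in T.left k..T.right k, w t * r t|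
        ≤ |γ| * (w₁ * ρ * T.meshSize) := by
          refine mul_le_mul_of_nonneg_left (h1.trans ?_) (abs_nonneg _)
          exact mul_le_mul_of_nonneg_left (T.sub_le_meshSize k) (by positivity)
      _ = z := by rw [hz]; ring
  -- Only the interface element contributes to the nodal values.
  have hnode := T.node_induction
    (P := fun y => (y ≤ T.left k → ∫ t in a..y, w t * T.pw R t = 0) ∧
      (T.left k < y → ∫ t in a..y, w t * T.pw R t = zk))
    ⟨fun _ => by simp, fun h => absurd (T.a_le_left k) (not_le.2 h)⟩ fun i ih => by
      rw [← hwR.integral_add_adjacent a (T.left i)]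
      rcases lt_trichotomy i k with h | rfl | h
      · have h1 := T.right_le_left h
        have h2 := T.left_lt_right i
        rw [hel0 i h.ne, add_zero]
        exact ⟨fun _ => ih.1 (by linarith), fun h' => by linarith⟩
      · have h2 := T.left_lt_right i
        rw [ih.1 le_rfl, zero_add]
        exact ⟨fun h' => by linarith, fun _ => rfl⟩
      · have h1 := T.right_le_left h
        have h2 := T.left_lt_right k
        have h3 := T.left_lt_right i
        rw [hel0 i h.ne', add_zero]
        exact ⟨fun h' => by linarith, fun _ => ih.2 (by linarith)⟩
  have hnodeb : ∀ j, |∫ t in a..T.node j, w t * T.pw R t| ≤ z := by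
    intro j
    rcases le_or_gt (T.node j) (T.left k) with h | h
    · rw [(hnode j).1 h, abs_zero]; exact hz0
    · rw [(hnode j).2 h]; exact hzkb
  have hRb : ∀ i, ∀ x ∈ Icc (T.left i) (T.right i), |(R i).eval x| ≤ S * (|γ| * ρ) := by
    intro i
    refine hS _ _ (T.left_lt_right i) (R i) (hR i).1 _ (hrl.const_mul γ) (|γ| * ρ)
      (fun x hx => ?_) (hR i).2
    rw [abs_mul]
    exact mul_le_mul_of_nonneg_left (hρ x (T.Icc_subset i (Ioo_subset_Icc_self hx))) (abs_nonneg _)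
  have hpwb : ∀ x ∈ Icc a b, |w x * T.pw R x| ≤ w₁ * (S * (|γ| * ρ)) := by
    intro x hx
    rw [abs_mul]
    refine mul_le_mul (hw.abs_le x) ?_ (abs_nonneg _) hw₁.le
    rcases hx.1.eq_or_lt with rfl | h
    · have : T.pw R a = 0 := by
        rw [pw]
        refine Finset.sum_eq_zero fun i _ => indicator_of_notMem (fun h => ?_) _
        exact absurd (T.a_le_left i) (not_le.2 h.1)
      rw [this, abs_zero]; positivity
    · obtain ⟨i, hi⟩ := T.exists_mem_Ioc ⟨h, hx.2⟩
      rw [pw_of_mem R hi]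
      exact hRb i x (Ioc_subset_Icc_self hi)
  set z' := w₁ * (1 + S) * |γ| * (ρ * T.meshSize) with hz'
  have hZ : ∀ x ∈ Icc a b, |∫ t in a..x, w t * T.pw R t| ≤ z' := fun x hx =>
    (abs_primitive_le k hwR hpwb hnodeb hx).trans_eq (by rw [hz, hz']; ring)
  have hW : 0 < ∫ t in a..b, w t := by
    refine (mul_pos hw.pos (sub_pos.2 hab)).trans_le ?_
    have := (LocBdd.const w₀).integral_mono hw.locBdd hab.le fun x _ => hw.le x
    simpa [mul_comm] using this
  -- Subtracting a constant flux restores the boundary condition at `b`; a constant is orthogonal to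
  -- the admissible test fluxes.
  set μ := (∫ t in a..b, w t * T.pw R t) / ∫ t in a..b, w t with hμ
  have hsplit : ∀ x ∈ Icc a b, ∫ t in a..x, w t * T.pw (fun i => R i - C μ) t =
      (∫ t in a..x, w t * T.pw R t) - μ * ∫ t in a..x, w t := by
    intro x hx
    rw [← intervalIntegral.integral_const_mul, ← hwR.integral_sub (hw.locBdd.const_mul μ)]
    refine integral_congr_Ioo hx.1 fun t ht => ?_
    rw [pw_sub R, pw_const μ ⟨ht.1, ht.2.le.trans hx.2⟩]; ring
  have hdeg : ∀ i, R i - C μ ∈ degreeLT ℝ p := fun i =>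
    Submodule.sub_mem _ (hR i).1 (mem_degreeLT_of_natDegree (by simp; omega))
  refine ⟨fun i => R i - C μ, hdeg, ?_, fun x hx => ?_, fun P hP hP0 => ?_⟩
  · rw [hsplit b (right_mem_Icc.2 hab.le), hμ, div_mul_cancel₀ _ hW.ne', sub_self]
  · rw [hsplit x hx]
    have h1 : 0 ≤ ∫ t in a..x, w t :=
      intervalIntegral.integral_nonneg hx.1 fun t _ => (hw.pos' t).le
    have h2 : ∫ t in a..x, w t ≤ ∫ t in a..b, w t := by
      rw [← hw.locBdd.integral_add_adjacent a x b]
      have := intervalIntegral.integral_nonneg (μ := volume) hx.2 fun t _ => (hw.pos' t).le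
      linarith
    have h3 : |μ * ∫ t in a..x, w t| ≤ z' := by
      rw [abs_mul, abs_of_nonneg h1, hμ, abs_div, abs_of_pos hW, div_mul_eq_mul_div,
        div_le_iff₀ hW]
      exact mul_le_mul (hZ b (right_mem_Icc.2 hab.le)) h2 h1 ((abs_nonneg _).trans (hZ x hx))
    calc |(∫ t in a..x, w t * T.pw R t) - μ * ∫ t in a..x, w t| ≤ z' + z' :=
          (abs_sub _ _).trans (add_le_add (hZ x hx) h3)
      _ = _ := by rw [hz']; ring
  · have h1 := hR.orth hw.locBdd (hrl.const_mul γ) hP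
    have hwP := hw.locBdd.mul (locBdd_pw P)
    have h2 : ∫ x in a..b, (T.pw (fun i => R i - C μ) x - γ * r x) * (w x * T.pw P x) =
        (-∫ x in a..b, (γ * r x - T.pw R x) * (w x * T.pw P x)) -
          μ * ∫ x in a..b, w x * T.pw P x := by
      rw [← intervalIntegral.integral_neg, ← intervalIntegral.integral_const_mul,
        ← ((((hrl.const_mul γ).sub (locBdd_pw R)).mul hwP).neg).integral_sub (hwP.const_mul μ)]
      refine integral_congr_Ioo hab.le fun t ht => ?_
      rw [pw_sub R, pw_const μ (Ioo_subset_Ioc_self ht)]; ring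
    rw [h2, h1, hP0]; simp

end Mesh

/-- Cauchy–Schwarz inequality. -/
theorem sq_integral_abs_le {a b : ℝ} (hab : a < b) {g : ℝ → ℝ} (hg : LocBdd g) :
    (∫ x in a..b, |g x|) ^ 2 ≤ (b - a) * ∫ x in a..b, g x ^ 2 := by
  have hd : 0 < b - a := sub_pos.2 hab
  set X := ∫ x in a..b, |g x| with hX
  set m := X / (b - a) with hm
  have hg2 : LocBdd fun x => g x ^ 2 := by simpa [sq] using hg.mul hg
  have h : 0 ≤ ∫ x in a..b, (|g x| - m) ^ 2 :=
    intervalIntegral.integral_nonneg hab.le fun x _ => sq_nonneg _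
  have e : ∀ x, (|g x| - m) ^ 2 = g x ^ 2 - 2 * m * |g x| + m ^ 2 := fun x => by
    rw [← sq_abs (g x)]; ring
  simp_rw [e] at h
  rw [(hg2.sub (hg.abs.const_mul _)).integral_add (.const _), hg2.integral_sub
    (hg.abs.const_mul _), intervalIntegral.integral_const_mul, ← hX,
    intervalIntegral.integral_const, smul_eq_mul] at h
  have e2 : (b - a) * m = X := by rw [hm]; field_simp
  nlinarith

/-- Coercivity bounds the maximum norm of a discrete function by the data. -/
theorem abs_primitive_le_of_coercive {a b κ B : ℝ} (hab : a < b) (hκ : 0 < κ) {k A J : ℝ → ℝ}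
    (hk : LocBdd k) (hJ : LocBdd J) (hJB : ∀ x ∈ Icc a b, |J x| ≤ B)
    (hA : ∫ x in a..b, A x * k x = ∫ x in a..b, J x * k x)
    (hcoer : κ * ∫ x in a..b, k x ^ 2 ≤ ∫ x in a..b, A x * k x) {x : ℝ} (hx : x ∈ Icc a b) :
    |∫ t in a..x, k t| ≤ (b - a) / κ * B := by
  have hd : 0 < b - a := sub_pos.2 hab
  have hB0 : 0 ≤ B := (abs_nonneg _).trans (hJB x hx)
  set X := ∫ x in a..b, |k x| with hX
  have h1 : |∫ t in a..x, k t| ≤ X := by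
    refine (intervalIntegral.abs_integral_le_integral_abs hx.1).trans ?_
    rw [hX, ← hk.abs.integral_add_adjacent a x b]
    have := intervalIntegral.integral_nonneg (μ := volume) hx.2 fun t _ => abs_nonneg (k t)
    linarith
  have hX0 : 0 ≤ X := (abs_nonneg _).trans h1
  have h2 : ∫ x in a..b, J x * k x ≤ B * X := by
    rw [hX, ← intervalIntegral.integral_const_mul]
    refine (hJ.mul hk).integral_mono (hk.abs.const_mul B) hab.le fun t ht => ?_
    refine (le_abs_self _).trans ?_
    rw [abs_mul]
    exact mul_le_mul_of_nonneg_right (hJB t (Ioo_subset_Icc_self ht)) (abs_nonneg _)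
  have h3 := sq_integral_abs_le hab hk
  rw [← hX] at h3
  refine h1.trans ?_
  rcases hX0.eq_or_lt with h0 | h0
  · rw [← h0]; positivity
  rw [div_mul_eq_mul_div, le_div_iff₀ hκ]
  refine le_of_mul_le_mul_right ?_ h0
  calc X * κ * X = κ * X ^ 2 := by ring
    _ ≤ κ * ((b - a) * ∫ x in a..b, k x ^ 2) := mul_le_mul_of_nonneg_left h3 hκ.le
    _ = (b - a) * (κ * ∫ x in a..b, k x ^ 2) := by ring
    _ ≤ (b - a) * (B * X) :=
      mul_le_mul_of_nonneg_left (hcoer.trans (hA.trans_le h2)) hd.le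
    _ = (b - a) * B * X := by ring

end Supercloseness

/-! ### Supercloseness -/

section Error

namespace Mesh

variable {a b : ℝ} {T : Mesh a b} {w : ℝ → ℝ} {w₀ w₁ : ℝ} {p : ℕ}

/-- Supercloseness: up to a quantity one order smaller, the error `e` of the Galerkin solution with
flux `Q_h` is the primitive `r` of the projection error of the exact flux `F`. -/
theorem supercloseness (hab : a < b) (hw : IsWeight w w₀ w₁) (hp : 2 ≤ p) {k : Fin T.N}
    (hconst : ∀ i, i ≠ k → ∃ ω : ℝ, ∀ x ∈ Ioo (T.left i) (T.right i), w x = ω)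
    {S : ℝ} (hS0 : 0 ≤ S) (hS : IsStabilityConst p w S) {γ c κ : ℝ} (hκ : 0 < κ)
    {F : ℝ → ℝ} (hF : LocBdd F) (hF0 : ∫ t in a..b, w t * F t = 0)
    {Qh : Fin T.N → ℝ[X]} (hQh : ∀ i, Qh i ∈ degreeLT ℝ p)
    (hQh0 : ∫ t in a..b, w t * T.pw Qh t = 0)
    (hgal : ∀ P : Fin T.N → ℝ[X], (∀ i, P i ∈ degreeLT ℝ p) → ∫ t in a..b, w t * T.pw P t = 0 →
      ∫ x in a..b, ((F x - T.pw Qh x) -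
        lowerOrder γ c a (fun y => ∫ t in a..y, w t * (F t - T.pw Qh t)) x) *
          (w x * T.pw P x) = 0)
    (hcoer : ∀ P : Fin T.N → ℝ[X], (∀ i, P i ∈ degreeLT ℝ p) → ∫ t in a..b, w t * T.pw P t = 0 →
      κ * ∫ x in a..b, (w x * T.pw P x) ^ 2 ≤ ∫ x in a..b, (T.pw P x -
        lowerOrder γ c a (fun y => ∫ t in a..y, w t * T.pw P t) x) * (w x * T.pw P x))
    {QF : Fin T.N → ℝ[X]} (hQF : T.IsProj w p F QF) {ρ : ℝ}
    (hρ : ∀ x ∈ Icc a b, |∫ t in a..x, w t * (F t - T.pw QF t)| ≤ ρ) {x : ℝ} (hx : x ∈ Icc a b) :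
    |(∫ t in a..x, w t * (F t - T.pw Qh t)) - ∫ t in a..x, w t * (F t - T.pw QF t)| ≤
      (2 * (w₁ * (1 + S) * |γ|) + (b - a) / κ *
        (|c| + (|γ| + |c| * (b - a)) * (2 * (w₁ * (1 + S) * |γ|)))) * (ρ * T.meshSize) := by
  obtain ⟨Q₁, hQ₁, hQ₁0, hv₁, horth₁⟩ :=
    hQF.exists_correction hab hw hp hconst hS0 hS hF hρ γ
  set c₁ := 2 * (w₁ * (1 + S) * |γ|) with hc₁
  -- The discrete function `θ` with flux `Θ`, for which `e = r + v₁ - θ`; here `v₁` is the correction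
  -- function with flux `Q₁`.
  set Θ : Fin T.N → ℝ[X] := fun i => Qh i - QF i + Q₁ i with hΘ
  have hΘd : ∀ i, Θ i ∈ degreeLT ℝ p := fun i =>
    Submodule.add_mem _ (Submodule.sub_mem _ (hQh i) (hQF i).1) (hQ₁ i)
  have hpwΘ : ∀ x, T.pw Θ x = T.pw Qh x - T.pw QF x + T.pw Q₁ x := fun x => by
    rw [hΘ, pw_add (fun i => Qh i - QF i) Q₁, pw_sub]
  have hlF := hw.locBdd.mul (hF.sub (locBdd_pw QF))
  have hlh := hw.locBdd.mul (hF.sub (locBdd_pw Qh))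
  have hl1 := hw.locBdd.mul (locBdd_pw Q₁)
  have hlΘ := hw.locBdd.mul (locBdd_pw Θ)
  have he : ∀ x, ∫ t in a..x, w t * (F t - T.pw Qh t) = (∫ t in a..x, w t * (F t - T.pw QF t)) +
      (∫ t in a..x, w t * T.pw Q₁ t) - ∫ t in a..x, w t * T.pw Θ t := by
    intro x
    rw [← hlF.integral_add hl1, ← (hlF.add hl1).integral_sub hlΘ]
    congr 1; funext t; rw [hpwΘ]; ring
  have hΘ0 : ∫ t in a..b, w t * T.pw Θ t = 0 := by
    have h1 := he b
    have h2 : ∫ t in a..b, w t * (F t - T.pw QF t) = 0 := by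
      have := hQF.primitive_node hw.locBdd (by omega) hF (Fin.last _)
      rwa [T.node_last] at this
    have h3 : ∫ t in a..b, w t * (F t - T.pw Qh t) = 0 := by
      simp_rw [mul_sub]
      rw [(hw.locBdd.mul hF).integral_sub (hw.locBdd.mul (locBdd_pw Qh)), hF0, hQh0, sub_zero]
    rw [h2, h3, hQ₁0] at h1
    linarith
  have hlow : ∀ x, lowerOrder γ c a (fun y => ∫ t in a..y, w t * (F t - T.pw Qh t)) x =
      γ * (∫ t in a..x, w t * (F t - T.pw QF t)) +
      c * (∫ y in a..x, ∫ t in a..y, w t * (F t - T.pw QF t)) +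
      lowerOrder γ c a (fun y => ∫ t in a..y, w t * T.pw Q₁ t) x -
      lowerOrder γ c a (fun y => ∫ t in a..y, w t * T.pw Θ t) x := by
    intro x
    simp only [lowerOrder, he]
    rw [((hlF.primitive a).add (hl1.primitive a)).integral_sub (hlΘ.primitive a),
      (hlF.primitive a).integral_add (hl1.primitive a)]
    ring
  -- The remaining data `J` of the equation for `θ`: the term `γ r` has been cancelled by the flux of
  -- `v₁`, and the projection error by orthogonality.
  set J : ℝ → ℝ := fun x => -(c * (∫ y in a..x, ∫ t in a..y, w t * (F t - T.pw QF t)) +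
    lowerOrder γ c a (fun y => ∫ t in a..y, w t * T.pw Q₁ t) x) with hJ
  have hL1 := locBdd_lowerOrder γ c a (hl1.primitive a)
  have hLΘ := locBdd_lowerOrder γ c a (hlΘ.primitive a)
  have hJl : LocBdd J := ((((hlF.primitive a).primitive a).const_mul c).add hL1).neg
  have hJb : ∀ x ∈ Icc a b, |J x| ≤
      (|c| + (|γ| + |c| * (b - a)) * c₁) * (ρ * T.meshSize) := by
    intro x hx
    rw [hJ, abs_neg]
    have h1 := hQF.abs_integral_primitive_le k hw.locBdd hp hF hρ hx
    have h2 := abs_lowerOrder_le (γ := γ) (c := c) (hl1.primitive a) hv₁ hx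
    refine (abs_add_le _ _).trans ?_
    rw [abs_mul]
    have h3 := mul_le_mul_of_nonneg_left h1 (abs_nonneg c)
    linarith
  have hA : ∫ x in a..b, (T.pw Θ x - lowerOrder γ c a (fun y => ∫ t in a..y, w t * T.pw Θ t) x) *
      (w x * T.pw Θ x) = ∫ x in a..b, J x * (w x * T.pw Θ x) := by
    have h1 := hgal Θ hΘd hΘ0
    have h2 := hQF.orth hw.locBdd hF hΘd
    have h3 := horth₁ Θ hΘd hΘ0
    have l2 := (hF.sub (locBdd_pw QF)).mul hlΘ
    have l3 := ((locBdd_pw Q₁).sub ((hlF.primitive a).const_mul γ)).mul hlΘ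
    have l4 := ((locBdd_pw Θ).sub hLΘ).mul hlΘ
    have l5 := hJl.mul hlΘ
    have h4 : ∫ x in a..b, ((F x - T.pw Qh x) -
        lowerOrder γ c a (fun y => ∫ t in a..y, w t * (F t - T.pw Qh t)) x) * (w x * T.pw Θ x) =
        (∫ x in a..b, (F x - T.pw QF x) * (w x * T.pw Θ x)) +
        (∫ x in a..b, (T.pw Q₁ x - γ * ∫ t in a..x, w t * (F t - T.pw QF t)) *
          (w x * T.pw Θ x)) +
        (∫ x in a..b, J x * (w x * T.pw Θ x)) -
        ∫ x in a..b, (T.pw Θ x - lowerOrder γ c a (fun y => ∫ t in a..y, w t * T.pw Θ t) x) *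
          (w x * T.pw Θ x) := by
      rw [← l2.integral_add l3, ← (l2.add l3).integral_add l5,
        ← ((l2.add l3).add l5).integral_sub l4]
      congr 1; funext x
      simp only [hlow, hJ, hpwΘ]
      ring
    rw [h1, h2, h3] at h4
    linarith
  have hθ := abs_primitive_le_of_coercive hab hκ hlΘ hJl hJb hA (hcoer Θ hΘd hΘ0) hx
  have hv := hv₁ x hx
  have : (∫ t in a..x, w t * (F t - T.pw Qh t)) - ∫ t in a..x, w t * (F t - T.pw QF t) =
      (∫ t in a..x, w t * T.pw Q₁ t) - ∫ t in a..x, w t * T.pw Θ t := by rw [he x]; ring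
  rw [this]
  refine (abs_sub _ _).trans ((add_le_add hv hθ).trans_eq ?_)
  ring

/-- The flux of the Galerkin solution is close to the projection of the exact flux, elementwise and
independently of the size of the element, as soon as the error is small in the maximum norm. -/
theorem abs_projection_sub_flux_le (hab : a < b) (hw : IsWeight w w₀ w₁) (hp : 1 ≤ p)
    {S : ℝ} (hS : IsStabilityConst p w S) {γ c : ℝ}
    {F : ℝ → ℝ} (hF : LocBdd F) (hF0 : ∫ t in a..b, w t * F t = 0)
    {Qh : Fin T.N → ℝ[X]} (hQh : ∀ i, Qh i ∈ degreeLT ℝ p)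
    (hQh0 : ∫ t in a..b, w t * T.pw Qh t = 0)
    (hgal : ∀ P : Fin T.N → ℝ[X], (∀ i, P i ∈ degreeLT ℝ p) → ∫ t in a..b, w t * T.pw P t = 0 →
      ∫ x in a..b, ((F x - T.pw Qh x) -
        lowerOrder γ c a (fun y => ∫ t in a..y, w t * (F t - T.pw Qh t)) x) *
          (w x * T.pw P x) = 0)
    {QF : Fin T.N → ℝ[X]} (hQF : T.IsProj w p F QF) {ε : ℝ}
    (hε : ∀ x ∈ Icc a b, |∫ t in a..x, w t * (F t - T.pw Qh t)| ≤ ε) (i : Fin T.N) {x : ℝ}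
    (hx : x ∈ Icc (T.left i) (T.right i)) :
    |(QF i).eval x - (Qh i).eval x| ≤ 2 * S * (|γ| + |c| * (b - a)) * ε := by
  have hlh := hw.locBdd.mul (hF.sub (locBdd_pw Qh))
  set K : ℝ → ℝ := lowerOrder γ c a fun y => ∫ t in a..y, w t * (F t - T.pw Qh t) with hK
  have hKl : LocBdd K := locBdd_lowerOrder γ c a (hlh.primitive a)
  set B := (|γ| + |c| * (b - a)) * ε with hB
  have hKb : ∀ x ∈ Icc a b, |K x| ≤ B := fun x hx => abs_lowerOrder_le (hlh.primitive a) hε hx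
  have hB0 : 0 ≤ B := (abs_nonneg _).trans (hKb a (left_mem_Icc.2 hab.le))
  have hW : 0 < ∫ t in a..b, w t := by
    refine (mul_pos hw.pos (sub_pos.2 hab)).trans_le ?_
    have := (LocBdd.const w₀).integral_mono hw.locBdd hab.le fun x _ => hw.le x
    simpa [mul_comm] using this
  set H : ℝ → ℝ := fun x => (F x - T.pw Qh x) - K x with hH
  have hHl : LocBdd H := (hF.sub (locBdd_pw Qh)).sub hKl
  have hwH := hw.locBdd.mul hHl
  set μ := (∫ t in a..b, w t * H t) / ∫ t in a..b, w t with hμ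
  -- Testing with all discrete functions shows that the projection of `H` is a global constant.
  have hloc : ∀ q ∈ degreeLT ℝ p, ∫ x in T.left i..T.right i, w x * (H x - μ) * q.eval x = 0 := by
    intro q hq
    -- The test flux is `q` on the `i`-th element and zero elsewhere, minus the constant that makes its
    -- `w`-weighted mean vanish.
    set s := (∫ t in T.left i..T.right i, w t * q.eval t) / ∫ t in a..b, w t with hs
    set G : Fin T.N → ℝ[X] := fun j => if j = i then q else 0 with hG
    have hGd : ∀ j, G j - C s ∈ degreeLT ℝ p := fun j => by
      refine Submodule.sub_mem _ ?_ (mem_degreeLT_of_natDegree (by simp; omega))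
      simp only [hG]; split_ifs
      · exact hq
      · exact Submodule.zero_mem _
    have hint : ∀ g, LocBdd g → ∫ x in a..b, g x * (w x * T.pw (fun j => G j - C s) x) =
        (∫ x in T.left i..T.right i, w x * g x * q.eval x) - s * ∫ x in a..b, w x * g x := by
      intro g hg
      have l1 := hw.locBdd.mul hg
      rw [← integral_mul_pw_single l1 i q, ← intervalIntegral.integral_const_mul,
        ← (l1.mul (locBdd_pw _)).integral_sub (l1.const_mul s)]
      refine integral_congr_Ioo hab.le fun x hx => ?_
      rw [pw_sub G, pw_const s (Ioo_subset_Ioc_self hx)]; ring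
    have h0 : ∫ t in a..b, w t * T.pw (fun j => G j - C s) t = 0 := by
      have := hint (fun _ => 1) (LocBdd.const 1)
      simp only [one_mul, mul_one] at this
      rw [this, hs, div_mul_cancel₀ _ hW.ne', sub_self]
    have h1 := hgal _ hGd h0
    rw [hint H hHl] at h1
    have e : ∀ x, w x * (H x - μ) * q.eval x = w x * H x * q.eval x - μ * (w x * q.eval x) :=
      fun x => by ring
    simp_rw [e]
    rw [(hwH.mul (.eval q)).integral_sub ((hw.locBdd.mul (.eval q)).const_mul μ),
      intervalIntegral.integral_const_mul, ← h1, hs, hμ]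
    ring
  have hμb : |μ| ≤ B := by
    have h1 : ∫ t in a..b, w t * H t = -∫ t in a..b, w t * K t := by
      have e : ∀ t, w t * H t = w t * F t - w t * T.pw Qh t - w t * K t := fun t => by
        simp only [hH]; ring
      simp_rw [e]
      rw [((hw.locBdd.mul hF).sub (hw.locBdd.mul (locBdd_pw Qh))).integral_sub
        (hw.locBdd.mul hKl), (hw.locBdd.mul hF).integral_sub (hw.locBdd.mul (locBdd_pw Qh)),
        hF0, hQh0]
      ring
    have h2 : |∫ t in a..b, w t * K t| ≤ B * ∫ t in a..b, w t := by
      refine (intervalIntegral.abs_integral_le_integral_abs hab.le).trans ?_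
      rw [← intervalIntegral.integral_const_mul]
      refine (hw.locBdd.mul hKl).abs.integral_mono (hw.locBdd.const_mul B) hab.le fun t ht => ?_
      rw [abs_mul, abs_of_pos (hw.pos' t), mul_comm]
      exact mul_le_mul_of_nonneg_right (hKb t (Ioo_subset_Icc_self ht)) (hw.pos' t).le
    rw [hμ, abs_div, abs_of_pos hW, h1, abs_neg, div_le_iff₀ hW]
    exact h2
  have hmain := hS (T.left i) (T.right i) (T.left_lt_right i) (QF i - Qh i)
    (Submodule.sub_mem _ (hQF i).1 (hQh i)) (fun x => K x + μ) (hKl.add (.const μ)) (2 * B)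
    (fun x hx => ?_) (fun q hq => ?_) x hx
  · rw [eval_sub] at hmain
    refine hmain.trans_eq ?_
    rw [hB]; ring
  · have := hKb x (T.Icc_subset i (Ioo_subset_Icc_self hx))
    refine (abs_add_le _ _).trans ?_
    linarith
  · have h1 := (hQF i).2 q hq
    have h2 := hloc q hq
    have e1 : ∀ x, w x * (QF i - Qh i).eval x * q.eval x =
        w x * (QF i).eval x * q.eval x - w x * (Qh i).eval x * q.eval x := fun x => by
      rw [eval_sub]; ring
    simp_rw [e1]
    rw [((hw.locBdd.mul (.eval _)).mul (.eval _)).integral_sub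
      ((hw.locBdd.mul (.eval _)).mul (.eval _)), h1,
      ← ((hw.locBdd.mul hF).mul (.eval _)).integral_sub ((hw.locBdd.mul (.eval _)).mul (.eval _)),
      ← sub_eq_zero, ← (((hw.locBdd.mul hF).mul (.eval _)).sub
        ((hw.locBdd.mul (.eval _)).mul (.eval _))).integral_sub
        ((hw.locBdd.mul (hKl.add (.const μ))).mul (.eval _)), ← h2]
    refine integral_congr_Ioo (T.left_lt_right i).le fun x hx => ?_
    simp only [hH]
    rw [pw_of_mem_Ioo Qh hx]; ring

/-- The projection error of a function that is close to a polynomial of degree less than `p`. -/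
theorem IsProj.abs_sub_le (hw : LocBdd w) {S : ℝ} (hS : IsStabilityConst p w S) {g : ℝ → ℝ}
    (hg : LocBdd g) {Q : Fin T.N → ℝ[X]} (hQ : T.IsProj w p g Q) {i : Fin T.N} {q : ℝ[X]}
    (hq : q ∈ degreeLT ℝ p) {A : ℝ[X]}
    (hA : ∀ q ∈ degreeLT ℝ p, ∫ t in T.left i..T.right i, w t * A.eval t * q.eval t = 0) {B : ℝ}
    (hB : ∀ x ∈ Ioo (T.left i) (T.right i), |g x - (A.eval x + q.eval x)| ≤ B) {x : ℝ}
    (hx : x ∈ Ioo (T.left i) (T.right i)) :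
    |g x - (Q i).eval x - A.eval x| ≤ (1 + S) * B := by
  have h := hS (T.left i) (T.right i) (T.left_lt_right i) (Q i - q)
    (Submodule.sub_mem _ (hQ i).1 hq) (fun x => g x - (A.eval x + q.eval x))
    (hg.sub ((LocBdd.eval A).add (.eval q))) B hB (fun q' hq' => ?_) x (Ioo_subset_Icc_self hx)
  · rw [eval_sub] at h
    have e : g x - (Q i).eval x - A.eval x =
        (g x - (A.eval x + q.eval x)) - ((Q i).eval x - q.eval x) := by ring
    rw [e]
    refine (abs_sub _ _).trans ?_
    linarith [hB x hx]
  · have h1 := (hQ i).2 q' hq'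
    have h2 := hA q' hq'
    have e1 : ∀ x, w x * (Q i - q).eval x * q'.eval x =
        w x * (Q i).eval x * q'.eval x - w x * q.eval x * q'.eval x := fun x => by
      rw [eval_sub]; ring
    have e2 : ∀ x, w x * (g x - (A.eval x + q.eval x)) * q'.eval x =
        w x * g x * q'.eval x - w x * A.eval x * q'.eval x - w x * q.eval x * q'.eval x :=
      fun x => by ring
    have lq := (hw.mul (.eval q)).mul (.eval q')
    have lA := (hw.mul (.eval A)).mul (.eval q')
    have lg := (hw.mul hg).mul (.eval q')
    simp_rw [e1, e2]
    rw [((hw.mul (.eval _)).mul (.eval _)).integral_sub lq, h1, (lg.sub lA).integral_sub lq,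
      lg.integral_sub lA, h2, sub_zero]

end Mesh

end Error

/-! ### Galerkin identities and superconvergence points -/

section Galerkin

theorem ae_deriv_eq {a b : ℝ} {g v : ℝ → ℝ} (hg : LocBdd g)
    (hv : ∀ x ∈ Icc a b, v x = ∫ t in a..x, g t) :
    ∀ᵐ x, x ∈ Ioo a b → deriv v x = g x := by
  filter_upwards [hg.ae_hasDerivAt a] with x hx hxI
  have : v =ᶠ[𝓝 x] fun x => ∫ t in a..x, g t := by
    filter_upwards [isOpen_Ioo.mem_nhds hxI] with y hy
    exact hv y (Ioo_subset_Icc_self hy)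
  rw [this.deriv_eq, hx.deriv]

theorem integral_congr_ae_Ioo {a b : ℝ} (hab : a ≤ b) {g k : ℝ → ℝ}
    (h : ∀ᵐ x, x ∈ Ioo a b → g x = k x) : ∫ x in a..b, g x = ∫ x in a..b, k x := by
  refine intervalIntegral.integral_congr_ae ?_
  have : ∀ᵐ x : ℝ, x ≠ b := by simp [ae_iff]
  filter_upwards [this, h] with x hx h hx'
  rw [uIoc_of_le hab] at hx'
  exact h ⟨hx'.1, lt_of_le_of_ne hx'.2 hx⟩

/-- The bilinear form in terms of the flux `D` of `u` and the derivative `k` of `v`. -/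
theorem bilin_eq {a b α βm βp γ c : ℝ} (hβm : 0 < βm) (hβp : 0 < βp) (hab : a ≤ b)
    {u v D k : ℝ → ℝ} (hD : LocBdd D) (hk : LocBdd k) (hk0 : ∫ x in a..b, k x = 0)
    (hu : ∀ x ∈ Icc a b, u x = ∫ t in a..x, (betaCoeff βm βp α t)⁻¹ * D t)
    (hv : ∀ x ∈ Icc a b, v x = ∫ t in a..x, k t) :
    bilin a b α βm βp γ c u v = ∫ x in a..b, (D x -
      lowerOrder γ c a (fun y => ∫ t in a..y, (betaCoeff βm βp α t)⁻¹ * D t) x) * k x := by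
  have hw := (isWeight_betaCoeff_inv hβm hβp α).locBdd
  have hdu := ae_deriv_eq (hw.mul hD) hu
  have hdv := ae_deriv_eq hk hv
  rw [← integral_form_eq hw hD hk hk0, bilin]
  congr 1
  · congr 1
    · refine integral_congr_ae_Ioo hab ?_
      filter_upwards [hdu, hdv] with x h1 h2 hx
      rw [h1 hx, h2 hx, mul_inv_cancel_left₀ (betaCoeff_pos hβm hβp α x).ne']
    · refine integral_congr_ae_Ioo hab ?_
      filter_upwards [hdu] with x h1 hx
      rw [h1 hx, hv x (Ioo_subset_Icc_self hx)]
  · refine integral_congr_Ioo hab fun x hx => ?_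
    rw [hu x (Ioo_subset_Icc_self hx), hv x (Ioo_subset_Icc_self hx)]

theorem eq_integral_flux {a b α βm βp : ℝ} (hβm : 0 < βm) (hβp : 0 < βp) {u F : ℝ → ℝ}
    (huc : ContinuousOn u (Icc a b)) (hua : u a = 0) (hF : LocBdd F)
    (hu : ∀ x ∈ Ioo a b, x ≠ α → HasDerivAt u ((betaCoeff βm βp α x)⁻¹ * F x) x) :
    ∀ x ∈ Icc a b, u x = ∫ t in a..x, (betaCoeff βm βp α t)⁻¹ * F t := by
  intro x hx
  have hw := (isWeight_betaCoeff_inv hβm hβp α).locBdd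
  rw [integral_eq_of_hasDerivAt_off_countable_of_le u _ hx.1 (countable_singleton α)
    (huc.mono (Icc_subset_Icc_right hx.2)) (fun t ht => hu t ⟨ht.1.1, ht.1.2.trans_le hx.2⟩ ht.2)
    ((hw.mul hF).intervalIntegrable _ _), hua, sub_zero]

theorem deriv_flux_eventuallyEq {a b α βm βp : ℝ} (hβm : 0 < βm) (hβp : 0 < βp) {u F : ℝ → ℝ}
    (hu : ∀ x ∈ Ioo a b, x ≠ α → HasDerivAt u ((betaCoeff βm βp α x)⁻¹ * F x) x) {x : ℝ}
    (hx : x ∈ Ioo a b) (hxα : x ≠ α) :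
    (fun y => betaCoeff βm βp α y * deriv u y) =ᶠ[𝓝 x] F := by
  filter_upwards [isOpen_Ioo.mem_nhds hx, isOpen_ne.mem_nhds hxα] with y hy hyα
  rw [(hu y hy hyα).deriv, mul_inv_cancel_left₀ (betaCoeff_pos hβm hβp α y).ne']

/-- The weak form of the interface problem, tested with a primitive that vanishes at the end
points. -/
theorem integral_rhs_eq {n : ℕ} {a b α βm βp γ c B : ℝ} (hβm : 0 < βm) (hβp : 0 < βp)
    (hα : α ∈ Ioo a b) {f u k : ℝ → ℝ} {F : ℕ → ℝ → ℝ} (hF : IsDerivChain (n + 1) a b α B F)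
    (hu' : ∀ x ∈ Ioo a b, x ≠ α → HasDerivAt u ((betaCoeff βm βp α x)⁻¹ * F 0 x) x)
    (hu : ∀ x ∈ Icc a b, u x = ∫ t in a..x, (betaCoeff βm βp α t)⁻¹ * F 0 t)
    (hf : SolvesInterfaceProblem a b α βm βp γ c f u)
    (hk : LocBdd k) (hk0 : ∫ x in a..b, k x = 0) :
    ∫ x in a..b, f x * ∫ t in a..x, k t = ∫ x in a..b, (F 0 x -
      lowerOrder γ c a (fun y => ∫ t in a..y, (betaCoeff βm βp α t)⁻¹ * F 0 t) x) * k x := by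
  have hab : a < b := hα.1.trans hα.2
  have hw := (isWeight_betaCoeff_inv hβm hβp α).locBdd
  have hF0 := hF.locBdd 0 (by omega)
  have hF1 := hF.locBdd 1 (by omega)
  have hV := hk.primitive a
  have hparts : ∫ x in a..b, F 0 x * k x = -∫ x in a..b, F 1 x * ∫ t in a..x, k t := by
    have h := hF1.integral_primitive_mul hk a b
    rw [hk0, mul_zero, zero_sub] at h
    rw [← h]
    have e : ∀ x ∈ Ioo a b, F 0 x * k x =
        (∫ t in a..x, F 1 t) * k x + (F 0 α - ∫ t in a..α, F 1 t) * k x := by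
      intro x hx
      have h1 := hF.integral_eq (j := 0) (by omega) hα hx
      rw [← hF1.integral_add_adjacent a α x]
      have h2 : F 0 x = F 0 α + ∫ t in α..x, F 1 t := by
        have : ∫ t in α..x, F 1 t = F 0 x - F 0 α := h1
        linarith
      rw [h2]; ring
    rw [integral_congr_Ioo hab.le e, ((hF1.primitive a).mul hk).integral_add (hk.const_mul _),
      intervalIntegral.integral_const_mul, hk0, mul_zero, add_zero]
  have hfe : ∀ᵐ x, x ∈ Ioo a b → f x * ∫ t in a..x, k t =
      (-(F 1 x * ∫ t in a..x, k t) + γ * ((betaCoeff βm βp α x)⁻¹ * F 0 x) * ∫ t in a..x, k t) +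
        c * (∫ t in a..x, (betaCoeff βm βp α t)⁻¹ * F 0 t) * ∫ t in a..x, k t := by
    have h1 := (ae_restrict_iff' (measurableSet_Ioo.union measurableSet_Ioo)).1 hf
    have h2 : ∀ᵐ x : ℝ, x ≠ α := by simp [ae_iff]
    filter_upwards [h1, h2] with x hx hxα hxI
    have hmem : x ∈ Ioo a α ∪ Ioo α b := by
      rcases hxα.lt_or_gt with h | h
      · exact .inl ⟨hxI.1, h⟩
      · exact .inr ⟨h, hxI.2⟩
    have h3 := hx hmem
    rw [(deriv_flux_eventuallyEq hβm hβp hu' hxI hxα).deriv_eq,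
      (hF.hasDerivAt 0 (by omega) x hxI hxα).deriv, (hu' x hxI hxα).deriv,
      hu x (Ioo_subset_Icc_self hxI)] at h3
    rw [← h3]; ring
  rw [integral_congr_ae_Ioo hab.le hfe, ← integral_form_eq hw hF0 hk hk0, hparts,
    ← intervalIntegral.integral_neg]
  have l1 := (hF1.mul hV).neg
  have l2 := ((hw.mul hF0).const_mul γ).mul hV
  have l3 := (((hw.mul hF0).primitive a).const_mul c).mul hV
  rw [(l1.add l2).integral_add l3, l1.integral_add l2]

namespace Mesh

variable {a b : ℝ} {T : Mesh a b}

/-- On the interior of an element a discrete function is differentiable off the interface, and its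
flux is a polynomial. -/
theorem hasDerivAt_of_eq_primitive {βm βp α : ℝ} {v : ℝ → ℝ} (hβm : 0 < βm) (hβp : 0 < βp)
    {Q : Fin T.N → ℝ[X]}
    (hv : ∀ x ∈ Icc a b, v x = ∫ t in a..x, (betaCoeff βm βp α t)⁻¹ * T.pw Q t) {i : Fin T.N}
    {x : ℝ} (hx : x ∈ Ioo (T.left i) (T.right i)) (hxα : x ≠ α) :
    HasDerivAt v ((betaCoeff βm βp α x)⁻¹ * (Q i).eval x) x := by
  have hl := (isWeight_betaCoeff_inv hβm hβp α).locBdd.mul (locBdd_pw Q)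
  have hE : (fun t => (betaCoeff βm βp α t)⁻¹ * T.pw Q t) =ᶠ[𝓝 x]
      fun t => (betaCoeff βm βp α x)⁻¹ * (Q i).eval t := by
    filter_upwards [betaCoeff_eventuallyEq (βm := βm) (βp := βp) hxα,
      isOpen_Ioo.mem_nhds hx] with t h1 h2
    rw [h1, pw_of_mem_Ioo Q h2]
  have hc : ContinuousAt (fun t => (betaCoeff βm βp α t)⁻¹ * T.pw Q t) x :=
    (continuous_const.mul (Q i).continuous).continuousAt.congr hE.symm
  have hd := intervalIntegral.integral_hasDerivAt_right (hl.intervalIntegrable a x)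
    (hl.meas.stronglyMeasurable.stronglyMeasurableAtFilter) hc
  rw [hE.eq_of_nhds] at hd
  refine hd.congr_of_eventuallyEq ?_
  filter_upwards [isOpen_Ioo.mem_nhds hx] with y hy
  exact hv y (T.Icc_subset i (Ioo_subset_Icc_self hy))

end Mesh

theorem isFluxAt_of_hasDerivAt {l r α βm βp : ℝ} (hβm : 0 < βm) (hβp : 0 < βp) {v F : ℝ → ℝ}
    (hv : ∀ x ∈ Ioo l r, x ≠ α → HasDerivAt v ((betaCoeff βm βp α x)⁻¹ * F x) x)
    (hF : ContinuousOn F (Ioo l r)) {x : ℝ} (hx : x ∈ Ioo l r) :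
    IsFluxAt βm βp α v x (F x) := by
  have hc : Tendsto F (𝓝[≠] x) (𝓝 (F x)) :=
    (hF.continuousAt (isOpen_Ioo.mem_nhds hx)).mono_left nhdsWithin_le_nhds
  refine hc.congr' ?_
  have h1 : ∀ᶠ y in 𝓝[≠] x, y ∈ Ioo l r := nhdsWithin_le_nhds (isOpen_Ioo.mem_nhds hx)
  have h2 : ∀ᶠ y in 𝓝[≠] x, y ≠ α := by
    by_cases h : x = α
    · subst h; exact self_mem_nhdsWithin
    · exact nhdsWithin_le_nhds (isOpen_ne.mem_nhds h)
  filter_upwards [h1, h2] with y hy hyα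
  rw [(hv y hy hyα).deriv, mul_inv_cancel_left₀ (betaCoeff_pos hβm hβp α y).ne']

end Galerkin

section Superconvergence

namespace Mesh

variable {a b : ℝ} {T : Mesh a b} {w : ℝ → ℝ} {w₀ w₁ : ℝ} {p : ℕ}

/-- To leading order, the error of the projection of a function of class `C^{p,1}` is on each element
a multiple of the orthogonal polynomial of degree `p`. -/
theorem IsProj.exists_expansion (hw : LocBdd w) {S : ℝ}
    (hS : IsStabilityConst p w S) {α B : ℝ} {F : ℕ → ℝ → ℝ} (hF : IsDerivChain p a b α B F)
    (hB : 0 ≤ B) {Q : Fin T.N → ℝ[X]} (hQ : T.IsProj w p (F 0) Q) {i : Fin T.N} {Φ : ℕ → ℝ → ℝ}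
    {A : ℕ → ℝ[X]} (hA : IsLobattoFamily w (T.left i) (T.right i) Φ A) :
    ∃ s : ℝ, ∀ x ∈ Ioo (T.left i) (T.right i),
      |F 0 x - (Q i).eval x - s * (A p).eval x| ≤ (1 + S) * (B * T.meshSize ^ (p + 1)) := by
  obtain ⟨P, hP, hPb⟩ := hF.exists_taylor (T.a_le_left i) (T.left_lt_right i) (T.right_le_b i)
  obtain ⟨s, q, hq, rfl⟩ := exists_eq_smul_add (hA.natDegree p) (hA.ne_zero p) hP
  refine ⟨s, fun x hx => ?_⟩
  have h := hQ.abs_sub_le hw hS (hF.locBdd 0 (Nat.zero_le p)) (i := i) hq (A := C s * A p)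
    (fun q' hq' => ?_) (B := B * T.meshSize ^ (p + 1)) (fun y hy => ?_) hx
  · simpa using h
  · have e : ∀ t, w t * (C s * A p).eval t * q'.eval t =
        s * (w t * (A p).eval t * q'.eval t) := fun t => by
      rw [eval_mul, eval_C]; ring
    simp_rw [e]
    rw [intervalIntegral.integral_const_mul, hA.orth p q' hq', mul_zero]
  · have h1 := hPb y hy
    rw [eval_add] at h1
    refine h1.trans (mul_le_mul_of_nonneg_left ?_ hB)
    exact pow_le_pow_left₀ (sub_pos.2 (T.left_lt_right i)).le (T.sub_le_meshSize i) _

/-- For the projection onto polynomials of degree at most `p`, a flux with `p` derivatives, the last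
one Lipschitz, already gives the optimal order `p + 2` of the primitive of the projection error. -/
theorem IsProj.abs_primitive_le_of_chain (hw : IsWeight w w₀ w₁) {S : ℝ} (hS0 : 0 ≤ S)
    (hS : IsStabilityConst (p + 1) w S) {α B : ℝ} {F : ℕ → ℝ → ℝ} (hF : IsDerivChain p a b α B F)
    (hB : 0 ≤ B) {Q : Fin T.N → ℝ[X]} (hQ : T.IsProj w (p + 1) (F 0) Q) (k : Fin T.N) {x : ℝ}
    (hx : x ∈ Icc a b) :
    |∫ t in a..x, w t * (F 0 t - T.pw Q t)| ≤ w₁ * (1 + S) * B * T.meshSize ^ (p + 2) := by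
  have hh := meshSize_nonneg k
  have hw₁ := hw.w₁_pos
  have hF0 := hF.locBdd 0 (Nat.zero_le p)
  rcases hx.1.eq_or_lt with rfl | h
  · simp only [intervalIntegral.integral_same, abs_zero]; positivity
  obtain ⟨i, hi, hi'⟩ := exists_left_le (T := T) ⟨h, hx.2⟩
  obtain ⟨P, hP, hPb⟩ := hF.exists_taylor (T.a_le_left i) (T.left_lt_right i) (T.right_le_b i)
  rw [hQ.primitive_eq hw.locBdd (by omega) hF0 i]
  have hb : ∀ t ∈ Ioo (T.left i) (T.right i), |w t * (F 0 t - T.pw Q t)| ≤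
      w₁ * ((1 + S) * (B * T.meshSize ^ (p + 1))) := by
    intro t ht
    rw [abs_mul, pw_of_mem_Ioo Q ht]
    refine mul_le_mul (hw.abs_le t) ?_ (abs_nonneg _) hw₁.le
    have h1 := hQ.abs_sub_le hw.locBdd hS hF0 (i := i) hP (A := 0) (fun q' _ => by simp)
      (B := B * T.meshSize ^ (p + 1)) (fun y hy => ?_) ht
    · simpa using h1
    · rw [eval_zero, zero_add]
      refine (hPb y hy).trans (mul_le_mul_of_nonneg_left ?_ hB)
      exact pow_le_pow_left₀ (sub_pos.2 (T.left_lt_right i)).le (T.sub_le_meshSize i) _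
  refine ((hw.locBdd.mul (hF0.sub (locBdd_pw Q))).abs_integral_le hi.1
    fun t ht => hb t ⟨ht.1, ht.2.trans_le hi.2⟩).trans ?_
  refine (mul_le_mul_of_nonneg_left hi' (by positivity)).trans_eq ?_
  ring

/-- At the zeros of the Lobatto function the primitive of the projection error gains a power
of `h`. -/
theorem IsProj.abs_primitive_le_of_lobatto (hw : IsWeight w w₀ w₁) (hp : 1 ≤ p) {S : ℝ}
    (hS0 : 0 ≤ S) (hS : IsStabilityConst p w S) {α B : ℝ} {F : ℕ → ℝ → ℝ}
    (hF : IsDerivChain p a b α B F)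
    (hB : 0 ≤ B) {Q : Fin T.N → ℝ[X]} (hQ : T.IsProj w p (F 0) Q) {i : Fin T.N} {Φ : ℕ → ℝ → ℝ}
    {A : ℕ → ℝ[X]} (hA : IsLobattoFamily w (T.left i) (T.right i) Φ A) {x : ℝ}
    (hx : x ∈ Icc (T.left i) (T.right i)) (hΦ : Φ (p + 1) x = 0) :
    |∫ t in a..x, w t * (F 0 t - T.pw Q t)| ≤ w₁ * (1 + S) * B * T.meshSize ^ (p + 2) := by
  have hh := meshSize_nonneg i
  have hw₁ := hw.w₁_pos
  have hF0 := hF.locBdd 0 (Nat.zero_le p)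
  obtain ⟨s, hs⟩ := hQ.exists_expansion hw.locBdd hS hF hB hA
  obtain ⟨s', hs', hint⟩ := hA.succ p
  rw [hint x hx] at hΦ
  have hz : ∫ t in T.left i..x, w t * (A p).eval t = 0 := (mul_eq_zero.1 hΦ).resolve_left hs'
  rw [hQ.primitive_eq hw.locBdd hp hF0 i]
  have l1 := hw.locBdd.mul (hF0.sub (locBdd_pw Q))
  have l2 := (hw.locBdd.mul (.eval (A p))).const_mul s
  have e : ∫ t in T.left i..x, w t * (F 0 t - T.pw Q t) =
      ∫ t in T.left i..x, (w t * (F 0 t - T.pw Q t) - s * (w t * (A p).eval t)) := by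
    rw [l1.integral_sub l2, intervalIntegral.integral_const_mul, hz, mul_zero, sub_zero]
  rw [e]
  refine ((l1.sub l2).abs_integral_le (B := w₁ * ((1 + S) * (B * T.meshSize ^ (p + 1)))) hx.1
    fun t ht => ?_).trans ?_
  · have ht' : t ∈ Ioo (T.left i) (T.right i) := ⟨ht.1, ht.2.trans_le hx.2⟩
    rw [pw_of_mem_Ioo Q ht']
    have e2 : w t * (F 0 t - (Q i).eval t) - s * (w t * (A p).eval t) =
        w t * (F 0 t - (Q i).eval t - s * (A p).eval t) := by ring
    rw [e2, abs_mul]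
    exact mul_le_mul (hw.abs_le t) (hs t ht') (abs_nonneg _) hw₁.le
  · refine (mul_le_mul_of_nonneg_left (by linarith [T.sub_le_meshSize i, hx.2] :
      x - T.left i ≤ T.meshSize) (by positivity)).trans_eq ?_
    ring

end Mesh

end Superconvergence

end IFE

theorem theorem4p2 (p : ℕ) (hp : 2 ≤ p) (a b βm βp γ c κ : ℝ)
    (hβm : 0 < βm) (hβp : 0 < βp) (hκ : 0 < κ) :
    ∃ C : ℝ, 0 < C ∧
      ∀ (α : ℝ), α ∈ Ioo a b →
      ∀ (T : IFE.Mesh a b) (k : Fin T.N), α ∈ Icc (T.left k) (T.right k) →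
      T.IsCoercive βm βp γ c α k p κ →
      ∀ (f u uh : ℝ → ℝ),
        IFE.MemTildeW (p + 2) ⊤ a b α βm βp u →
        IFE.SolvesInterfaceProblem a b α βm βp γ c f u →
        T.IsIFESolution βm βp γ c α k p f uh →
        -- mesh points
        (∀ j, |u (T.node j) - uh (T.node j)| ≤
            C * T.meshSize ^ (p + 2) * IFE.tildeNormInfty (p + 2) a b α u) ∧
        -- noninterface elements
        (∀ i, i ≠ k →
          (∀ x ∈ Icc (T.left i) (T.right i), T.lobattoOn i (p + 1) x = 0 →
            |u x - uh x| ≤ C * T.meshSize ^ (p + 2) * IFE.tildeNormInfty (p + 2) a b α u) ∧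
          (∀ x ∈ Ioo (T.left i) (T.right i), T.legendreOn i p x = 0 →
            DifferentiableAt ℝ u x ∧ DifferentiableAt ℝ uh x ∧
            |deriv u x - deriv uh x| ≤
              C * T.meshSize ^ (p + 1) * IFE.tildeNormInfty (p + 2) a b α u)) ∧
        -- the interface element
        (∀ x ∈ Icc (T.left k) (T.right k), T.genLobattoOn βm βp α k (p + 1) x = 0 →
          |u x - uh x| ≤ C * T.meshSize ^ (p + 2) * IFE.tildeNormInfty (p + 2) a b α u) ∧
        (∀ x ∈ Ioo (T.left k) (T.right k), T.genLegendreOn βm βp α k p x = 0 →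
          ∃ q qh : ℝ, IFE.IsFluxAt βm βp α u x q ∧ IFE.IsFluxAt βm βp α uh x qh ∧
            |q - qh| ≤ C * T.meshSize ^ (p + 1) * IFE.tildeNormInfty (p + 2) a b α u) := by
  rcases le_or_gt b a with hba | hab
  · exact ⟨1, one_pos, fun α hα => absurd (hα.1.trans hα.2) (not_lt.2 hba)⟩
  obtain ⟨m, rfl⟩ : ∃ m, p = m + 1 := ⟨p - 1, by omega⟩
  set w₀ := min βm⁻¹ βp⁻¹ with hw₀
  set w₁ := max βm⁻¹ βp⁻¹ with hw₁
  have hwα : ∀ α, IFE.IsWeight (fun x => (IFE.betaCoeff βm βp α x)⁻¹) w₀ w₁ :=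
    IFE.isWeight_betaCoeff_inv hβm hβp
  have hw₁0 : 0 < w₁ := (hwα 0).w₁_pos
  obtain ⟨S, hS0, hStab⟩ := IFE.exists_projection_stability (m + 1) (hwα 0).pos hw₁0
  have hd : 0 < b - a := sub_pos.2 hab
  have hbM : 0 < max βm βp := hβm.trans_le (le_max_left _ _)
  set Cr := w₁ * (1 + S) * max βm βp with hCr
  set Cd := 2 * (w₁ * (1 + S) * |γ|) + (b - a) / κ *
    (|c| + (|γ| + |c| * (b - a)) * (2 * (w₁ * (1 + S) * |γ|))) with hCd
  set Cf := (1 + S) * max βm βp +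
    2 * S * (|γ| + |c| * (b - a)) * ((1 + Cd * (b - a)) * Cr) with hCf
  have hCr0 : 0 < Cr := by positivity
  have hCd0 : 0 ≤ Cd := by positivity
  have hCf0 : 0 ≤ Cf := by positivity
  refine ⟨(1 + Cd) * Cr + (1 + w₁) * Cf, by positivity, ?_⟩
  intro α hα T k hαk hcoer f u uh hu hf huh
  have hw := hwα α
  set w : ℝ → ℝ := fun x => (IFE.betaCoeff βm βp α x)⁻¹ with hwdef
  have hS : IFE.IsStabilityConst (m + 1) w S := hStab w hw
  obtain ⟨F, hF, hu'⟩ := hu.exists_flux hβm hβp hα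
  set M := IFE.tildeNormInfty (m + 1 + 2) a b α u with hM
  have hM0 : 0 ≤ M := IFE.tildeNormInfty_nonneg _ _ _ _ _
  set h := T.meshSize with hh
  have hh0 : 0 ≤ h := IFE.Mesh.meshSize_nonneg k
  have hhd : h ≤ b - a := IFE.Mesh.meshSize_le k
  have hB0 : 0 ≤ max βm βp * M := by positivity
  have hF0 := hF.locBdd 0 (Nat.zero_le _)
  have huF := IFE.eq_integral_flux hβm hβp hu.1 hu.2.1 hF0 hu'
  obtain ⟨Qh, hQh, huhQ⟩ := IFE.Mesh.exists_pw_of_mem_ifeSpace hβm hβp hαk (by omega) huh.1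
  have hFb : ∫ t in a..b, w t * F 0 t = 0 := by
    rw [← huF b (right_mem_Icc.2 hab.le)]; exact hu.2.2.1
  have hQhb : ∫ t in a..b, w t * T.pw Qh t = 0 := by
    rw [← huhQ b (right_mem_Icc.2 hab.le)]; exact huh.1.1.2.2.1
  have he : ∀ x ∈ Icc a b, u x - uh x = ∫ t in a..x, w t * (F 0 t - T.pw Qh t) := by
    intro x hx
    simp_rw [mul_sub]
    rw [(hw.locBdd.mul hF0).integral_sub (hw.locBdd.mul (IFE.Mesh.locBdd_pw Qh)), huF x hx,
      huhQ x hx]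
  have hgal : ∀ P : Fin T.N → ℝ[X], (∀ i, P i ∈ Polynomial.degreeLT ℝ (m + 1)) →
      ∫ t in a..b, w t * T.pw P t = 0 →
      ∫ x in a..b, ((F 0 x - T.pw Qh x) -
        IFE.lowerOrder γ c a (fun y => ∫ t in a..y, w t * (F 0 t - T.pw Qh t)) x) *
          (w x * T.pw P x) = 0 := by
    intro P hP hP0
    have hk := hw.locBdd.mul (IFE.Mesh.locBdd_pw P)
    have hQl := IFE.Mesh.locBdd_pw Qh
    have h1 := huh.2 _ (IFE.Mesh.primitive_pw_mem_ifeSpace hβm hβp hαk (by omega) hP hP0)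
    rw [IFE.bilin_eq hβm hβp hab.le hQl hk hP0 huhQ (fun x _ => rfl),
      IFE.integral_rhs_eq hβm hβp hα hF hu' huF hf hk hP0] at h1
    have lF := hw.locBdd.mul hF0
    have lQ := hw.locBdd.mul hQl
    have l1 := (hF0.sub (IFE.locBdd_lowerOrder γ c a (lF.primitive a))).mul hk
    have l2 := (hQl.sub (IFE.locBdd_lowerOrder γ c a (lQ.primitive a))).mul hk
    rw [eq_comm, ← sub_eq_zero, ← l1.integral_sub l2] at h1
    rw [← h1]
    congr 1; funext x
    have e : ∀ y, ∫ t in a..y, w t * (F 0 t - T.pw Qh t) =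
        (∫ t in a..y, w t * F 0 t) - ∫ t in a..y, w t * T.pw Qh t := fun y => by
      rw [← lF.integral_sub lQ]; simp_rw [mul_sub]
    simp only [IFE.lowerOrder, e]
    rw [(lF.primitive a).integral_sub (lQ.primitive a)]
    ring
  have hcoer' : ∀ P : Fin T.N → ℝ[X], (∀ i, P i ∈ Polynomial.degreeLT ℝ (m + 1)) →
      ∫ t in a..b, w t * T.pw P t = 0 →
      κ * ∫ x in a..b, (w x * T.pw P x) ^ 2 ≤ ∫ x in a..b, (T.pw P x -
        IFE.lowerOrder γ c a (fun y => ∫ t in a..y, w t * T.pw P t) x) * (w x * T.pw P x) := by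
    intro P hP hP0
    have hPl := IFE.Mesh.locBdd_pw P
    have hk := hw.locBdd.mul hPl
    have h1 := hcoer _ (IFE.Mesh.primitive_pw_mem_ifeSpace hβm hβp hαk (by omega) hP hP0)
    rw [IFE.bilin_eq hβm hβp hab.le hPl hk hP0 (fun x _ => rfl) (fun x _ => rfl)] at h1
    refine le_trans (mul_le_mul_of_nonneg_left ?_ hκ.le) h1
    have h2 : 0 ≤ ∫ x in a..b, (∫ t in a..x, w t * T.pw P t) ^ 2 :=
      intervalIntegral.integral_nonneg hab.le fun x _ => sq_nonneg _
    have h3 : ∫ x in a..b, deriv (fun x => ∫ t in a..x, w t * T.pw P t) x ^ 2 =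
        ∫ x in a..b, (w x * T.pw P x) ^ 2 := by
      refine IFE.integral_congr_ae_Ioo hab.le ?_
      filter_upwards [IFE.ae_deriv_eq hk (fun x (_ : x ∈ Icc a b) => rfl)] with x hx hxI
      rw [hx hxI]
    rw [h3]
    linarith
  have hconst : ∀ i, i ≠ k → ∃ ω : ℝ, ∀ x ∈ Ioo (T.left i) (T.right i), w x = ω := by
    intro i hik
    obtain ⟨β, -, hβ⟩ := IFE.Mesh.betaCoeff_const (βm := βm) (βp := βp) hαk hik
    exact ⟨β⁻¹, fun x hx => by simp only [hwdef, hβ x hx]⟩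
  obtain ⟨QF, hQF⟩ := IFE.Mesh.exists_isProj (T := T) (p := m + 1) hw hF0
  set ρ := Cr * h ^ (m + 2) * M with hρ
  have hρ0 : 0 ≤ ρ := by positivity
  have hr : ∀ x ∈ Icc a b, |∫ t in a..x, w t * (F 0 t - T.pw QF t)| ≤ ρ := fun x hx =>
    (hQF.abs_primitive_le_of_chain hw hS0.le hS hF.of_succ hB0 k hx).trans_eq (by
      rw [hρ, hCr]; ring)
  have hsup : ∀ x ∈ Icc a b, |(∫ t in a..x, w t * (F 0 t - T.pw Qh t)) -
      ∫ t in a..x, w t * (F 0 t - T.pw QF t)| ≤ Cd * (ρ * h) := fun x hx =>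
    IFE.Mesh.supercloseness hab hw hp hconst hS0.le hS hκ hF0 hFb hQh hQhb hgal hcoer' hQF hr hx
  have hpow : ρ * h = Cr * h ^ (m + 1 + 2) * M := by rw [hρ]; ring
  -- Points at which the primitive of the projection error is superconvergent.
  have hval : ∀ x ∈ Icc a b, |∫ t in a..x, w t * (F 0 t - T.pw QF t)| ≤ ρ * h →
      |u x - uh x| ≤ ((1 + Cd) * Cr + (1 + w₁) * Cf) * h ^ (m + 1 + 2) * M := by
    intro x hx hrx
    rw [he x hx]
    have h1 := hsup x hx
    have h2 := abs_add_le ((∫ t in a..x, w t * (F 0 t - T.pw Qh t)) -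
      ∫ t in a..x, w t * (F 0 t - T.pw QF t)) (∫ t in a..x, w t * (F 0 t - T.pw QF t))
    rw [sub_add_cancel] at h2
    have h3 : 0 ≤ (1 + w₁) * Cf * (h ^ (m + 1 + 2) * M) := by positivity
    rw [hpow] at h1 hrx
    linarith
  have hLob : ∀ i (Φ : ℕ → ℝ → ℝ) (A : ℕ → ℝ[X]),
      IFE.IsLobattoFamily w (T.left i) (T.right i) Φ A →
      ∀ x ∈ Icc (T.left i) (T.right i), Φ (m + 1 + 1) x = 0 →
      |u x - uh x| ≤ ((1 + Cd) * Cr + (1 + w₁) * Cf) * h ^ (m + 1 + 2) * M := by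
    intro i Φ A hA x hx hΦ
    refine hval x (T.Icc_subset i hx) ?_
    refine (hQF.abs_primitive_le_of_lobatto hw (by omega) hS0.le hS hF hB0 hA hx hΦ).trans_eq ?_
    rw [hpow, hCr]; ring
  have hsupe : ∀ x ∈ Icc a b, |∫ t in a..x, w t * (F 0 t - T.pw Qh t)| ≤
      (1 + Cd * (b - a)) * ρ := by
    intro x hx
    have h1 := hsup x hx
    have h2 := abs_add_le ((∫ t in a..x, w t * (F 0 t - T.pw Qh t)) -
      ∫ t in a..x, w t * (F 0 t - T.pw QF t)) (∫ t in a..x, w t * (F 0 t - T.pw QF t))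
    rw [sub_add_cancel] at h2
    have h3 : Cd * (ρ * h) ≤ Cd * (ρ * (b - a)) := by gcongr
    linarith [hr x hx]
  have hflux : ∀ i (Φ : ℕ → ℝ → ℝ) (A : ℕ → ℝ[X]),
      IFE.IsLobattoFamily w (T.left i) (T.right i) Φ A →
      ∀ x ∈ Ioo (T.left i) (T.right i), (A (m + 1)).eval x = 0 →
      |F 0 x - (Qh i).eval x| ≤ Cf * h ^ (m + 1 + 1) * M := by
    intro i Φ A hA x hx hAx
    obtain ⟨s, hs⟩ := hQF.exists_expansion hw.locBdd hS hF hB0 hA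
    have h1 := hs x hx
    rw [hAx, mul_zero, sub_zero] at h1
    have h2 := IFE.Mesh.abs_projection_sub_flux_le hab hw (by omega) hS hF0 hFb hQh hQhb hgal hQF
      hsupe i (Ioo_subset_Icc_self hx)
    refine (abs_sub_le _ ((QF i).eval x) _).trans ((add_le_add h1 h2).trans_eq ?_)
    rw [hCf, hρ, ← hh]; ring
  have hCle : ∀ n, Cf * h ^ n * M ≤ ((1 + Cd) * Cr + (1 + w₁) * Cf) * h ^ n * M := by
    intro n
    have : Cf ≤ (1 + Cd) * Cr + (1 + w₁) * Cf := by
      have h1 : 0 ≤ (1 + Cd) * Cr := by positivity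
      have h2 : 0 ≤ w₁ * Cf := by positivity
      linarith
    gcongr
  refine ⟨fun j => ?_, fun i hik => ⟨fun x hx hΦ => ?_, fun x hx hP => ?_⟩, fun x hx hΦ => ?_,
    fun x hx hL => ?_⟩
  · refine hval _ ⟨T.a_le_node j, T.node_le_b j⟩ ?_
    rw [hQF.primitive_node hw.locBdd (by omega) hF0 j, abs_zero]
    positivity
  · exact hLob i _ _ (IFE.Mesh.isLobattoFamily_of_ne hβm hβp hαk hik) x hx hΦ
  · have hxα := IFE.Mesh.ne_of_mem_Ioo hαk hik hx
    have hxI : x ∈ Ioo a b := ⟨(T.a_le_left i).trans_lt hx.1, hx.2.trans_le (T.right_le_b i)⟩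
    have d1 := hu' x hxI hxα
    have d2 := IFE.Mesh.hasDerivAt_of_eq_primitive hβm hβp huhQ hx hxα
    refine ⟨d1.differentiableAt, d2.differentiableAt, ?_⟩
    have h1 := hflux i _ _ (IFE.Mesh.isLobattoFamily_of_ne hβm hβp hαk hik) x hx
      (by rw [IFE.Mesh.eval_pullback]; exact hP)
    rw [d1.deriv, d2.deriv, ← mul_sub, abs_mul]
    calc |(IFE.betaCoeff βm βp α x)⁻¹| * |F 0 x - (Qh i).eval x|
        ≤ w₁ * (Cf * h ^ (m + 1 + 1) * M) :=
          mul_le_mul (hw.abs_le x) h1 (abs_nonneg _) hw₁0.le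
      _ ≤ ((1 + Cd) * Cr + (1 + w₁) * Cf) * h ^ (m + 1 + 1) * M := by
          have h2 : 0 ≤ (1 + Cd) * Cr * (h ^ (m + 1 + 1) * M) := by positivity
          have h3 : 0 ≤ Cf * (h ^ (m + 1 + 1) * M) := by positivity
          linarith
  · exact hLob k _ _ (T.isLobattoFamily_genLobattoOn k hβm hβp hαk) x hx hΦ
  · have hxI : x ∈ Ioo a b := ⟨(T.a_le_left k).trans_lt hx.1, hx.2.trans_le (T.right_le_b k)⟩
    refine ⟨F 0 x, (Qh k).eval x,
      IFE.isFluxAt_of_hasDerivAt hβm hβp hu' (hF.continuousOn 0 (Nat.zero_le _)) hxI,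
      IFE.isFluxAt_of_hasDerivAt hβm hβp
        (fun y hy hyα => IFE.Mesh.hasDerivAt_of_eq_primitive hβm hβp huhQ hy hyα)
        (Qh k).continuous.continuousOn hx, ?_⟩
    exact (hflux k _ _ (T.isLobattoFamily_genLobattoOn k hβm hβp hαk) x hx
      (by rw [IFE.Mesh.eval_pullback]; exact hL)).trans (hCle _)
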